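/- Let $\alpha>\beta>-\tfrac12$ be real, $\rho=\alpha+\beta+1$, and let $R_0\in(1,\sqrt{\pi/2})$. For $\lambda\in\mathbb{R}$, $t\ge 0$ let $$\varphi_\lambda(t)={}_2F_1\bigl(\tfrac12(\rho-i\lambda),\tfrac12(\rho+i\lambda);\alpha+1;-\sinh^2t\bigr)$$ be the Jacobi function (where ${}_2F_1$ is continued analytically from the unit disc to a neighbourhood of the half line $(-\infty,0]$), let $$\mathbf{c}(\lambda)=\frac{2^{\rho}\,\Gamma(\tfrac12 i\lambda)\,\Gamma(\tfrac12(1+i\lambda))}{\Gamma(\tfrac12(\rho+i\lambda))\,\Gamma(\tfrac12(\rho+i\lambda)-\beta)},$$ let $d\mu(t)=\Delta(t)\,dt$ on $\mathbb{R}_+=(0,\infty)$ with $\Delta(t)=(2\sinh t)^{2\alpha+1}(2\cosh t)^{2\beta+1}$, and let $$K_R(t,r)=\int_0^R\varphi_\lambda(t)\varphi_\lambda(r)\,|\mathbf{c}(\lambda)|^{-2}\,d\lambda$$ be the Jacobi disc kernel. Put $K_{3,R}(t,r)=K_R(t,r)$ if $t<R_0/2$ and $r>R_0$, and $K_{3,R}(t,r)=0$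 otherwise, and let $$S_{3,R}f(t)=\int_0^\infty K_{3,R}(t,r)f(r)\,d\mu(r),\qquad S_{3,*}f(t)=\sup_{R>0}|S_{3,R}f(t)|\qquad(t>0).$$ (i) There is a constant $C>0$, depending only on $\alpha,\beta,R_0$, such that for all $R>1$, $0<t<R_0/2$ and $r>R_0$ $$|K_R(t,r)|\le C\,\frac{e^{-\rho r}}{t^{\alpha+1/2}}\,\frac1r ;$$ in particular, since $r>t$ and $\rho>0$, $|K_R(t,r)|\le C\,e^{-\rho t}\,t^{-(\alpha+1/2)}\,r^{-1}$. (ii) Let $1<p\le 2$. For every $f\in L^p(\mathbb{R}_+,d\mu)$ the integral defining $S_{3,R}f(t)$ converges absolutely for all $R>0$, $t>0$, the function $S_{3,*}f$ is $\mu$-measurable, and $$\|S_{3,*}f\|_{L^p(\mathbb{R}_+,d\mu)}\le C_p\,\|f\|_{L^p(\mathbb{R}_+,d\mu)}$$ with a constant $C_p$ depending only on $\alpha,\beta,R_0,p$. -/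

import Mathlib

namespace JacobiAnalysis

/-- Gauss' hypergeometric function on the half plane `Re z < 1/2`, which contains the half line
`z ≤ 0`. Mathlib's `₂F₁` is the sum of the power series, so it is meaningful only for `|z| < 1`.
The function below is holomorphic on `Re z < 1/2` (`hyp2F1_analyticOnNhd`) and agrees with the
power series near `0` (`hyp2F1_eq_of_small`), so it is the analytic continuation of the series
to that half plane. -/
noncomputable def hyp2F1 (a b c z : ℂ) : ℂ :=
  (1 - z) ^ (-a) * ₂F₁ a (c - b) c (z / (z - 1))

section Hypergeometric

open scoped Nat

lemma sum_choose_ascPochhammer (N : ℕ) : ∀ c d : ℂ, ∑ x ∈ Finset.HasAntidiagonal.antidiagonal N, (N.choose x.1 : ℂ) * ((-1) ^ x.1 *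
    (ascPochhammer ℂ x.1).eval d * (ascPochhammer ℂ x.2).eval (c + x.1)) =
    (ascPochhammer ℂ N).eval (c - d) := by
  induction N with
  | zero => simp
  | succ N ih =>
    intro c d
    have key : (ascPochhammer ℂ (N + 1)).eval (c - d) =
        (c - d) * (ascPochhammer ℂ N).eval (c + 1 - d) := by
      rw [ascPochhammer_succ_left]
      simp
      left; congr 1; ring
    rw [key, ← ih (c + 1) d, Finset.sum_antidiagonal_choose_succ_mul
      (fun i j => (-1) ^ i * (ascPochhammer ℂ i).eval d * (ascPochhammer ℂ j).eval (c + i)),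
      ← Finset.sum_add_distrib, Finset.mul_sum]
    refine Finset.sum_congr rfl fun x hx => ?_
    have hx' : x.1 + x.2 = N := by simpa using hx
    have e : N.choose x.2 = N.choose x.1 := by
      rw [← hx', Nat.choose_symm_add]
    have e2 : (ascPochhammer ℂ (x.2 + 1)).eval (c + x.1) =
        (c + x.1) * (ascPochhammer ℂ x.2).eval (c + 1 + x.1) := by
      rw [ascPochhammer_succ_left]
      simp
      left; congr 1; ring
    rw [e, e2, ascPochhammer_succ_eval]
    push_cast
    rw [show c + ((x.1 : ℂ) + 1) = c + 1 + x.1 by ring]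
    ring

lemma ascPochhammer_eval_add (a : ℂ) (n m : ℕ) : (ascPochhammer ℂ (n + m)).eval a =
    (ascPochhammer ℂ n).eval a * (ascPochhammer ℂ m).eval (a + n) := by
  rw [← ascPochhammer_mul]; simp

lemma sum_pfaff_coeff (a b c : ℂ) (hc : ∀ k : ℕ, c ≠ -k) (N : ℕ) :
    ∑ x ∈ Finset.HasAntidiagonal.antidiagonal N, ordinaryHypergeometricCoefficient a (c - b) c x.1 * (-1) ^ x.1 *
      ((ascPochhammer ℂ x.2).eval (a + x.1) / (x.2 ! : ℂ)) =
    ordinaryHypergeometricCoefficient a b c N := by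
  have hne : ∀ n, (ascPochhammer ℂ n).eval c ≠ 0 := by
    intro n h
    obtain ⟨k, -, hk⟩ := (ascPochhammer_eval_eq_zero_iff n c).1 h
    exact hc k (by rw [hk]; simp)
  have h := sum_choose_ascPochhammer N c (c - b)
  rw [sub_sub_cancel] at h
  rw [ordinaryHypergeometricCoefficient, ← h, Finset.mul_sum, Finset.sum_mul]
  refine Finset.sum_congr rfl fun x hx => ?_
  have hx' : x.1 + x.2 = N := by simpa using hx
  subst hx'
  have f1 : ((x.1 + x.2).choose x.1 : ℂ) * (x.1 ! : ℂ) * (x.2 ! : ℂ) = ((x.1 + x.2) ! : ℂ) := by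
    rw [Nat.choose_symm_add]; exact_mod_cast Nat.add_choose_mul_factorial_mul_factorial x.1 x.2
  have g0 : ((x.1 + x.2) ! : ℂ) ≠ 0 := by exact_mod_cast Nat.factorial_ne_zero _
  have g1 : (x.1 ! : ℂ) ≠ 0 := by exact_mod_cast Nat.factorial_ne_zero _
  have g2 : (x.2 ! : ℂ) ≠ 0 := by exact_mod_cast Nat.factorial_ne_zero _
  have q1 := hne x.1
  have q2 := hne (x.1 + x.2)
  rw [ascPochhammer_eval_add a, ascPochhammer_eval_add c] 
  rw [ascPochhammer_eval_add c] at q2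
  have q3 := right_ne_zero_of_mul q2
  rw [ordinaryHypergeometricCoefficient, ← f1]
  rw [← f1] at g0
  have g3 : ((x.1 + x.2).choose x.1 : ℂ) ≠ 0 := left_ne_zero_of_mul (left_ne_zero_of_mul g0)
  field_simp

lemma one_le_radius_two_f_one (a b c : ℂ) (hc : ∀ k : ℕ, c ≠ -k) :
    1 ≤ (ordinaryHypergeometricSeries ℂ a b c).radius := by
  by_cases ha : ∃ k : ℕ, a = -k
  · obtain ⟨k, rfl⟩ := ha
    simp [ordinaryHypergeometric_radius_top_of_neg_nat₁]
  by_cases hb : ∃ k : ℕ, b = -k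
  · obtain ⟨k, rfl⟩ := hb
    simp [ordinaryHypergeometric_radius_top_of_neg_nat₂]
  push Not at ha hb
  refine (ordinaryHypergeometricSeries_radius_eq_one ℂ a b c fun k => ⟨?_, ?_, ?_⟩).ge
  · exact fun h => ha k (by rw [h]; simp)
  · exact fun h => hb k (by rw [h]; simp)
  · exact fun h => hc k (by rw [h]; simp)

lemma norm_ascPochhammer_div_le (a : ℂ) (k : ℕ) (hk : ‖a‖ ≤ k + 1) (m : ℕ) :
    ‖(ascPochhammer ℂ m).eval a / (m ! : ℂ)‖ ≤ 2 ^ (k + m) := by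
  have h : ‖(ascPochhammer ℂ m).eval a‖ ≤ ((k + 1).ascFactorial m : ℝ) := by
    induction m with
    | zero => simp
    | succ m ih =>
      rw [ascPochhammer_succ_eval, norm_mul, Nat.ascFactorial_succ, mul_comm]
      push_cast
      gcongr
      refine (norm_add_le _ _).trans ?_
      simp
      linarith
  rw [norm_div, div_le_iff₀ (by simp; positivity)]
  refine h.trans ?_
  rw [Nat.ascFactorial_eq_factorial_mul_choose]
  simp only [Complex.norm_natCast]
  push_cast
  rw [mul_comm]
  gcongr
  exact_mod_cast Nat.choose_le_two_pow (k + m) m 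
lemma choose_eq_ascPochhammer_div (a : ℂ) (m : ℕ) :
    Ring.choose (a + m - 1) m = (ascPochhammer ℂ m).eval a / (m ! : ℂ) := by
  have h := Ring.factorial_nsmul_multichoose_eq_ascPochhammer a m
  have e : Ring.choose (a + m - 1) m = Ring.multichoose a m := by
    rw [Ring.choose]; congr 1; ring
  rw [e, eq_div_iff (by exact_mod_cast Nat.factorial_ne_zero m), mul_comm, ← nsmul_eq_mul, h,
    Polynomial.ascPochhammer_smeval_eq_eval]

lemma hasSum_one_sub_cpow_neg (a : ℂ) {z : ℂ} (hz : ‖z‖ < 1) :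
    HasSum (fun m : ℕ => (ascPochhammer ℂ m).eval a / (m ! : ℂ) * z ^ m) ((1 - z) ^ (-a)) := by
  have h := (Complex.one_div_one_sub_cpow_hasFPowerSeriesOnBall_zero a).hasSum (y := z)
    (by simpa [Metric.mem_eball, edist_eq_enorm_sub, ← ofReal_norm] using hz)
  simp only [FormalMultilinearSeries.ofScalars_apply_eq, zero_add, choose_eq_ascPochhammer_div, smul_eq_mul] at h
  simpa [Complex.cpow_neg] using h

lemma summable_two_f_one_coeff (a b c : ℂ) (hc : ∀ k : ℕ, c ≠ -k) {r : NNReal} (hr : r < 1) :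
    Summable fun n : ℕ => ‖ordinaryHypergeometricCoefficient a b c n‖ * (r : ℝ) ^ n := by
  have h := (ordinaryHypergeometricSeries ℂ a b c).summable_norm_mul_pow (r := r)
    (lt_of_lt_of_le (by exact_mod_cast hr) (one_le_radius_two_f_one a b c hc))
  simpa [ordinaryHypergeometricSeries, FormalMultilinearSeries.ofScalars_norm] using h

theorem hyp2F1_eq_of_small (a b c : ℂ) (hc : ∀ k : ℕ, c ≠ -k) {z : ℂ} (hz : ‖z‖ < 1 / 4) :
    hyp2F1 a b c z = ₂F₁ a b c z := by
  set A := ordinaryHypergeometricCoefficient a (c - b) c with hA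
  obtain ⟨k, hk⟩ := exists_nat_ge ‖a‖
  have hz1 : (1 - z) ≠ 0 := by
    intro h
    have : z = 1 := by linear_combination -h
    rw [this] at hz; norm_num at hz
  have hz1' : z - 1 ≠ 0 := by rw [← neg_sub]; exact neg_ne_zero.2 hz1
  let F : ℕ × ℕ → ℂ := fun x => A x.1 * (-1) ^ x.1 *
    ((ascPochhammer ℂ x.2).eval (a + x.1) / (x.2 ! : ℂ)) * z ^ (x.1 + x.2)
  have hF : Summable F := by
    have s1 := summable_two_f_one_coeff a (c - b) c hc (r := 2 * ‖z‖₊)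
      (by rw [← NNReal.coe_lt_coe]; push_cast; linarith)
    have s2 : Summable fun m : ℕ => (2 * ‖z‖) ^ m :=
      summable_geometric_of_lt_one (by positivity) (by linarith)
    have s3 := (s1.mul_of_nonneg s2 (fun n => by positivity) (fun n => by positivity)).mul_left
      ((2 : ℝ) ^ k)
    refine Summable.of_norm_bounded s3 fun x => ?_
    have hb := norm_ascPochhammer_div_le (a + x.1) (k + x.1) (by
      refine (norm_add_le _ _).trans ?_
      simp; linarith) x.2
    have e : ‖F x‖ = ‖A x.1‖ * ‖(ascPochhammer ℂ x.2).eval (a + x.1) / (x.2 ! : ℂ)‖ *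
        ‖z‖ ^ (x.1 + x.2) := by
      simp only [F]
      rw [norm_mul, norm_mul, norm_mul, norm_pow, norm_pow, norm_neg, norm_one, one_pow, mul_one]
    rw [e]
    calc _ ≤ ‖A x.1‖ * 2 ^ (k + x.1 + x.2) * ‖z‖ ^ (x.1 + x.2) := by gcongr
      _ = (2 : ℝ) ^ k * (‖A x.1‖ * ((2 * ‖z‖₊ : NNReal) : ℝ) ^ x.1 * (2 * ‖z‖) ^ x.2) := by
        simp only [NNReal.coe_mul, NNReal.coe_ofNat, coe_nnnorm]; ring
  have h1 : ∑' x, F x = hyp2F1 a b c z := by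
    rw [hF.tsum_prod, hyp2F1, ordinaryHypergeometric_eq_tsum, ← tsum_mul_left]
    refine tsum_congr fun n => ?_
    have hs := (hasSum_one_sub_cpow_neg (a + n) (z := z) (by linarith)).mul_left (A n * (-1) ^ n * z ^ n)
    have e : ∀ m, F (n, m) = A n * (-1) ^ n * z ^ n *
        ((ascPochhammer ℂ m).eval (a + n) / (m ! : ℂ) * z ^ m) := by
      intro m; simp only [F]; ring
    simp_rw [e]
    rw [hs.tsum_eq, show -(a + (n : ℂ)) = -a - n by ring, Complex.cpow_sub _ _ hz1,
      Complex.cpow_natCast, hA]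
    rw [show z / (z - 1) = (-1) * z / (1 - z) by field_simp; ring]
    simp only [smul_eq_mul, div_pow, mul_pow]
    ring
  have h2 : ∑' x, F x = ₂F₁ a b c z := by
    rw [← Finset.HasAntidiagonal.sigmaAntidiagonalEquivProd.tsum_eq F]
    change ∑' x, (F ∘ Finset.HasAntidiagonal.sigmaAntidiagonalEquivProd) x = _
    rw [(Finset.HasAntidiagonal.sigmaAntidiagonalEquivProd.summable_iff.2 hF).tsum_sigma'
        (fun n ↦ (hasSum_fintype _).summable), ordinaryHypergeometric_eq_tsum]
    refine tsum_congr fun N => ?_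
    rw [tsum_fintype]
    have := sum_pfaff_coeff a b c hc N
    rw [ordinaryHypergeometricCoefficient] at this
    rw [← this, smul_eq_mul, Finset.sum_mul]
    rw [← Finset.sum_coe_sort (Finset.HasAntidiagonal.antidiagonal N)]
    refine Finset.sum_congr rfl fun x _ => ?_
    have hx : x.1.1 + x.1.2 = N := Finset.HasAntidiagonal.mem_antidiagonal.1 x.2
    simp [F, hx, hA]
  rw [← h1, h2]

theorem hyp2F1_analyticOnNhd (a b c : ℂ) (hc : ∀ k : ℕ, c ≠ -k) :
    AnalyticOnNhd ℂ (hyp2F1 a b c) {z | z.re < 1 / 2} := by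
  intro z hz
  simp only [Set.mem_ofPred_eq] at hz
  have hz1 : z - 1 ≠ 0 := by
    intro h
    have := congrArg Complex.re h
    simp at this; linarith
  have hw : ‖z / (z - 1)‖ < 1 := by
    rw [norm_div, div_lt_one (norm_pos_iff.2 hz1), ← sq_lt_sq₀ (norm_nonneg _) (norm_nonneg _),
      ← Complex.normSq_eq_norm_sq, ← Complex.normSq_eq_norm_sq, Complex.normSq_apply,
      Complex.normSq_apply]
    simp; nlinarith
  have hr := one_le_radius_two_f_one a (c - b) c hc
  have h := ((ordinaryHypergeometricSeries ℂ a (c - b) c).hasFPowerSeriesOnBall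
    (lt_of_lt_of_le one_pos hr)).analyticAt_of_mem (y := z / (z - 1))
    (by
      refine Metric.eball_subset_eball hr ?_
      simpa [Metric.mem_eball, edist_eq_enorm_sub, ← ofReal_norm] using hw)
  unfold hyp2F1
  refine AnalyticAt.mul (AnalyticAt.cpow (by fun_prop) (by fun_prop) ?_) ?_
  · left; simp; linarith
  · exact AnalyticAt.fun_comp (f := fun z => z / (z - 1)) h
      (AnalyticAt.div (by fun_prop) (by fun_prop) hz1)

end Hypergeometric

/-- `ρ = α + β + 1`. -/
noncomputable def rho (α β : ℝ) : ℝ := α + β + 1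

/-- The Jacobi function `φ_λ(t) = ₂F₁((ρ - iλ)/2, (ρ + iλ)/2; α + 1; -sinh² t)`. -/
noncomputable def jacobiPhi (α β : ℝ) (lam : ℂ) (t : ℝ) : ℂ :=
  hyp2F1 ((rho α β - Complex.I * lam) / 2) ((rho α β + Complex.I * lam) / 2) (α + 1)
    (-(Real.sinh t : ℂ) ^ 2)

/-- The Harish-Chandra function
`c(λ) = 2^ρ Γ(iλ/2) Γ((1 + iλ)/2) / (Γ((ρ + iλ)/2) Γ((ρ + iλ)/2 - β))`. -/
noncomputable def cFun (α β : ℝ) (lam : ℂ) : ℂ :=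
  (2 : ℂ) ^ (rho α β : ℂ) * Complex.Gamma (Complex.I * lam / 2) *
      Complex.Gamma ((1 + Complex.I * lam) / 2) /
    (Complex.Gamma ((rho α β + Complex.I * lam) / 2) *
      Complex.Gamma ((rho α β + Complex.I * lam) / 2 - β))

/-- `Δ(t) = (2 sinh t)^(2α+1) (2 cosh t)^(2β+1)`, used for `t > 0`. -/
noncomputable def jacobiDelta (α β t : ℝ) : ℝ :=
  (2 * Real.sinh t) ^ (2 * α + 1) * (2 * Real.cosh t) ^ (2 * β + 1)

/-- The measure `dμ(t) = Δ(t) dt` on `(0, ∞)`, as a measure on `ℝ`. -/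
noncomputable def jacobiMeasure (α β : ℝ) : MeasureTheory.Measure ℝ :=
  (MeasureTheory.volume.restrict (Set.Ioi (0 : ℝ))).withDensity
    fun t => ENNReal.ofReal (jacobiDelta α β t)

/-- The disc kernel `K_R(t, r) = ∫_0^R φ_λ(t) φ_λ(r) |c(λ)|⁻² dλ`. -/
noncomputable def discKernel (α β R t r : ℝ) : ℂ :=
  ∫ lam in (0 : ℝ)..R, jacobiPhi α β lam t * jacobiPhi α β lam r *
    (((‖cFun α β lam‖ ^ 2)⁻¹ : ℝ) : ℂ)

/-- The kernel `K_{3,R}`: the disc kernel restricted to the region `t < R₀/2`, `r > R₀`. -/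
noncomputable def discKernelThree (α β R₀ R t r : ℝ) : ℂ :=
  open Classical in if t < R₀ / 2 ∧ R₀ < r then discKernel α β R t r else 0

/-- The operator `S_{3,R} f(t) = ∫ K_{3,R}(t, r) f(r) dμ(r)`. -/
noncomputable def discOpThree (α β R₀ R : ℝ) (f : ℝ → ℂ) (t : ℝ) : ℂ :=
  ∫ r, discKernelThree α β R₀ R t r * f r ∂(jacobiMeasure α β)

/-- The maximal operator `S_{3,*} f(t) = sup_{R > 0} |S_{3,R} f(t)|`, with values in `[0, ∞]`. -/
noncomputable def discMaxThree (α β R₀ : ℝ) (f : ℝ → ℂ) (t : ℝ) : ENNReal :=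
  ⨆ (R : ℝ) (_ : 0 < R), ‖discOpThree α β R₀ R f t‖ₑ

end JacobiAnalysis

/-!
The disc kernel is estimated away from the diagonal by a contour shift in the spectral variable,
and the maximal operator is then bounded by Hölder's inequality.

The Jacobi equation `f'' + (Δ'/Δ) f' + (ρ² + λ²) f = 0` has, besides the Jacobi function `φ_λ`, the
solutions `Φ_{±λ}(r) = ∑ Γₙ(±λ) e^{(±iλ - ρ - 2n) r}` given by the Harish-Chandra series, and
`φ_λ = κ (c(λ) Φ_λ + c(-λ) Φ_{-λ})` with the constant `κ = Γ(α + 1) / (2 √π)`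
(`phiFun_eq_hcPhi`). The coefficients are Wronskians, hence holomorphic in the spectral parameter;
for spectral parameters on an interval of the imaginary axis they can be read off from the growth
of `φ_λ` at infinity, which Gauss' summation theorem provides, and the identity theorem extends the
formula (`hcWronskian_eq`). Since `|c(λ)|² = c(λ) c(-λ)` for real `λ`, the kernel becomes
`κ ∫_{-R}^R φ_λ(t) Φ_λ(r) / c(-λ) dλ` (`discKernel_eq`), whose integrand is holomorphic in the
closed upper half plane `Im λ ≥ 0`. There three estimates hold, uniformly in `λ`, for `t ≤ 1 ≤ r`:

* `|φ_λ(t)| ≤ C e^{t Im λ} ((1 + |λ|) t)^{-(α + 1/2)}` (`exists_norm_phiFun_le`). For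
  `t ≲ 1/(1 + |λ|)` this follows from the integrated equation; beyond that point the energy of
  `Δ^{1/2} φ_λ`, taken with the weight `(1 + ρ + |λ|)²`, grows at most like `e^{2 t Im λ}`.
* `|Φ_λ(r)| ≤ C e^{-(Im λ + ρ) r}` (`exists_norm_hcPhi_le`). The recursion for `Γₙ` gives polynomial
  growth in `n`, uniformly in `λ`.
* `|1 / c(-λ)| ≤ C (1 + |λ|)^{α + 1/2}` (`exists_norm_inv_hcC_le`). Up to a constant, `1 / c(-λ)` is
  a product of two quotients `Γ(w + s) / Γ(w)` with `s ≥ 0` and `Re w ≥ 0`, each of growth `|w|^s`.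

The powers of `1 + |λ|` cancel, so the integrand is at most
`C e^{-ρ r} t^{-(α + 1/2)} e^{-(r - t) Im λ}`. Pushing the segment `[-R, R]` to infinity in the
upper half plane leaves two vertical half lines and yields a bound by
`C e^{-ρ r} t^{-(α + 1/2)} / (r - t)` that does not depend on `R` (`norm_integral_le_of_exp_decay`,
`exists_norm_discKernel_le`).

Consequently the maximal function at `t` is at most a constant times
`t^{-(α + 1/2)} ∫_1^∞ (e^{-ρ r} / r) |f(r)| dμ(r)` for `t < R₀/2`, and zero beyond. As
`Δ(r) ≲ e^{2ρ r}`, the weight `e^{-ρ r} / r` lies in `L^q(μ)` on `(1, ∞)` for the exponent `q ≥ 2`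
conjugate to `p`; as `Δ(t) ≲ t^{2α + 1}` near zero, `t^{-(α + 1/2)}` lies in `L^p(μ)` on `(0, 1)`
(`exists_eLpNorm_discMaxThree_le`).
-/

namespace JacobiAnalysis

open Filter Topology Set MeasureTheory

/-! ### The hypergeometric equation -/

section HypergeometricEquation

open scoped Nat

variable {a b c : ℂ}

lemma two_f_one_coeff_succ (hc : ∀ k : ℕ, c ≠ -k) (n : ℕ) :
    (n + 1) * ordinaryHypergeometricCoefficient a b c (n + 1) =
      (a + n) * (b + n) / (c + n) * ordinaryHypergeometricCoefficient a b c n := by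
  have h1 : (c + n) ≠ 0 := fun h => hc n (by linear_combination h)
  have h2 : ((n : ℂ) + 1) ≠ 0 := by exact_mod_cast Nat.succ_ne_zero n
  simp only [ordinaryHypergeometricCoefficient, ascPochhammer_succ_eval, Nat.factorial_succ]
  push_cast
  simp only [mul_inv]
  field_simp

/-- The derivative of the series `₂F₁` is a multiple of the series with shifted parameters. -/
lemma two_f_one_coeff_succ_shift (n : ℕ) :
    (n + 1) * ordinaryHypergeometricCoefficient a b c (n + 1) =
      a * b / c * ordinaryHypergeometricCoefficient (a + 1) (b + 1) (c + 1) n := by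
  have h2 : ((n : ℂ) + 1) ≠ 0 := by exact_mod_cast Nat.succ_ne_zero n
  simp only [ordinaryHypergeometricCoefficient, ascPochhammer_succ_left, Nat.factorial_succ]
  simp
  field_simp

lemma add_one_ne_neg_nat (hc : ∀ k : ℕ, c ≠ -k) (k : ℕ) : c + 1 ≠ -k := fun h =>
  hc (k + 1) (by push_cast; linear_combination h)

lemma hasSum_two_f_one (a b : ℂ) (hc : ∀ k : ℕ, c ≠ -k) {z : ℂ} (hz : ‖z‖ < 1) :
    HasSum (fun n : ℕ => ordinaryHypergeometricCoefficient a b c n * z ^ n) (₂F₁ a b c z) := by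
  have h := summable_two_f_one_coeff a b c hc (r := ‖z‖₊) (by exact_mod_cast hz)
  have h2 : Summable fun n : ℕ => ordinaryHypergeometricCoefficient a b c n * z ^ n :=
    Summable.of_norm (by simpa [norm_mul] using h)
  rw [ordinaryHypergeometric_eq_tsum]
  simpa only [smul_eq_mul] using h2.hasSum

lemma hasDerivAt_two_f_one (a b : ℂ) (hc : ∀ k : ℕ, c ≠ -k) {z : ℂ} (hz : ‖z‖ < 1) :
    HasDerivAt (₂F₁ a b c) (a * b / c * ₂F₁ (a + 1) (b + 1) (c + 1) z) z := by
  obtain ⟨r, hr, hr1⟩ := exists_between hz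
  have hr0 : 0 < r := (norm_nonneg _).trans_lt hr
  lift r to NNReal using hr0.le
  have key : ∀ (n : ℕ) (w : ℂ), ((n : ℂ) + 1) * ordinaryHypergeometricCoefficient a b c (n + 1) *
      w ^ n = a * b / c * (ordinaryHypergeometricCoefficient (a + 1) (b + 1) (c + 1) n * w ^ n) :=
    fun n w => by rw [two_f_one_coeff_succ_shift]; ring
  have hs : Summable fun n : ℕ => ‖(n : ℂ) * ordinaryHypergeometricCoefficient a b c n‖ *
      (r : ℝ) ^ (n - 1) := by
    rw [← summable_nat_add_iff 1]
    have := (summable_two_f_one_coeff (a + 1) (b + 1) (c + 1) (add_one_ne_neg_nat hc)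
      (r := r) (by exact_mod_cast hr1)).mul_left ‖a * b / c‖
    refine this.congr fun n => ?_
    push_cast
    rw [two_f_one_coeff_succ_shift, norm_mul (a * b / c)]
    ring
  have hd := hasDerivAt_tsum_of_isPreconnected (y₀ := (0 : ℂ)) (y := z)
    (g := fun n w => ordinaryHypergeometricCoefficient a b c n * w ^ n)
    (g' := fun n w => ordinaryHypergeometricCoefficient a b c n * (n * w ^ (n - 1)))
    (t := Metric.ball (0 : ℂ) r) hs Metric.isOpen_ball
    (convex_ball _ _).isPreconnected
    (fun n w _ => (hasDerivAt_pow n w).const_mul _) (fun n w hw => by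
      rw [mem_ball_zero_iff] at hw
      rw [← mul_assoc, norm_mul, norm_pow, mul_comm (n : ℂ)]
      gcongr) (by simpa using hr0) (hasSum_two_f_one a b hc (by simp)).summable (by simpa using hr)
  have e : ₂F₁ a b c = fun w : ℂ =>
      ∑' n : ℕ, ordinaryHypergeometricCoefficient a b c n * w ^ n := by
    rw [ordinaryHypergeometric_eq_tsum]; simp
  rw [e]
  refine hd.congr_deriv ?_
  have h1 := (hasSum_two_f_one (a + 1) (b + 1) (add_one_ne_neg_nat hc) hz).mul_left (a * b / c)
  rw [← h1.tsum_eq]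
  have h2 : Summable fun n : ℕ =>
      ordinaryHypergeometricCoefficient a b c n * (n * z ^ (n - 1)) := by
    rw [← summable_nat_add_iff 1]
    refine h1.summable.congr fun n => ?_
    rw [← key]; push_cast; ring
  rw [h2.tsum_eq_zero_add]
  simp only [Nat.cast_zero, zero_mul, mul_zero, zero_add]
  refine tsum_congr fun n => ?_
  rw [← key]; push_cast; ring

/-- The hypergeometric differential equation, with the derivatives of `₂F₁` expressed through the
functions with shifted parameters. -/
lemma two_f_one_ode (a b : ℂ) (hc : ∀ k : ℕ, c ≠ -k) {z : ℂ} (hz : ‖z‖ < 1) :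
    z * (1 - z) * ((a + 1) * (b + 1) / (c + 1) * ₂F₁ (a + 1 + 1) (b + 1 + 1) (c + 1 + 1) z) +
      (c - (a + b + 1) * z) * ₂F₁ (a + 1) (b + 1) (c + 1) z - c * ₂F₁ a b c z = 0 := by
  have hc1 := add_one_ne_neg_nat hc
  have hc2 := add_one_ne_neg_nat hc1
  have hc0 : c ≠ 0 := by simpa using hc 0
  set D := ordinaryHypergeometricCoefficient (a + 1) (b + 1) (c + 1) with hD
  have h0 := hasSum_two_f_one a b hc hz
  have h1 := hasSum_two_f_one (a + 1) (b + 1) hc1 hz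
  rw [← hD] at h1
  have h2 : HasSum (fun n : ℕ => (n : ℂ) * D n * z ^ n)
      (z * ((a + 1) * (b + 1) / (c + 1) * ₂F₁ (a + 1 + 1) (b + 1 + 1) (c + 1 + 1) z)) := by
    rw [← hasSum_nat_add_iff' 1]
    have := ((hasSum_two_f_one (a + 1 + 1) (b + 1 + 1) hc2 hz).mul_left
      ((a + 1) * (b + 1) / (c + 1))).mul_left z
    simp only [Finset.range_one, Finset.sum_singleton, Nat.cast_zero, zero_mul, sub_zero]
    refine this.congr_fun fun n => ?_
    push_cast
    rw [hD, two_f_one_coeff_succ_shift]; ring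
  have hL := ((h2.add (h1.mul_left c)).sub (h0.mul_left c))
  have hR := (h2.add (h1.mul_left (a + b + 1))).mul_left z
  -- Multiplication by `z` shifts the index by one, so the term `n` of `hR` meets the term `n + 1`
  -- of `hL`.
  rw [← hasSum_nat_add_iff' 1] at hL
  have e : ∀ n : ℕ, ((n + 1 : ℕ) : ℂ) * D (n + 1) * z ^ (n + 1) + c * (D (n + 1) * z ^ (n + 1)) -
      c * (ordinaryHypergeometricCoefficient a b c (n + 1) * z ^ (n + 1)) =
      z * (n * D n * z ^ n + (a + b + 1) * (D n * z ^ n)) := by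
    intro n
    have q1 := two_f_one_coeff_succ (a := a + 1) (b := b + 1) hc1 n
    have q2 := two_f_one_coeff_succ_shift (a := a) (b := b) (c := c) n
    have n1 : (c + 1 + n) ≠ 0 := fun h => hc1 n (by linear_combination h)
    have n2 : ((n : ℂ) + 1) ≠ 0 := by exact_mod_cast Nat.succ_ne_zero n
    rw [← hD] at q1 q2
    have q1' : D (n + 1) = (a + 1 + n) * (b + 1 + n) / ((c + 1 + n) * (n + 1)) * D n := by
      rw [mul_comm] at q1
      rw [eq_div_of_mul_eq n2 q1]; field_simp
    have q2' : ordinaryHypergeometricCoefficient a b c (n + 1) = a * b / (c * (n + 1)) * D n := by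
      rw [mul_comm] at q2
      rw [eq_div_of_mul_eq n2 q2]; field_simp
    rw [q1', q2']
    push_cast
    field_simp
    ring
  have := hL.unique (hR.congr_fun e)
  have d0 : D 0 = 1 := by simp [hD, ordinaryHypergeometricCoefficient]
  have a0 : ordinaryHypergeometricCoefficient a b c 0 = 1 := by
    simp [ordinaryHypergeometricCoefficient]
  simp only [Finset.range_one, Finset.sum_singleton, d0, a0] at this
  simp at this
  linear_combination this

lemma isPreconnected_re_lt (x : ℝ) : IsPreconnected {z : ℂ | z.re < x} :=
  (convex_halfSpace_re_lt x).isPreconnected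

lemma eventually_norm_lt_quarter : ∀ᶠ z : ℂ in 𝓝 0, ‖z‖ < 1 / 4 := by
  filter_upwards [Metric.ball_mem_nhds (0 : ℂ) (by norm_num : (0 : ℝ) < 1 / 4)] with z hz
  simpa using hz

/-- The definition of `hyp2F1` treats `a` and `b` differently; the power series does not. -/
theorem hyp2F1_symm (a b : ℂ) (hc : ∀ k : ℕ, c ≠ -k) {z : ℂ} (hz : z.re < 1 / 2) :
    hyp2F1 a b c z = hyp2F1 b a c z := by
  refine (hyp2F1_analyticOnNhd a b c hc).eqOn_of_preconnected_of_eventuallyEq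
    (hyp2F1_analyticOnNhd b a c hc) (isPreconnected_re_lt _) (z₀ := 0) (by simp) ?_ hz
  filter_upwards [eventually_norm_lt_quarter] with w hw
  rw [hyp2F1_eq_of_small _ _ _ hc hw, hyp2F1_eq_of_small _ _ _ hc hw]
  simp only [ordinaryHypergeometric]
  rw [ordinaryHypergeometricSeries_symm]

theorem hasDerivAt_hyp2F1 (a b : ℂ) (hc : ∀ k : ℕ, c ≠ -k) {z : ℂ} (hz : z.re < 1 / 2) :
    HasDerivAt (hyp2F1 a b c) (a * b / c * hyp2F1 (a + 1) (b + 1) (c + 1) z) z := by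
  have hA := hyp2F1_analyticOnNhd a b c hc
  have hB : AnalyticOnNhd ℂ (fun z => a * b / c * hyp2F1 (a + 1) (b + 1) (c + 1) z)
      {z | z.re < 1 / 2} := fun z hz =>
    analyticAt_const.mul (hyp2F1_analyticOnNhd _ _ _ (add_one_ne_neg_nat hc) z hz)
  have h := hA.deriv.eqOn_of_preconnected_of_eventuallyEq hB (isPreconnected_re_lt _) (z₀ := 0)
    (by simp) (by
      filter_upwards [eventually_norm_lt_quarter, eventually_norm_lt_quarter.eventually_nhds] with
        w hw hw'
      rw [hyp2F1_eq_of_small _ _ _ (add_one_ne_neg_nat hc) hw]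
      have h1 : hyp2F1 a b c =ᶠ[𝓝 w] ₂F₁ a b c := by
        filter_upwards [hw'] with v hv using hyp2F1_eq_of_small _ _ _ hc hv
      rw [h1.deriv_eq, (hasDerivAt_two_f_one a b hc (by linarith)).deriv]) hz
  simp only at h
  rw [← h]
  exact (hA z hz).differentiableAt.hasDerivAt

/-- The hypergeometric equation on the half plane of continuation, by the identity theorem. -/
theorem hyp2F1_ode (a b : ℂ) (hc : ∀ k : ℕ, c ≠ -k) {z : ℂ} (hz : z.re < 1 / 2) :
    z * (1 - z) * ((a + 1) * (b + 1) / (c + 1) * hyp2F1 (a + 1 + 1) (b + 1 + 1) (c + 1 + 1) z) +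
      (c - (a + b + 1) * z) * hyp2F1 (a + 1) (b + 1) (c + 1) z - c * hyp2F1 a b c z = 0 := by
  have hc1 := add_one_ne_neg_nat hc
  have hc2 := add_one_ne_neg_nat hc1
  have h : AnalyticOnNhd ℂ (fun z => z * (1 - z) * ((a + 1) * (b + 1) / (c + 1) *
      hyp2F1 (a + 1 + 1) (b + 1 + 1) (c + 1 + 1) z) +
      (c - (a + b + 1) * z) * hyp2F1 (a + 1) (b + 1) (c + 1) z - c * hyp2F1 a b c z)
      {z | z.re < 1 / 2} := fun w hw => by
    have q0 := hyp2F1_analyticOnNhd a b _ hc w hw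
    have q1 := hyp2F1_analyticOnNhd (a + 1) (b + 1) _ hc1 w hw
    have q2 := hyp2F1_analyticOnNhd (a + 1 + 1) (b + 1 + 1) _ hc2 w hw
    fun_prop
  refine h.eqOn_of_preconnected_of_eventuallyEq (fun _ _ => analyticAt_const (v := (0 : ℂ)))
    (isPreconnected_re_lt _) (z₀ := 0) (by simp) ?_ hz
  filter_upwards [eventually_norm_lt_quarter] with w hw
  rw [hyp2F1_eq_of_small _ _ _ hc hw, hyp2F1_eq_of_small _ _ _ hc1 hw,
    hyp2F1_eq_of_small _ _ _ hc2 hw]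
  exact two_f_one_ode a b hc (by linarith)

end HypergeometricEquation

/-! ### Holomorphy of the hypergeometric function in its parameters -/

section HypergeometricParameters

/-- Termwise, `₂F₁` is dominated by the series with the upper parameters replaced by bounds for
their absolute values. -/
lemma norm_ascPochhammer_le (a : ℂ) {M : ℝ} (ha : ‖a‖ ≤ M) (n : ℕ) :
    ‖(ascPochhammer ℂ n).eval a‖ ≤ ‖(ascPochhammer ℂ n).eval (M : ℂ)‖ := by
  have hM : 0 ≤ M := (norm_nonneg _).trans ha
  induction n with
  | zero => simp
  | succ n ih =>
    rw [ascPochhammer_succ_eval, ascPochhammer_succ_eval, norm_mul, norm_mul]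
    gcongr
    refine (norm_add_le _ _).trans ?_
    rw [← Complex.ofReal_natCast, ← Complex.ofReal_add, Complex.norm_of_nonneg (by positivity),
      Complex.norm_of_nonneg (by positivity)]
    gcongr

/-- The continued hypergeometric function depends holomorphically on its upper parameters. -/
theorem differentiable_hyp2F1_param {c z : ℂ} (hc : ∀ k : ℕ, c ≠ -k) (hz : z.re < 1 / 2)
    {f g : ℂ → ℂ} (hf : Differentiable ℂ f) (hg : Differentiable ℂ g) :
    Differentiable ℂ fun s => hyp2F1 (f s) (g s) c z := by
  have hz1 : z - 1 ≠ 0 := by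
    intro h
    have := congrArg Complex.re h
    simp at this; linarith
  have hz1' : 1 - z ≠ 0 := by rw [← neg_sub]; exact neg_ne_zero.2 hz1
  have hw : ‖z / (z - 1)‖ < 1 := by
    rw [norm_div, div_lt_one (norm_pos_iff.2 hz1), ← sq_lt_sq₀ (norm_nonneg _) (norm_nonneg _),
      ← Complex.normSq_eq_norm_sq, ← Complex.normSq_eq_norm_sq, Complex.normSq_apply,
      Complex.normSq_apply]
    simp; nlinarith
  unfold hyp2F1
  refine Differentiable.fun_mul ?_ ?_
  · intro s
    exact (hf s).neg.const_cpow (Or.inl hz1')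
  · set w := z / (z - 1)
    intro s₀
    have hcont : ContinuousAt (fun s => max ‖f s‖ ‖c - g s‖) s₀ := by
      have := hf.continuous; have := hg.continuous; fun_prop
    obtain ⟨M, hM⟩ := exists_gt (max ‖f s₀‖ ‖c - g s₀‖)
    have hev := hcont.eventually_lt continuousAt_const hM
    obtain ⟨U, hU, hUo, hsU⟩ := eventually_nhds_iff.1 hev
    have hd := Complex.differentiableOn_tsum_of_summable_norm (U := U)
      (F := fun n s => ordinaryHypergeometricCoefficient (f s) (c - g s) c n * w ^ n)
      (summable_two_f_one_coeff M M c hc (r := ‖w‖₊) (by exact_mod_cast hw))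
      (fun n => by
        have := hf.differentiableOn (s := U)
        have := hg.differentiableOn (s := U)
        unfold ordinaryHypergeometricCoefficient
        have p := Polynomial.differentiable (ascPochhammer ℂ n)
        have p1 : DifferentiableOn ℂ (fun s => (ascPochhammer ℂ n).eval (f s)) U :=
          (p.comp hf).differentiableOn
        have p2 : DifferentiableOn ℂ (fun s => (ascPochhammer ℂ n).eval (c - g s)) U :=
          (p.comp (hg.const_sub c)).differentiableOn
        fun_prop) hUo (fun n s hs => by
        have hs' := hU s hs
        rw [max_lt_iff] at hs'
        have b1 := norm_ascPochhammer_le (f s) hs'.1.le n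
        have b2 := norm_ascPochhammer_le (c - g s) hs'.2.le n
        simp only [ordinaryHypergeometricCoefficient, norm_mul, norm_pow, coe_nnnorm]
        gcongr)
    have e : ∀ s, ₂F₁ (f s) (c - g s) c w =
        ∑' n : ℕ, ordinaryHypergeometricCoefficient (f s) (c - g s) c n * w ^ n := fun s =>
      (hasSum_two_f_one _ _ hc hw).tsum_eq.symm
    simp_rw [e]
    exact hd.differentiableAt (hUo.mem_nhds hsU)

end HypergeometricParameters

/-! ### The density of the measure -/

section Density

variable {α β : ℝ}

/-- Half the logarithmic derivative of `Δ`. -/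
noncomputable def halfLogDeriv (α β t : ℝ) : ℝ :=
  (α + 1 / 2) * (Real.cosh t / Real.sinh t) + (β + 1 / 2) * (Real.sinh t / Real.cosh t)

lemma jacobiDelta_pos {t : ℝ} (ht : 0 < t) : 0 < jacobiDelta α β t := by
  have := Real.sinh_pos_iff.2 ht
  have := Real.cosh_pos t
  unfold jacobiDelta
  positivity

lemma hasDerivAt_jacobiDelta {t : ℝ} (ht : 0 < t) :
    HasDerivAt (jacobiDelta α β) (2 * halfLogDeriv α β t * jacobiDelta α β t) t := by
  have hs := Real.sinh_pos_iff.2 ht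
  have hc := Real.cosh_pos t
  have h1 := ((Real.hasDerivAt_sinh t).const_mul 2).rpow_const (p := 2 * α + 1)
    (Or.inl (by positivity))
  have h2 := ((Real.hasDerivAt_cosh t).const_mul 2).rpow_const (p := 2 * β + 1)
    (Or.inl (by positivity))
  refine (h1.mul h2).congr_deriv ?_
  unfold halfLogDeriv jacobiDelta
  rw [Real.rpow_sub_one (by positivity), Real.rpow_sub_one (by positivity)]
  field_simp

lemma continuous_jacobiDelta (hα : -(1 / 2) < α) : Continuous (jacobiDelta α β) := by
  unfold jacobiDelta
  refine Continuous.mul ?_ ?_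
  · exact (Real.continuous_sinh.const_mul 2).rpow_const fun _ => Or.inr (by linarith)
  · exact (Real.continuous_cosh.const_mul 2).rpow_const fun t =>
      Or.inl (by have := Real.cosh_pos t; positivity)

lemma jacobiDelta_zero (hα : -(1 / 2) < α) : jacobiDelta α β 0 = 0 := by
  unfold jacobiDelta
  rw [Real.sinh_zero, mul_zero, Real.zero_rpow (by linarith), zero_mul]

lemma jacobiDelta_mono (hα : -(1 / 2) < α) (hβ : -(1 / 2) < β) {s t : ℝ} (hs : 0 ≤ s)
    (hst : s ≤ t) : jacobiDelta α β s ≤ jacobiDelta α β t := by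
  unfold jacobiDelta
  have h1 : Real.sinh s ≤ Real.sinh t := Real.sinh_le_sinh.2 hst
  have h2 : Real.cosh s ≤ Real.cosh t := Real.cosh_le_cosh.2 (by
    rwa [abs_of_nonneg hs, abs_of_nonneg (hs.trans hst)])
  have h3 : 0 ≤ Real.sinh s := Real.sinh_nonneg_iff.2 hs
  have := Real.cosh_pos s
  have := Real.cosh_pos t
  have := Real.rpow_nonneg (mul_nonneg two_pos.le (h3.trans h1)) (2 * α + 1)
  gcongr
  · linarith
  · linarith

lemma cosh_le_two {t : ℝ} (h0 : 0 ≤ t) (h1 : t ≤ 1) : Real.cosh t ≤ 2 := by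
  have h : Real.cosh t ≤ Real.cosh 1 := Real.cosh_le_cosh.2 (by
    rw [abs_of_nonneg h0]; simpa using h1)
  refine h.trans ?_
  rw [Real.cosh_eq]
  have e1 := Real.exp_one_lt_d9
  have e2 : Real.exp (-1) ≤ 1 := by simp
  linarith

lemma sinh_le_two_mul {t : ℝ} (h0 : 0 ≤ t) (h1 : t ≤ 1) : Real.sinh t ≤ 2 * t := by
  have h := Convex.norm_image_sub_le_of_norm_hasDerivWithin_le (f := Real.sinh) (f' := Real.cosh)
    (s := Icc 0 1) (C := 2) (x := 0) (y := t)
    (fun x _ => (Real.hasDerivAt_sinh x).hasDerivWithinAt) (fun x hx => by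
      rw [Real.norm_of_nonneg (Real.cosh_pos x).le]; exact cosh_le_two hx.1 hx.2)
    (convex_Icc 0 1) (by simp) ⟨h0, h1⟩
  simpa [abs_of_nonneg h0, abs_of_nonneg (Real.sinh_nonneg_iff.2 h0)] using h

lemma jacobiDelta_le (hα : -(1 / 2) < α) (hβ : -(1 / 2) < β) {t : ℝ} (h0 : 0 ≤ t) (h1 : t ≤ 1) :
    jacobiDelta α β t ≤ (4 : ℝ) ^ (2 * α + 1) * 4 ^ (2 * β + 1) * t ^ (2 * α + 1) := by
  have h2 := cosh_le_two h0 h1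
  have h3 := sinh_le_two_mul h0 h1
  have h4 := Real.sinh_nonneg_iff.2 h0
  have h5 := Real.cosh_pos t
  have : (4 : ℝ) ^ (2 * α + 1) * 4 ^ (2 * β + 1) * t ^ (2 * α + 1) =
      (4 * t) ^ (2 * α + 1) * 4 ^ (2 * β + 1) := by
    rw [Real.mul_rpow (by norm_num) h0]; ring
  rw [this]
  unfold jacobiDelta
  gcongr ?_ ^ _ * ?_ ^ _
  all_goals linarith

lemma le_jacobiDelta (hα : -(1 / 2) < α) (hβ : -(1 / 2) < β) {t : ℝ} (h0 : 0 ≤ t) :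
    t ^ (2 * α + 1) ≤ jacobiDelta α β t := by
  have h3 := Real.self_le_sinh_iff.2 h0
  have h5 := Real.one_le_cosh t
  unfold jacobiDelta
  rw [← mul_one (t ^ (2 * α + 1))]
  gcongr
  · linarith
  · linarith
  · exact Real.one_le_rpow (by linarith) (by linarith)

lemma two_mul_sinh_eq (t : ℝ) :
    2 * Real.sinh t = Real.exp t * (1 - Real.exp (-(2 * t))) := by
  rw [Real.sinh_eq, mul_sub, ← Real.exp_add]; ring_nf

lemma two_mul_cosh_eq (t : ℝ) :
    2 * Real.cosh t = Real.exp t * (1 + Real.exp (-(2 * t))) := by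
  rw [Real.cosh_eq, mul_add, ← Real.exp_add]; ring_nf

lemma jacobiDelta_eq_exp_mul (t : ℝ) (ht : 0 ≤ t) : jacobiDelta α β t =
    Real.exp (2 * rho α β * t) * ((1 - Real.exp (-(2 * t))) ^ (2 * α + 1) *
      (1 + Real.exp (-(2 * t))) ^ (2 * β + 1)) := by
  have e0 : Real.exp (-(2 * t)) ≤ 1 := Real.exp_le_one_iff.2 (by linarith)
  have e1 := two_mul_sinh_eq t
  have e2 := two_mul_cosh_eq t
  unfold jacobiDelta
  rw [e1, e2, Real.mul_rpow (Real.exp_pos t).le (by linarith),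
    Real.mul_rpow (Real.exp_pos t).le (by positivity), ← Real.exp_mul, ← Real.exp_mul,
    show 2 * rho α β * t = t * (2 * α + 1) + t * (2 * β + 1) by unfold rho; ring, Real.exp_add]
  ring

lemma jacobiDelta_le_exp (hα : -(1 / 2) < α) (hβ : -(1 / 2) < β) {t : ℝ} (ht : 0 ≤ t) :
    jacobiDelta α β t ≤ (2 : ℝ) ^ (2 * β + 1) * Real.exp (2 * rho α β * t) := by
  have e0 : Real.exp (-(2 * t)) ≤ 1 := Real.exp_le_one_iff.2 (by linarith)
  have e1 := Real.exp_pos (-(2 * t))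
  rw [jacobiDelta_eq_exp_mul t ht, mul_comm]
  gcongr
  calc _ ≤ (1 : ℝ) * 2 ^ (2 * β + 1) := by
        gcongr
        · exact Real.rpow_le_one (by linarith) (by linarith) (by linarith)
        · linarith
        · linarith
    _ = _ := one_mul _

lemma tendsto_jacobiDelta_mul_exp :
    Tendsto (fun t => jacobiDelta α β t * Real.exp (-(2 * rho α β * t))) atTop (𝓝 1) := by
  have h : Tendsto (fun t : ℝ => Real.exp (-(2 * t))) atTop (𝓝 0) :=
    Real.tendsto_exp_neg_atTop_nhds_zero.comp (tendsto_id.const_mul_atTop two_pos)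
  have h1 : Tendsto (fun t : ℝ => (1 - Real.exp (-(2 * t))) ^ (2 * α + 1) *
      (1 + Real.exp (-(2 * t))) ^ (2 * β + 1)) atTop
      (𝓝 ((1 - 0) ^ (2 * α + 1) * (1 + 0) ^ (2 * β + 1))) :=
    ((h.const_sub 1).rpow_const (Or.inl (by norm_num))).mul
      ((h.const_add 1).rpow_const (Or.inl (by norm_num)))
  simp only [sub_zero, add_zero, Real.one_rpow, mul_one] at h1
  refine h1.congr' ?_
  filter_upwards [eventually_ge_atTop 0] with t ht
  rw [jacobiDelta_eq_exp_mul t ht, mul_right_comm, ← Real.exp_add, add_neg_cancel, Real.exp_zero,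
    one_mul]

end Density

/-! ### The Jacobi equation -/

section JacobiEquation

variable {α β : ℝ} {z : ℂ}

/-- `f`, with derivative `f₁`, solves on `(0, ∞)` the Jacobi equation
`f'' + (Δ'/Δ) f' + (ρ² - z²) f = 0`, whose spectral parameter is `λ = i z`. -/
def IsJacobiSolution (α β : ℝ) (z : ℂ) (f f₁ : ℝ → ℂ) : Prop :=
  ∀ t : ℝ, 0 < t → HasDerivAt f (f₁ t) t ∧
    HasDerivAt f₁ (-(2 * halfLogDeriv α β t) * f₁ t - (rho α β ^ 2 - z ^ 2) * f t) t

/-- The Wronskian of two solutions, multiplied by `Δ`. -/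
noncomputable def weightedWronskian (α β : ℝ) (f f₁ g g₁ : ℝ → ℂ) (t : ℝ) : ℂ :=
  jacobiDelta α β t * (f t * g₁ t - f₁ t * g t)

/-- Abel's identity: the logarithmic derivative `Δ'/Δ` is the first order coefficient of the
equation, so it cancels the decay of the Wronskian. -/
lemma weightedWronskian_const {f f₁ g g₁ : ℝ → ℂ} (hf : IsJacobiSolution α β z f f₁)
    (hg : IsJacobiSolution α β z g g₁) {s t : ℝ} (hs : 0 < s) (ht : 0 < t) :
    weightedWronskian α β f f₁ g g₁ s = weightedWronskian α β f f₁ g g₁ t := by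
  have hd : ∀ x ∈ Ioi (0 : ℝ), HasDerivAt (weightedWronskian α β f f₁ g g₁) 0 x := by
    intro x hx
    obtain ⟨f1, f2⟩ := hf x hx
    obtain ⟨g1, g2⟩ := hg x hx
    refine ((hasDerivAt_jacobiDelta (α := α) (β := β) hx).ofReal_comp.mul
      ((f1.mul g2).sub (f2.mul g1))).congr_deriv ?_
    simp only [Pi.mul_apply, Pi.sub_apply]
    push_cast
    ring
  exact isOpen_Ioi.is_const_of_deriv_eq_zero isPreconnected_Ioi
    (fun x hx => (hd x hx).differentiableAt.differentiableWithinAt)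
    (fun x hx => (hd x hx).deriv) hs ht

/-- The Jacobi function with spectral parameter `λ = i z`. -/
noncomputable def phiFun (α β : ℝ) (z : ℂ) (t : ℝ) : ℂ :=
  hyp2F1 ((rho α β + z) / 2) ((rho α β - z) / 2) (α + 1) (-(Real.sinh t : ℂ) ^ 2)

/-- The derivative of `phiFun` in `t`. -/
noncomputable def phiDeriv (α β : ℝ) (z : ℂ) (t : ℝ) : ℂ :=
  (rho α β + z) / 2 * ((rho α β - z) / 2) / (α + 1) *
    hyp2F1 ((rho α β + z) / 2 + 1) ((rho α β - z) / 2 + 1) (α + 1 + 1) (-(Real.sinh t : ℂ) ^ 2) *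
    (-(2 * Real.sinh t * Real.cosh t))

lemma jacobiPhi_eq_phiFun (α β : ℝ) (lam : ℂ) (t : ℝ) :
    jacobiPhi α β lam t = phiFun α β (-Complex.I * lam) t := by
  unfold jacobiPhi phiFun
  ring_nf

lemma add_one_ne_neg_nat_of_gt (hα : -1 < α) (k : ℕ) : (α + 1 : ℂ) ≠ -k := by
  intro h
  have h1 := congrArg Complex.re h
  simp at h1
  have : (0 : ℝ) ≤ k := k.cast_nonneg
  linarith

lemma neg_sinh_sq_re_lt (t : ℝ) : (-(Real.sinh t : ℂ) ^ 2).re < 1 / 2 := by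
  rw [← Complex.ofReal_pow, ← Complex.ofReal_neg, Complex.ofReal_re]
  nlinarith [sq_nonneg (Real.sinh t)]

lemma phiFun_neg (hα : -1 < α) (z : ℂ) (t : ℝ) : phiFun α β (-z) t = phiFun α β z t := by
  unfold phiFun
  rw [hyp2F1_symm _ _ (add_one_ne_neg_nat_of_gt hα) (neg_sinh_sq_re_lt t)]
  ring_nf

lemma phiFun_zero (z : ℂ) : phiFun α β z 0 = 1 := by
  simp [phiFun, hyp2F1]

lemma differentiable_phiFun (hα : -1 < α) (t : ℝ) : Differentiable ℂ fun z => phiFun α β z t :=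
  differentiable_hyp2F1_param (add_one_ne_neg_nat_of_gt hα) (neg_sinh_sq_re_lt t)
    (by fun_prop) (by fun_prop)

lemma differentiable_phiDeriv (hα : -1 < α) (t : ℝ) :
    Differentiable ℂ fun z => phiDeriv α β z t := by
  have h := differentiable_hyp2F1_param (add_one_ne_neg_nat (add_one_ne_neg_nat_of_gt hα))
    (neg_sinh_sq_re_lt t) (f := fun z => (rho α β + z) / 2 + 1)
    (g := fun z => (rho α β - z) / 2 + 1) (by fun_prop) (by fun_prop)
  unfold phiDeriv
  fun_prop

lemma hasDerivAt_neg_sinh_sq (t : ℝ) :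
    HasDerivAt (fun s : ℝ => -(Real.sinh s : ℂ) ^ 2) (-(2 * Real.sinh t * Real.cosh t)) t := by
  refine ((Real.hasDerivAt_sinh t).ofReal_comp.pow 2).neg.congr_deriv ?_
  simp

lemma hasDerivAt_phiFun (hα : -1 < α) (z : ℂ) (t : ℝ) :
    HasDerivAt (phiFun α β z) (phiDeriv α β z t) t :=
  (hasDerivAt_hyp2F1 _ _ (add_one_ne_neg_nat_of_gt hα) (neg_sinh_sq_re_lt t)).comp_of_eq t
    (hasDerivAt_neg_sinh_sq t) rfl

lemma continuous_phiDeriv (hα : -1 < α) (z : ℂ) : Continuous (phiDeriv α β z) := by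
  rw [continuous_iff_continuousAt]
  intro t
  have h1 := ((hasDerivAt_hyp2F1 ((rho α β + z) / 2 + 1) ((rho α β - z) / 2 + 1)
    (add_one_ne_neg_nat (add_one_ne_neg_nat_of_gt hα)) (neg_sinh_sq_re_lt t)).comp_of_eq t
    (hasDerivAt_neg_sinh_sq t) rfl).continuousAt
  unfold phiDeriv
  refine (continuousAt_const.mul h1).mul ?_
  have := Real.continuous_sinh
  have := Real.continuous_cosh
  fun_prop

/-- The substitution `x = -sinh² t` turns the hypergeometric equation into the Jacobi equation. -/
lemma isJacobiSolution_phiFun (hα : -1 < α) (z : ℂ) :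
    IsJacobiSolution α β z (phiFun α β z) (phiDeriv α β z) := by
  intro t ht
  refine ⟨hasDerivAt_phiFun hα z t, ?_⟩
  have hc := add_one_ne_neg_nat_of_gt hα
  have hs : (Real.sinh t : ℂ) ≠ 0 := by
    exact_mod_cast (Real.sinh_pos_iff.2 ht).ne'
  have hco : (Real.cosh t : ℂ) ≠ 0 := by
    exact_mod_cast (Real.cosh_pos t).ne'
  have hcs : (Real.cosh t : ℂ) ^ 2 = Real.sinh t ^ 2 + 1 := by exact_mod_cast Real.cosh_sq t
  have h1 := (hasDerivAt_hyp2F1 ((rho α β + z) / 2 + 1) ((rho α β - z) / 2 + 1)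
    (add_one_ne_neg_nat hc) (neg_sinh_sq_re_lt t)).comp_of_eq t
    (hasDerivAt_neg_sinh_sq t) rfl
  have h2 : HasDerivAt (fun s : ℝ => -(2 * (Real.sinh s : ℂ) * Real.cosh s))
      (-(2 * (Real.cosh t * Real.cosh t + Real.sinh t * Real.sinh t))) t := by
    refine (((Real.hasDerivAt_sinh t).ofReal_comp.const_mul 2).mul
      (Real.hasDerivAt_cosh t).ofReal_comp).neg.congr_deriv ?_
    ring
  have hode := hyp2F1_ode ((rho α β + z) / 2) ((rho α β - z) / 2) hc (neg_sinh_sq_re_lt t)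
  refine ((h1.const_mul ((rho α β + z) / 2 * ((rho α β - z) / 2) / (α + 1))).mul
    h2).congr_deriv ?_
  simp only [phiDeriv, phiFun, halfLogDeriv, Function.comp_apply]
  push_cast
  simp only [← Complex.ofReal_sinh, ← Complex.ofReal_cosh]
  have hc0 : (α + 1 : ℂ) ≠ 0 := by simpa using hc 0
  have hc1 : (α + 1 + 1 : ℂ) ≠ 0 := by simpa using add_one_ne_neg_nat hc 0
  set F2 := hyp2F1 ((rho α β + z) / 2 + 1 + 1) ((rho α β - z) / 2 + 1 + 1) (α + 1 + 1 + 1)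
    (-(Real.sinh t : ℂ) ^ 2)
  set F1 := hyp2F1 ((rho α β + z) / 2 + 1) ((rho α β - z) / 2 + 1) (α + 1 + 1)
    (-(Real.sinh t : ℂ) ^ 2)
  set F0 := hyp2F1 ((rho α β + z) / 2) ((rho α β - z) / 2) (α + 1) (-(Real.sinh t : ℂ) ^ 2)
  have hr : (rho α β : ℂ) = α + β + 1 := by unfold rho; push_cast; ring
  set s := (Real.sinh t : ℂ)
  set co := (Real.cosh t : ℂ)
  have e1 : -(2 * ((α + 1 / 2) * (co / s) + (β + 1 / 2) * (s / co))) *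
      ((rho α β + z) / 2 * ((rho α β - z) / 2) / (α + 1) * F1 * -(2 * s * co)) =
      (rho α β + z) / 2 * ((rho α β - z) / 2) / (α + 1) * F1 *
        (2 * ((2 * α + 1) * co ^ 2 + (2 * β + 1) * s ^ 2)) := by
    field_simp
  rw [e1]
  rw [hr] at hode ⊢
  have e0 : F0 = ((-s ^ 2) * (1 - -s ^ 2) * (((α + β + 1 + z) / 2 + 1) * ((α + β + 1 - z) / 2 + 1) /
      (α + 1 + 1) * F2) + (α + 1 - ((α + β + 1 + z) / 2 + (α + β + 1 - z) / 2 + 1) * -s ^ 2) * F1)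
      / (α + 1) := by
    rw [eq_div_iff hc0]
    linear_combination -hode
  rw [e0]
  have hco4 : co * co = s ^ 2 + 1 := by rw [← hcs]; ring
  simp only [hcs, hco4]
  field_simp
  have h4 : co ^ 2 = s ^ 2 + 1 := hcs
  ring_nf
  simp only [h4]
  ring

end JacobiEquation

/-! ### Exponential series -/

section ExponentialSeries

/-- The series `∑ aₙ e^{-(ν + 2n) t}`. It converges for `t > 0` if the coefficients grow at most
polynomially. -/
noncomputable def expSeries (a : ℕ → ℂ) (ν : ℂ) (t : ℝ) : ℂ :=
  ∑' n : ℕ, a n * Complex.exp (-(ν + 2 * n) * t)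

lemma norm_exp_term (ν : ℂ) (n : ℕ) (t : ℝ) :
    ‖Complex.exp (-(ν + 2 * n) * t)‖ = Real.exp (-(ν.re * t)) * Real.exp (-(2 * t)) ^ n := by
  rw [Complex.norm_exp, ← Real.exp_nat_mul, ← Real.exp_add]
  congr 1
  simp
  ring

lemma summable_pow_mul_exp (K : ℕ) {t : ℝ} (ht : 0 < t) :
    Summable fun n : ℕ => ((n : ℝ) + 1) ^ K * Real.exp (-(2 * t)) ^ n := by
  have hr : Real.exp (-(2 * t)) < 1 := Real.exp_lt_one_iff.2 (by linarith)
  have h := summable_pow_mul_geometric_of_norm_lt_one K (r := Real.exp (-(2 * t)))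
    (by rwa [Real.norm_of_nonneg (Real.exp_pos _).le])
  rw [← summable_nat_add_iff 1] at h
  have h2 := h.mul_left (Real.exp (-(2 * t)))⁻¹
  refine h2.congr fun n => ?_
  have := (Real.exp_pos (-(2 * t))).ne'
  push_cast
  rw [pow_succ]
  field_simp

variable {a : ℕ → ℂ} {C : ℝ} {K : ℕ}

lemma norm_expSeries_term_le (ha : ∀ n, ‖a n‖ ≤ C * ((n : ℝ) + 1) ^ K) (ν : ℂ) {s t : ℝ}
    (hst : s ≤ t) (n : ℕ) :
    ‖a n * Complex.exp (-(ν + 2 * n) * t)‖ ≤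
      Real.exp (-(ν.re * t)) * (C * (((n : ℝ) + 1) ^ K * Real.exp (-(2 * s)) ^ n)) := by
  rw [norm_mul, norm_exp_term]
  have h1 : Real.exp (-(2 * t)) ≤ Real.exp (-(2 * s)) := Real.exp_le_exp.2 (by linarith)
  calc _ ≤ C * ((n : ℝ) + 1) ^ K * (Real.exp (-(ν.re * t)) * Real.exp (-(2 * s)) ^ n) := by
        have := ha n
        gcongr
        exact (norm_nonneg _).trans this
    _ = _ := by ring

lemma summable_expSeries (ha : ∀ n, ‖a n‖ ≤ C * ((n : ℝ) + 1) ^ K) (ν : ℂ) {t : ℝ} (ht : 0 < t) :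
    Summable fun n : ℕ => a n * Complex.exp (-(ν + 2 * n) * t) :=
  Summable.of_norm_bounded (((summable_pow_mul_exp K ht).mul_left C).mul_left _)
    fun n => norm_expSeries_term_le ha ν le_rfl n

lemma norm_expSeries_le (ha : ∀ n, ‖a n‖ ≤ C * ((n : ℝ) + 1) ^ K) (ν : ℂ) {s t : ℝ}
    (hs : 0 < s) (hst : s ≤ t) :
    ‖expSeries a ν t‖ ≤ Real.exp (-(ν.re * t)) *
      (C * ∑' n : ℕ, ((n : ℝ) + 1) ^ K * Real.exp (-(2 * s)) ^ n) := by
  have h := (((summable_pow_mul_exp K hs).hasSum.mul_left C).mul_left (Real.exp (-(ν.re * t))))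
  exact tsum_of_norm_bounded h fun n => norm_expSeries_term_le ha ν hst n

/-- Termwise differentiation preserves polynomial growth of the coefficients. -/
lemma norm_expSeries_deriv_coeff_le (ha : ∀ n, ‖a n‖ ≤ C * ((n : ℝ) + 1) ^ K) (ν : ℂ) (n : ℕ) :
    ‖-(ν + 2 * n) * a n‖ ≤ (‖ν‖ + 2) * C * ((n : ℝ) + 1) ^ (K + 1) := by
  have h1 : ‖-(ν + 2 * n)‖ ≤ (‖ν‖ + 2) * ((n : ℝ) + 1) := by
    rw [norm_neg]
    refine (norm_add_le _ _).trans ?_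
    simp only [norm_mul, Complex.norm_ofNat, Complex.norm_natCast]
    nlinarith [norm_nonneg ν, (Nat.cast_nonneg n : (0 : ℝ) ≤ n)]
  rw [norm_mul]
  calc _ ≤ (‖ν‖ + 2) * ((n : ℝ) + 1) * (C * ((n : ℝ) + 1) ^ K) := by
        have := ha n; gcongr
    _ = _ := by ring

lemma hasDerivAt_expSeries (ha : ∀ n, ‖a n‖ ≤ C * ((n : ℝ) + 1) ^ K) (ν : ℂ) {t : ℝ}
    (ht : 0 < t) :
    HasDerivAt (expSeries a ν) (expSeries (fun n => -(ν + 2 * n) * a n) ν t) t := by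
  have hb := norm_expSeries_deriv_coeff_le ha ν
  have hC : 0 ≤ C := by
    have := (norm_nonneg _).trans (ha 0)
    simpa using this
  have h := hasDerivAt_tsum_of_isPreconnected (t := Ioo (t / 2) (2 * t)) (y₀ := t) (y := t)
    (g := fun n (y : ℝ) => a n * Complex.exp (-(ν + 2 * n) * y))
    (g' := fun n (y : ℝ) => -(ν + 2 * n) * a n * Complex.exp (-(ν + 2 * n) * y))
    (((summable_pow_mul_exp (K + 1) (half_pos ht)).mul_left ((‖ν‖ + 2) * C)).mul_left
      (Real.exp (|ν.re| * (2 * t)))) isOpen_Ioo isPreconnected_Ioo (fun n y _ => ?_)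
    (fun n y hy => ?_) ⟨by linarith, by linarith⟩ (summable_expSeries ha ν ht)
    ⟨by linarith, by linarith⟩
  · exact h
  · have h1 : HasDerivAt (fun y : ℝ => -(ν + 2 * n) * (y : ℂ)) (-(ν + 2 * n)) y := by
      simpa using (Complex.ofRealCLM.hasDerivAt (x := y)).const_mul (-(ν + 2 * n))
    refine ((h1.cexp).const_mul (a n)).congr_deriv ?_
    ring
  · refine (norm_expSeries_term_le hb ν hy.1.le n).trans ?_
    gcongr
    have h1 := neg_abs_le ν.re
    have h2 := abs_nonneg ν.re
    nlinarith [hy.1, hy.2]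

/-- The leading coefficient governs the behaviour at infinity. -/
lemma tendsto_expSeries_mul_exp (ha : ∀ n, ‖a n‖ ≤ C * ((n : ℝ) + 1) ^ K) (ν : ℂ) :
    Tendsto (fun t : ℝ => expSeries a ν t * Complex.exp (ν * t)) atTop (𝓝 (a 0)) := by
  have e : ∀ t : ℝ, expSeries a ν t * Complex.exp (ν * t) =
      ∑' n : ℕ, a n * Complex.exp (-(0 + 2 * n) * t) := by
    intro t
    rw [expSeries, ← tsum_mul_right]
    refine tsum_congr fun n => ?_
    rw [mul_assoc, ← Complex.exp_add]
    ring_nf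
  simp_rw [e]
  have h := tendsto_tsum_of_dominated_convergence (𝓕 := atTop)
    (f := fun (t : ℝ) (n : ℕ) => a n * Complex.exp (-(0 + 2 * n) * t))
    (g := fun n : ℕ => if n = 0 then a 0 else 0)
    (bound := fun n => C * (((n : ℝ) + 1) ^ K * Real.exp (-(2 * 1)) ^ n))
    ((summable_pow_mul_exp K one_pos).mul_left C) (fun n => ?_) ?_
  · simpa using h
  · rcases eq_or_ne n 0 with rfl | hn
    · simp
    · simp only [hn, if_false]
      rw [tendsto_zero_iff_norm_tendsto_zero]
      simp only [norm_mul, norm_exp_term]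
      have h1 : Tendsto (fun t : ℝ => Real.exp (-(2 * t))) atTop (𝓝 0) :=
        Real.tendsto_exp_neg_atTop_nhds_zero.comp (tendsto_id.const_mul_atTop two_pos)
      have h2 := (h1.pow n).const_mul ‖a n‖
      simpa [hn] using h2
  · filter_upwards [eventually_ge_atTop 1] with t ht n
    have := norm_expSeries_term_le ha 0 ht n
    simpa using this

/-- An exponential series whose coefficients and exponent depend holomorphically on a parameter is
holomorphic, provided that the coefficients grow polynomially, locally uniformly. -/
lemma differentiableOn_expSeries_param {a : ℂ → ℕ → ℂ} {U : Set ℂ} (hU : IsOpen U)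
    {ν : ℂ → ℂ} (hν : DifferentiableOn ℂ ν U) (hd : ∀ n, DifferentiableOn ℂ (fun z => a z n) U)
    (hb : ∀ M : ℝ, ∃ C : ℝ, ∃ K : ℕ, ∀ z ∈ U, ‖z‖ ≤ M → ∀ n, ‖a z n‖ ≤ C * ((n : ℝ) + 1) ^ K)
    {t : ℝ} (ht : 0 < t) : DifferentiableOn ℂ (fun z => expSeries (a z) (ν z) t) U := by
  intro z₀ hz₀
  obtain ⟨C, K, hCK⟩ := hb (‖z₀‖ + 1)
  have hcont : ContinuousAt (fun z => Real.exp (-((ν z).re * t))) z₀ := by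
    have := (hν.continuousOn.continuousAt (hU.mem_nhds hz₀))
    fun_prop
  have h1 := hcont.eventually_lt continuousAt_const (lt_add_one _)
  have h2 : ∀ᶠ z in 𝓝 z₀, ‖z‖ < ‖z₀‖ + 1 :=
    continuous_norm.continuousAt.eventually_lt continuousAt_const (lt_add_one _)
  obtain ⟨V, hV, hVo, hzV⟩ := eventually_nhds_iff.1 ((h1.and h2).and (hU.mem_nhds hz₀))
  have hd := Complex.differentiableOn_tsum_of_summable_norm (U := V)
    (F := fun n z => a z n * Complex.exp (-(ν z + 2 * n) * t))
    (((summable_pow_mul_exp K ht).mul_left C).mul_left (Real.exp (-((ν z₀).re * t)) + 1))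
    (fun n => by
      have := (hd n).mono fun z hz => (hV z hz).2
      have := hν.mono fun z hz => (hV z hz).2
      fun_prop) hVo (fun n z hz => by
      obtain ⟨⟨q1, q2⟩, q3⟩ := hV z hz
      have hb := hCK z q3 q2.le
      refine (norm_expSeries_term_le hb (ν z) le_rfl n).trans ?_
      have hC : 0 ≤ C := by
        have := (norm_nonneg _).trans (hb 0)
        simpa using this
      gcongr)
  exact (hd.differentiableAt (hVo.mem_nhds hzV)).differentiableWithinAt

end ExponentialSeries

/-! ### The Harish-Chandra series -/

section HarishChandraSeries

/-- The coefficients of the Harish-Chandra series, given by the recursion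
`n (n + z) Γₙ = (α - β) (ρ + 2 (n - 1) + z) Γₙ₋₁ + (ρ + n - 2) (ρ + n - 2 + z) Γₙ₋₂`. -/
noncomputable def hcCoeff (α β : ℝ) (z : ℂ) : ℕ → ℂ
  | 0 => 1
  | 1 => (α - β) * (rho α β + z) / (1 + z)
  | n + 2 => ((α - β) * (rho α β + 2 * (n + 1) + z) * hcCoeff α β z (n + 1) +
      (rho α β + n) * (rho α β + n + z) * hcCoeff α β z n) / ((n + 2) * (n + 2 + z))

/-- The solution `Φ(t) = ∑ Γₙ e^{-(z + ρ + 2n) t}` of the Jacobi equation. -/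
noncomputable def hcPhi (α β : ℝ) (z : ℂ) (t : ℝ) : ℂ :=
  expSeries (hcCoeff α β z) (z + rho α β) t

/-- The derivative of `hcPhi` in `t`. -/
noncomputable def hcPhiDeriv (α β : ℝ) (z : ℂ) (t : ℝ) : ℂ :=
  expSeries (fun n => -(z + rho α β + 2 * n) * hcCoeff α β z n) (z + rho α β) t

variable {α β : ℝ} {z : ℂ}

lemma half_le_norm_nat_add (hz : -(1 / 2) ≤ z.re) (n : ℕ) :
    ((n : ℝ) + 1) / 2 ≤ ‖(n : ℂ) + 1 + z‖ := by
  refine le_trans ?_ (Complex.re_le_norm _)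
  simp
  have : (0 : ℝ) ≤ n := n.cast_nonneg
  linarith

lemma nat_add_ne_zero (hz : -(1 / 2) ≤ z.re) (n : ℕ) : (n : ℂ) + 1 + z ≠ 0 := by
  have := half_le_norm_nat_add hz n
  intro h
  rw [h, norm_zero] at this
  have : (0 : ℝ) ≤ n := n.cast_nonneg
  linarith

/-- The coefficients of the Harish-Chandra series grow at most polynomially, uniformly in the
spectral parameter. -/
lemma exists_norm_hcCoeff_le (α β : ℝ) : ∃ K : ℕ, ∀ z : ℂ, -(1 / 2) ≤ z.re →
    ∀ n, ‖hcCoeff α β z n‖ ≤ ((n : ℝ) + 1) ^ K := by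
  -- The recursion bounds the coefficient of index `n + 2` by the maximum of the two preceding ones
  -- times `1 + (A + 3 E + 2 E²) / (n + 2)`, and a product of such factors is dominated by a power
  -- of `n`.
  set A := |α - β| * (3 + 2 * |rho α β|) with hA
  set E := |rho α β - 2| with hE
  obtain ⟨K, hK⟩ := exists_nat_ge (A + (3 * E + 2 * E ^ 2))
  refine ⟨K, fun z hz => ?_⟩
  have hA0 : 0 ≤ A := by positivity
  have hE0 : 0 ≤ E := by positivity
  have hAB : ‖(α : ℂ) - β‖ = |α - β| := by rw [← Complex.ofReal_sub, Complex.norm_real]; rfl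
  have hbern : ∀ n : ℕ, (1 + K / ((n : ℝ) + 1)) * ((n : ℝ) + 1) ^ K ≤ ((n : ℝ) + 1 + 1) ^ K := by
    intro n
    have h := one_add_mul_le_pow (a := 1 / ((n : ℝ) + 1)) (by
      have : 0 ≤ 1 / ((n : ℝ) + 1) := by positivity
      linarith) K
    calc _ = (1 + K * (1 / ((n : ℝ) + 1))) * ((n : ℝ) + 1) ^ K := by ring
      _ ≤ (1 + 1 / ((n : ℝ) + 1)) ^ K * ((n : ℝ) + 1) ^ K := by gcongr
      _ = _ := by rw [← mul_pow]; congr 1; field_simp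
  have hfirst : ∀ n : ℕ, ‖((α : ℂ) - β) * (rho α β + 2 * n + z) / (((n : ℂ) + 1) * (n + 1 + z))‖ ≤
      A / ((n : ℝ) + 1) := by
    intro n
    have hn := half_le_norm_nat_add hz n
    have hn0 : (0 : ℝ) ≤ n := n.cast_nonneg
    have hpos : 0 < ‖(n : ℂ) + 1 + z‖ := by linarith
    have h1 : ‖(rho α β : ℂ) + 2 * n + z‖ ≤ (3 + 2 * |rho α β|) * ‖(n : ℂ) + 1 + z‖ := by
      have e : (rho α β : ℂ) + 2 * n + z = (n + 1 + z) + (((n - 1 : ℝ) : ℂ) + rho α β) := by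
        push_cast; ring
      rw [e]
      refine (norm_add_le _ _).trans ?_
      have h2 : ‖((n - 1 : ℝ) : ℂ) + rho α β‖ ≤ ((n : ℝ) + 1) + |rho α β| := by
        refine (norm_add_le _ _).trans ?_
        rw [Complex.norm_real, Complex.norm_real, Real.norm_eq_abs, Real.norm_eq_abs]
        gcongr
        rw [abs_le]; constructor <;> linarith
      nlinarith [abs_nonneg (rho α β)]
    rw [norm_div, norm_mul, norm_mul, hAB, hA]
    have h3 : ‖(n : ℂ) + 1‖ = (n : ℝ) + 1 := by
      rw [← Complex.ofReal_natCast, ← Complex.ofReal_one, ← Complex.ofReal_add,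
        Complex.norm_of_nonneg (by positivity)]
    rw [h3, div_le_div_iff₀ (by positivity) (by positivity)]
    calc _ ≤ |α - β| * ((3 + 2 * |rho α β|) * ‖(n : ℂ) + 1 + z‖) * ((n : ℝ) + 1) := by gcongr
      _ = _ := by ring
  have hsecond : ∀ n : ℕ, ‖((rho α β : ℂ) + n) * (rho α β + n + z) /
      (((n : ℂ) + 2) * (n + 2 + z))‖ ≤ 1 + (3 * E + 2 * E ^ 2) / ((n : ℝ) + 1 + 1) := by
    intro n
    have hn := half_le_norm_nat_add hz (n + 1)
    have hn0 : (0 : ℝ) ≤ n := n.cast_nonneg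
    push_cast at hn
    rw [show (n : ℂ) + 1 + 1 + z = n + 2 + z by ring] at hn
    have hpos : 0 < ‖(n : ℂ) + 2 + z‖ := by linarith
    have hEn : ‖(rho α β : ℂ) - 2‖ = E := by
      rw [← Complex.ofReal_ofNat, ← Complex.ofReal_sub, Complex.norm_real]; rfl
    have h3 : ‖(n : ℂ) + 2‖ = (n : ℝ) + 2 := by
      rw [← Complex.ofReal_natCast, ← Complex.ofReal_ofNat, ← Complex.ofReal_add,
        Complex.norm_of_nonneg (by positivity)]
    have h1 : ‖((rho α β : ℂ) + n) / ((n : ℂ) + 2)‖ ≤ 1 + E / ((n : ℝ) + 2) := by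
      have e : (rho α β : ℂ) + n = (n + 2) + (rho α β - 2) := by ring
      rw [norm_div, div_le_iff₀ (by rw [h3]; positivity), e, h3]
      refine (norm_add_le _ _).trans ?_
      rw [h3, hEn]
      field_simp
      rfl
    have h2 : ‖((rho α β : ℂ) + n + z) / ((n : ℂ) + 2 + z)‖ ≤ 1 + 2 * E / ((n : ℝ) + 2) := by
      have e : (rho α β : ℂ) + n + z = (n + 2 + z) + (rho α β - 2) := by ring
      rw [norm_div, div_le_iff₀ hpos, e]
      refine (norm_add_le _ _).trans ?_
      rw [hEn, add_mul, one_mul, div_mul_eq_mul_div]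
      gcongr
      rw [le_div_iff₀ (by positivity)]
      nlinarith
    have hfrac : E * E / (((n : ℝ) + 2) * (n + 2)) ≤ E * E / ((n : ℝ) + 2) := by
      gcongr
      nlinarith
    rw [mul_div_mul_comm, norm_mul]
    calc _ ≤ (1 + E / ((n : ℝ) + 2)) * (1 + 2 * E / ((n : ℝ) + 2)) := by gcongr
      _ = 1 + 3 * E / ((n : ℝ) + 2) + 2 * (E * E / (((n : ℝ) + 2) * (n + 2))) := by
        field_simp; ring
      _ ≤ 1 + 3 * E / ((n : ℝ) + 2) + 2 * (E * E / ((n : ℝ) + 2)) := by gcongr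
      _ = _ := by
        rw [show (n : ℝ) + 1 + 1 = n + 2 by ring]; ring
  have key : ∀ n : ℕ, ‖hcCoeff α β z n‖ ≤ ((n : ℝ) + 1) ^ K ∧
      ‖hcCoeff α β z (n + 1)‖ ≤ (((n + 1 : ℕ) : ℝ) + 1) ^ K := by
    intro n
    induction n with
    | zero =>
      refine ⟨by simp [hcCoeff], ?_⟩
      have h1 := hfirst 0
      have h2 := hbern 0
      simp only [Nat.cast_zero, zero_add, mul_zero, add_zero, div_one, one_pow, mul_one,
        one_mul] at h1 h2
      simp only [hcCoeff]
      norm_num at h1 h2 ⊢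
      nlinarith
    | succ n ih =>
      refine ⟨ih.2, ?_⟩
      have hn0 : (0 : ℝ) ≤ n := n.cast_nonneg
      have h1 := hfirst (n + 1)
      have h2 := hsecond n
      have h3 := hbern (n + 1)
      push_cast at h1 h2 h3 ih ⊢
      rw [show (n : ℂ) + 1 + 1 = n + 2 by ring] at h1
      have e : hcCoeff α β z (n + 1 + 1) =
          ((α : ℂ) - β) * (rho α β + 2 * (n + 1) + z) / (((n : ℂ) + 2) * (n + 2 + z)) *
            hcCoeff α β z (n + 1) +
          ((rho α β : ℂ) + n) * (rho α β + n + z) / (((n : ℂ) + 2) * (n + 2 + z)) *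
            hcCoeff α β z n := by
        simp only [hcCoeff]
        ring
      rw [e]
      have hmono : ((n : ℝ) + 1) ^ K ≤ ((n : ℝ) + 1 + 1) ^ K := by gcongr; linarith
      refine (norm_add_le _ _).trans ?_
      rw [norm_mul, norm_mul]
      calc _ ≤ A / ((n : ℝ) + 1 + 1) * ((n : ℝ) + 1 + 1) ^ K +
            (1 + (3 * E + 2 * E ^ 2) / ((n : ℝ) + 1 + 1)) * ((n : ℝ) + 1 + 1) ^ K := by
            gcongr
            · exact ih.2
            · exact ih.1.trans hmono
        _ = (1 + (A + (3 * E + 2 * E ^ 2)) / ((n : ℝ) + 1 + 1)) * ((n : ℝ) + 1 + 1) ^ K := by ring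
        _ ≤ (1 + K / ((n : ℝ) + 1 + 1)) * ((n : ℝ) + 1 + 1) ^ K := by gcongr
        _ ≤ _ := h3
  exact fun n => (key n).1

lemma hcCoeff_rec (hz : -(1 / 2) ≤ z.re) (n : ℕ) :
    ((n : ℂ) + 2) * (n + 2 + z) * hcCoeff α β z (n + 2) =
      (α - β) * (rho α β + 2 * (n + 1) + z) * hcCoeff α β z (n + 1) +
      (rho α β + n) * (rho α β + n + z) * hcCoeff α β z n := by
  have h1 : (n : ℂ) + 2 + z ≠ 0 := by
    have := nat_add_ne_zero hz (n + 1)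
    push_cast at this
    rwa [show (n : ℂ) + 1 + 1 + z = n + 2 + z by ring] at this
  have h2 : (n : ℂ) + 2 ≠ 0 := by exact_mod_cast (Nat.succ_ne_zero (n + 1))
  rw [hcCoeff]
  field_simp

lemma differentiableOn_hcCoeff (α β : ℝ) (n : ℕ) :
    DifferentiableOn ℂ (fun z => hcCoeff α β z n) {z | -(1 / 2) < z.re} := by
  have key : DifferentiableOn ℂ (fun z => hcCoeff α β z n) {z | -(1 / 2) < z.re} ∧
      DifferentiableOn ℂ (fun z => hcCoeff α β z (n + 1)) {z | -(1 / 2) < z.re} := by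
    induction n with
    | zero =>
      refine ⟨by simp only [hcCoeff]; fun_prop, ?_⟩
      simp only [hcCoeff]
      refine DifferentiableOn.fun_div (by fun_prop) (by fun_prop) fun z hz => ?_
      simpa using nat_add_ne_zero (z := z) (le_of_lt hz) 0
    | succ n ih =>
      refine ⟨ih.2, ?_⟩
      obtain ⟨h1, h2⟩ := ih
      simp only [hcCoeff]
      refine DifferentiableOn.fun_div (by fun_prop) (by fun_prop) fun z hz => ?_
      have h1 := nat_add_ne_zero (z := z) (le_of_lt hz) (n + 1)
      push_cast at h1
      rw [show (n : ℂ) + 1 + 1 + z = n + 2 + z by ring] at h1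
      exact mul_ne_zero (by exact_mod_cast (Nat.succ_ne_zero (n + 1))) h1
  exact key.1

lemma isOpen_re_gt (x : ℝ) : IsOpen {z : ℂ | x < z.re} :=
  isOpen_lt continuous_const Complex.continuous_re

lemma differentiableOn_hcPhi (α β : ℝ) {t : ℝ} (ht : 0 < t) :
    DifferentiableOn ℂ (fun z => hcPhi α β z t) {z | -(1 / 2) < z.re} := by
  obtain ⟨K, hK⟩ := exists_norm_hcCoeff_le α β
  exact differentiableOn_expSeries_param (isOpen_re_gt _) (by fun_prop)
    (differentiableOn_hcCoeff α β)
    (fun M => ⟨1, K, fun z hz _ n => by rw [one_mul]; exact hK z (le_of_lt hz) n⟩) ht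

lemma differentiableOn_hcPhiDeriv (α β : ℝ) {t : ℝ} (ht : 0 < t) :
    DifferentiableOn ℂ (fun z => hcPhiDeriv α β z t) {z | -(1 / 2) < z.re} := by
  obtain ⟨K, hK⟩ := exists_norm_hcCoeff_le α β
  refine differentiableOn_expSeries_param (isOpen_re_gt _) (by fun_prop)
    (fun n => ?_) (fun M => ⟨(M + ‖(rho α β : ℂ)‖ + 2) * 1, K + 1, fun z hz hM n => ?_⟩) ht
  · have := differentiableOn_hcCoeff α β n
    fun_prop
  · refine (norm_expSeries_deriv_coeff_le (C := 1) (K := K)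
      (fun n => by rw [one_mul]; exact hK z (le_of_lt hz) n) (z + rho α β) n).trans ?_
    gcongr
    exact (norm_add_le _ _).trans (by gcongr)

/-- The Harish-Chandra series solves the Jacobi equation. With `w = e^{-2t}`, the equation
multiplied by `1 - w²` has polynomial coefficients in `w`, and the comparison of the coefficients of
`e^{-(z + ρ + 2n) t}` is the recursion that defines the series. -/
lemma isJacobiSolution_hcPhi (hz : -(1 / 2) ≤ z.re) :
    IsJacobiSolution α β z (hcPhi α β z) (hcPhiDeriv α β z) := by
  obtain ⟨K, hK⟩ := exists_norm_hcCoeff_le α β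
  set ν : ℂ := z + rho α β with hν
  have b0 : ∀ n, ‖hcCoeff α β z n‖ ≤ 1 * ((n : ℝ) + 1) ^ K := fun n => by
    rw [one_mul]; exact hK z hz n
  have b1 := norm_expSeries_deriv_coeff_le b0 ν
  have b2 := norm_expSeries_deriv_coeff_le b1 ν
  intro t ht
  refine ⟨hasDerivAt_expSeries b0 ν ht, ?_⟩
  refine (hasDerivAt_expSeries b1 ν ht).congr_deriv ?_
  set w : ℂ := Complex.exp (-(2 * t)) with hw
  set e : ℕ → ℂ := fun n => Complex.exp (-(ν + 2 * n) * t) with he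
  have he1 : ∀ n, w * e n = e (n + 1) := fun n => by
    simp only [he, hw]
    rw [← Complex.exp_add]; congr 1; push_cast; ring
  have s0 := (summable_expSeries b0 ν ht).hasSum
  have s1 := (summable_expSeries b1 ν ht).hasSum
  have s2 := (summable_expSeries b2 ν ht).hasSum
  change HasSum _ (hcPhi α β z t) at s0
  change HasSum _ (hcPhiDeriv α β z t) at s1
  set S0 := hcPhi α β z t
  set S1 := hcPhiDeriv α β z t
  change HasSum _ (expSeries (fun n => -(ν + 2 * n) * (-(ν + 2 * n) * hcCoeff α β z n)) ν t) at s2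
  set S2 := expSeries (fun n => -(ν + 2 * n) * (-(ν + 2 * n) * hcCoeff α β z n)) ν t
  set ρ : ℂ := Complex.ofReal (rho α β) with hρ
  have sA := ((s2.add (s1.mul_left (2 * ρ))).add (s0.mul_left (ρ ^ 2 - z ^ 2)))
  have sB := (s1.mul_left (4 * (α - β : ℂ))).mul_left w
  have sC := (((s1.mul_left (2 * ρ)).sub s2).sub (s0.mul_left (ρ ^ 2 - z ^ 2))).mul_left (w ^ 2)
  -- The factors `w` and `w²` shift the index, so the terms of `sA` from index two on and those of
  -- `sB` from index one on match the terms of `sC`.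
  rw [← hasSum_nat_add_iff' 2] at sA
  rw [← hasSum_nat_add_iff' 1] at sB
  have h1z : (1 : ℂ) + z ≠ 0 := by simpa using nat_add_ne_zero hz 0
  have hsum := ((sA.add sB).add sC)
  have hzero := hsum.unique (hasSum_zero.congr_fun fun n => by
    have hrec := hcCoeff_rec (α := α) (β := β) hz n
    have e1 : Complex.exp (-(ν + 2 * ((n + 2 : ℕ) : ℂ)) * t) = e (n + 2) := rfl
    have e2 : w * Complex.exp (-(ν + 2 * ((n + 1 : ℕ) : ℂ)) * t) = e (n + 2) := he1 (n + 1)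
    have e3 : w ^ 2 * Complex.exp (-(ν + 2 * (n : ℂ)) * t) = e (n + 2) := by
      rw [sq, mul_assoc]
      change w * (w * e n) = _
      rw [he1, he1]
    have e4 : ∀ x y v : ℂ, w * (x * (y * v)) = x * y * (w * v) := fun x y v => by ring
    have e5 : w ^ 2 * (2 * ρ * (-(ν + 2 * n) * hcCoeff α β z n *
          Complex.exp (-(ν + 2 * (n : ℂ)) * t)) -
        -(ν + 2 * n) * (-(ν + 2 * n) * hcCoeff α β z n) * Complex.exp (-(ν + 2 * (n : ℂ)) * t) -
        (ρ ^ 2 - z ^ 2) * (hcCoeff α β z n * Complex.exp (-(ν + 2 * (n : ℂ)) * t))) =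
        (2 * ρ * (-(ν + 2 * n) * hcCoeff α β z n) -
        -(ν + 2 * n) * (-(ν + 2 * n) * hcCoeff α β z n) -
        (ρ ^ 2 - z ^ 2) * hcCoeff α β z n) *
        (w ^ 2 * Complex.exp (-(ν + 2 * (n : ℂ)) * t)) := by ring
    simp only [e4, e5, e1, e2, e3]
    push_cast
    simp only [hν]
    linear_combination (4 * e (n + 2)) * hrec)
  simp only [Finset.sum_range_succ, Finset.range_zero, Finset.sum_empty] at hzero
  have f0 : Complex.exp (-(ν + 2 * ((0 : ℕ) : ℂ)) * t) = e 0 := rfl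
  have f1 : Complex.exp (-(ν + 2 * ((1 : ℕ) : ℂ)) * t) = w * e 0 := by rw [he1 0]
  have c0 : hcCoeff α β z 0 = 1 := rfl
  have c1 : hcCoeff α β z 1 = (α - β) * (ρ + z) / (1 + z) := rfl
  rw [f0, f1, c0, c1] at hzero
  have hode : (1 - w ^ 2) * S2 + (2 * ρ * (1 + w ^ 2) + 4 * (α - β) * w) * S1 +
      (ρ ^ 2 - z ^ 2) * (1 - w ^ 2) * S0 = 0 := by
    rw [← hzero]
    simp only [hν]
    push_cast
    field_simp
    ring
  have hwr : w = ((Real.exp (-(2 * t)) : ℝ) : ℂ) := by rw [hw]; push_cast; rfl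
  have hr1 : Real.exp (-(2 * t)) < 1 := Real.exp_lt_one_iff.2 (by linarith)
  have hr0 := Real.exp_pos (-(2 * t))
  have hw1 : 1 - w ≠ 0 := by
    rw [hwr]; exact_mod_cast (sub_pos.2 hr1).ne'
  have hw2 : 1 + w ≠ 0 := by
    rw [hwr]; exact_mod_cast (add_pos one_pos hr0).ne'
  have hh : ((halfLogDeriv α β t : ℝ) : ℂ) = (α + 1 / 2) * ((1 + w) / (1 - w)) +
      (β + 1 / 2) * ((1 - w) / (1 + w)) := by
    have hq : Real.cosh t / Real.sinh t =
        (1 + Real.exp (-(2 * t))) / (1 - Real.exp (-(2 * t))) := by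
      have e1 := two_mul_sinh_eq t
      have e2 := two_mul_cosh_eq t
      rw [← mul_div_mul_left _ _ two_ne_zero, e1, e2,
        mul_div_mul_left _ _ (Real.exp_pos t).ne']
    have hq' : Real.sinh t / Real.cosh t =
        (1 - Real.exp (-(2 * t))) / (1 + Real.exp (-(2 * t))) := by
      rw [← inv_div, hq, inv_div]
    rw [halfLogDeriv, hq, hq', hwr]
    push_cast
    ring
  have hρ' : ρ = α + β + 1 := by rw [hρ]; unfold rho; push_cast; ring
  rw [hh]
  have hw3 : 1 - w ^ 2 ≠ 0 := by
    rw [show 1 - w ^ 2 = (1 - w) * (1 + w) by ring]; exact mul_ne_zero hw1 hw2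
  refine mul_left_cancel₀ hw3 ?_
  have hcoef : (1 - w ^ 2) * (2 * ((α + 1 / 2) * ((1 + w) / (1 - w)) +
      (β + 1 / 2) * ((1 - w) / (1 + w)))) = 2 * ρ * (1 + w ^ 2) + 4 * (α - β) * w := by
    rw [hρ', show 1 - w ^ 2 = (1 - w) * (1 + w) by ring]
    field_simp
    ring
  linear_combination hode + S1 * hcoef

lemma tendsto_hcPhi_mul_exp (hz : -(1 / 2) ≤ z.re) :
    Tendsto (fun t : ℝ => hcPhi α β z t * Complex.exp ((z + rho α β) * t)) atTop (𝓝 1) := by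
  obtain ⟨K, hK⟩ := exists_norm_hcCoeff_le α β
  exact tendsto_expSeries_mul_exp (C := 1) (K := K)
    (fun n => by rw [one_mul]; exact hK z hz n) _

lemma tendsto_hcPhiDeriv_mul_exp (hz : -(1 / 2) ≤ z.re) :
    Tendsto (fun t : ℝ => hcPhiDeriv α β z t * Complex.exp ((z + rho α β) * t)) atTop
      (𝓝 (-(z + rho α β))) := by
  obtain ⟨K, hK⟩ := exists_norm_hcCoeff_le α β
  have h := tendsto_expSeries_mul_exp (norm_expSeries_deriv_coeff_le (C := 1) (K := K)
    (fun n => by rw [one_mul]; exact hK z hz n) (z + rho α β)) (z + rho α β)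
  have e : -(z + rho α β + 2 * ((0 : ℕ) : ℂ)) * hcCoeff α β z 0 = -(z + rho α β) := by
    simp [hcCoeff]
  rwa [e] at h

/-- The Harish-Chandra series is bounded, uniformly in the spectral parameter, by its leading
exponential. -/
theorem exists_norm_hcPhi_le (α β : ℝ) : ∃ C : ℝ, 0 < C ∧ ∀ (z : ℂ) (t : ℝ), 0 ≤ z.re → 1 ≤ t →
    ‖hcPhi α β z t‖ ≤ C * Real.exp (-((z.re + rho α β) * t)) := by
  obtain ⟨K, hK⟩ := exists_norm_hcCoeff_le α β
  refine ⟨∑' n : ℕ, ((n : ℝ) + 1) ^ K * Real.exp (-(2 * 1)) ^ n,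
    (summable_pow_mul_exp K one_pos).tsum_pos (fun n => by positivity) 0 (by simp),
    fun z t hz ht => ?_⟩
  have h := norm_expSeries_le (a := hcCoeff α β z) (C := 1) (K := K)
    (fun n => by rw [one_mul]; exact hK z (by linarith) n) (z + rho α β) one_pos ht
  rw [one_mul, mul_comm] at h
  simpa [hcPhi] using h

end HarishChandraSeries

/-! ### Gauss' summation theorem -/

section GaussSummation

open scoped Nat

lemma ne_neg_nat_of_re_pos {c : ℂ} (hc : 0 < c.re) (k : ℕ) : c ≠ -k := by
  intro h
  have h1 := congrArg Complex.re h
  simp at h1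
  have : (0 : ℝ) ≤ k := k.cast_nonneg
  linarith

lemma betaIntegral_mul_two_f_one_coeff (a : ℂ) {b c : ℂ} (hb : 0 < b.re) (hcb : 0 < (c - b).re)
    (n : ℕ) : Complex.betaIntegral b (c - b) * ordinaryHypergeometricCoefficient a b c n =
      (ascPochhammer ℂ n).eval a / (n ! : ℂ) * Complex.betaIntegral (b + n) (c - b) := by
  have hc : 0 < c.re := by simp at hcb; linarith
  have hbn : 0 < (b + n).re := by
    simp; have : (0 : ℝ) ≤ n := n.cast_nonneg
    linarith
  have h1 := Complex.Gamma_add_nat_div_Gamma_eq (n := n) b (ne_neg_nat_of_re_pos hb)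
  have h2 := Complex.Gamma_add_nat_div_Gamma_eq (n := n) c (ne_neg_nat_of_re_pos hc)
  have g1 := Complex.Gamma_ne_zero_of_re_pos hb
  have g2 := Complex.Gamma_ne_zero_of_re_pos hc
  have g3 : Complex.Gamma (c + n) ≠ 0 := Complex.Gamma_ne_zero_of_re_pos (by
    simp; have : (0 : ℝ) ≤ n := n.cast_nonneg
    linarith)
  rw [Complex.betaIntegral_eq_Gamma_mul_div _ _ hb hcb,
    Complex.betaIntegral_eq_Gamma_mul_div _ _ hbn hcb, ordinaryHypergeometricCoefficient,
    ← h1, ← h2, show b + n + (c - b) = c + n by ring, add_sub_cancel]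
  field_simp

/-- Euler's integral representation of `₂F₁` on `[0, 1)`. -/
lemma betaIntegral_mul_two_f_one (a : ℂ) {b c : ℂ} (hb : 0 < b.re) (hcb : 0 < (c - b).re)
    {x : ℝ} (hx0 : 0 ≤ x) (hx1 : x < 1) :
    Complex.betaIntegral b (c - b) * ₂F₁ a b c (x : ℂ) =
      ∫ s : ℝ in (0 : ℝ)..1, (1 - (x * s : ℂ)) ^ (-a) *
        ((s : ℂ) ^ (b - 1) * (1 - (s : ℂ)) ^ (c - b - 1)) := by
  have hc : 0 < c.re := by simp at hcb; linarith
  have hconv := Complex.betaIntegral_convergent hb hcb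
  set w : ℝ → ℂ := fun s => (s : ℂ) ^ (b - 1) * (1 - (s : ℂ)) ^ (c - b - 1) with hw
  have hnx : ‖(x : ℂ)‖ < 1 := by rwa [Complex.norm_of_nonneg hx0]
  have hsum : Summable fun n : ℕ => ‖(ascPochhammer ℂ n).eval a / (n ! : ℂ)‖ * x ^ n := by
    have := (hasSum_one_sub_cpow_neg a hnx).summable.norm
    simpa [norm_mul, norm_pow, Complex.norm_of_nonneg hx0, abs_of_nonneg hx0] using this
  have h := intervalIntegral.hasSum_integral_of_dominated_convergence (a := 0) (b := 1)
    (μ := volume)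
    (F := fun (n : ℕ) (s : ℝ) => (ascPochhammer ℂ n).eval a / (n ! : ℂ) * (x * s : ℂ) ^ n * w s)
    (f := fun s : ℝ => (1 - (x * s : ℂ)) ^ (-a) * w s)
    (fun n s => ‖(ascPochhammer ℂ n).eval a / (n ! : ℂ)‖ * x ^ n * ‖w s‖)
    (fun n => by
      have hm : AEStronglyMeasurable w (volume.restrict (uIoc (0 : ℝ) 1)) := by
        rw [uIoc_of_le zero_le_one]
        exact hconv.1.aestronglyMeasurable
      exact AEStronglyMeasurable.mul (Continuous.aestronglyMeasurable (by fun_prop)) hm)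
    (fun n => Eventually.of_forall fun s hs => by
      rw [uIoc_of_le zero_le_one] at hs
      rw [norm_mul, norm_mul, norm_pow, norm_mul, Complex.norm_of_nonneg hx0,
        Complex.norm_of_nonneg hs.1.le]
      gcongr
      · exact mul_nonneg hx0 hs.1.le
      · exact mul_le_of_le_one_right hx0 hs.2)
    (Eventually.of_forall fun s _ => hsum.mul_right _)
    (by
      simp only [tsum_mul_right]
      exact (hconv.norm).const_mul _)
    (Eventually.of_forall fun s hs => by
      rw [uIoc_of_le zero_le_one] at hs
      refine (hasSum_one_sub_cpow_neg a (z := x * s) ?_).mul_right _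
      rw [norm_mul, Complex.norm_of_nonneg hx0, Complex.norm_of_nonneg hs.1.le]
      exact (mul_le_of_le_one_right hx0 hs.2).trans_lt hx1)
  rw [← h.tsum_eq, ← (hasSum_two_f_one a b (ne_neg_nat_of_re_pos hc) hnx).tsum_eq,
    ← tsum_mul_left]
  refine tsum_congr fun n => ?_
  rw [← mul_assoc, betaIntegral_mul_two_f_one_coeff a hb hcb, Complex.betaIntegral]
  rw [← intervalIntegral.integral_const_mul, ← intervalIntegral.integral_mul_const]
  refine intervalIntegral.integral_congr_ae (Eventually.of_forall fun s hs => ?_)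
  rw [uIoc_of_le zero_le_one] at hs
  have hs0 : (s : ℂ) ≠ 0 := by exact_mod_cast hs.1.ne'
  rw [show b + n - 1 = (n : ℂ) + (b - 1) by ring, Complex.cpow_add _ _ hs0, Complex.cpow_natCast,
    hw, mul_pow]
  ring

/-- Gauss' summation theorem, as the value of the limit of `₂F₁` at `1`. -/
theorem tendsto_two_f_one_one {a : ℝ} {b c : ℂ} (ha : 0 ≤ a) (hb : 0 < b.re)
    (hcb : a < (c - b).re) :
    Tendsto (fun x : ℝ => ₂F₁ (a : ℂ) b c (x : ℂ)) (𝓝[<] 1)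
      (𝓝 (Complex.Gamma c * Complex.Gamma (c - a - b) /
        (Complex.Gamma (c - a) * Complex.Gamma (c - b)))) := by
  have hcb0 : 0 < (c - b).re := ha.trans_lt hcb
  have hcab : 0 < (c - a - b).re := by simp at hcb ⊢; linarith
  have hconv := Complex.betaIntegral_convergent hb hcab
  have hconv0 := Complex.betaIntegral_convergent hb hcb0
  have hlim := intervalIntegral.tendsto_integral_filter_of_dominated_convergence (a := 0) (b := 1)
    (μ := volume) (l := 𝓝[<] (1 : ℝ))
    (F := fun (x : ℝ) (s : ℝ) => (1 - (x * s : ℂ)) ^ (-(a : ℂ)) *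
        ((s : ℂ) ^ (b - 1) * (1 - (s : ℂ)) ^ (c - b - 1)))
    (f := fun s : ℝ => (s : ℂ) ^ (b - 1) * (1 - (s : ℂ)) ^ (c - a - b - 1))
    (fun s => ‖(s : ℂ) ^ (b - 1) * (1 - (s : ℂ)) ^ (c - a - b - 1)‖) ?_ ?_ hconv.norm ?_
  · have hB : Complex.betaIntegral b (c - b) ≠ 0 := by
      rw [Complex.betaIntegral_eq_Gamma_mul_div _ _ hb hcb0]
      refine div_ne_zero (mul_ne_zero (Complex.Gamma_ne_zero_of_re_pos hb)
        (Complex.Gamma_ne_zero_of_re_pos hcb0)) (Complex.Gamma_ne_zero_of_re_pos ?_)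
      simp at hcb0 ⊢; linarith
    have h2 := hlim.const_mul (Complex.betaIntegral b (c - b))⁻¹
    have hval : (Complex.betaIntegral b (c - b))⁻¹ *
        ∫ s : ℝ in (0 : ℝ)..1, (s : ℂ) ^ (b - 1) * (1 - (s : ℂ)) ^ (c - a - b - 1) =
        Complex.Gamma c * Complex.Gamma (c - a - b) /
        (Complex.Gamma (c - a) * Complex.Gamma (c - b)) := by
      have e := Complex.betaIntegral_eq_Gamma_mul_div b (c - a - b) hb hcab
      rw [Complex.betaIntegral] at e
      rw [e, Complex.betaIntegral_eq_Gamma_mul_div _ _ hb hcb0, add_sub_cancel,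
        show b + (c - a - b) = c - a by ring, inv_div]
      have g1 := Complex.Gamma_ne_zero_of_re_pos hb
      field_simp
    rw [hval] at h2
    refine h2.congr' ?_
    filter_upwards [Ioo_mem_nhdsLT (zero_lt_one (α := ℝ))] with x hx
    rw [← betaIntegral_mul_two_f_one a hb hcb0 hx.1.le hx.2]
    field_simp
  · filter_upwards [Ioo_mem_nhdsLT (zero_lt_one (α := ℝ))] with x hx
    rw [uIoc_of_le zero_le_one]
    refine AEStronglyMeasurable.mul ?_ hconv0.1.aestronglyMeasurable
    refine (ContinuousOn.aestronglyMeasurable (fun s hs => ?_) measurableSet_Ioc)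
    refine ContinuousAt.continuousWithinAt (ContinuousAt.cpow (by fun_prop) (by fun_prop) ?_)
    left
    have : x * s < 1 := (mul_le_of_le_one_right hx.1.le hs.2).trans_lt hx.2
    simp; linarith
  · filter_upwards [Ioo_mem_nhdsLT (zero_lt_one (α := ℝ))] with x hx
    filter_upwards [Measure.ae_ne volume (1 : ℝ)] with s hs1 hs
    rw [uIoc_of_le zero_le_one] at hs
    have hs1' : 0 < 1 - s := sub_pos.2 (lt_of_le_of_ne hs.2 hs1)
    have hxs : 1 - s ≤ 1 - x * s := by nlinarith [hs.1, hx.2]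
    have hxs0 : 0 < 1 - x * s := hs1'.trans_le hxs
    have e1 : (1 - (s : ℂ)) = ((1 - s : ℝ) : ℂ) := by push_cast; ring
    have e2 : (1 - (x * s : ℂ)) = ((1 - x * s : ℝ) : ℂ) := by push_cast; ring
    rw [e1, e2, norm_mul, norm_mul, norm_mul, Complex.norm_cpow_eq_rpow_re_of_pos hs1',
      Complex.norm_cpow_eq_rpow_re_of_pos hs1', Complex.norm_cpow_eq_rpow_re_of_pos hxs0]
    have e3 : (c - a - b - 1).re = -a + (c - b - 1).re := by simp; ring
    -- The factor `(1 - x s)^{-a}` is largest in the limit `x = 1`, because `a ≥ 0`.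
    rw [e3, Real.rpow_add hs1', mul_left_comm]
    gcongr
    rw [Complex.neg_re, Complex.ofReal_re]
    exact Real.rpow_le_rpow_of_nonpos hs1' hxs (by linarith)
  · filter_upwards [Measure.ae_ne volume (1 : ℝ)] with s hs1 hs
    rw [uIoc_of_le zero_le_one] at hs
    have hs1' : 0 < 1 - s := sub_pos.2 (lt_of_le_of_ne hs.2 hs1)
    have hne : (1 - (s : ℂ)) ≠ 0 := by
      have : (1 - (s : ℂ)) = ((1 - s : ℝ) : ℂ) := by push_cast; ring
      rw [this]; exact_mod_cast hs1'.ne'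
    have hcont : ContinuousAt (fun x : ℝ => (1 - (x * s : ℂ)) ^ (-(a : ℂ)) *
        ((s : ℂ) ^ (b - 1) * (1 - (s : ℂ)) ^ (c - b - 1))) 1 := by
      refine ContinuousAt.mul (ContinuousAt.cpow (by fun_prop) (by fun_prop) ?_) (by fun_prop)
      left
      simpa using hs1'
    have h3 := hcont.tendsto.mono_left (nhdsWithin_le_nhds (s := Iio 1))
    have e : (1 - ((1 : ℝ) * s : ℂ)) ^ (-(a : ℂ)) *
        ((s : ℂ) ^ (b - 1) * (1 - (s : ℂ)) ^ (c - b - 1)) =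
        (s : ℂ) ^ (b - 1) * (1 - (s : ℂ)) ^ (c - a - b - 1) := by
      rw [show c - a - b - 1 = -(a : ℂ) + (c - b - 1) by ring, Complex.cpow_add _ _ hne]
      push_cast
      rw [one_mul]
      ring
    rwa [e] at h3

end GaussSummation

/-! ### The Harish-Chandra expansion of the Jacobi function -/

section Connection

variable {α β : ℝ} {z : ℂ}

/-- The Harish-Chandra function `c(λ)` in the variable `z = iλ`. -/
noncomputable def hcC (α β : ℝ) (z : ℂ) : ℂ :=
  (2 : ℂ) ^ (rho α β : ℂ) * Complex.Gamma (z / 2) * Complex.Gamma ((1 + z) / 2) /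
    (Complex.Gamma ((rho α β + z) / 2) * Complex.Gamma ((rho α β + z) / 2 - β))

lemma cFun_eq_hcC (α β : ℝ) (lam : ℂ) : cFun α β lam = hcC α β (Complex.I * lam) := rfl

/-- The factor between the function `c(λ)` and the coefficient of the Harish-Chandra series in the
expansion of the Jacobi function. -/
noncomputable def hcConst (α : ℝ) : ℝ := Real.Gamma (α + 1) / (2 * √Real.pi)

/-- The Wronskian of the Jacobi function and the Harish-Chandra series. -/
noncomputable def hcWronskian (α β : ℝ) (z : ℂ) : ℂ :=
  weightedWronskian α β (phiFun α β z) (phiDeriv α β z) (hcPhi α β z) (hcPhiDeriv α β z) 1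

lemma IsJacobiSolution.neg {f f₁ : ℝ → ℂ} (h : IsJacobiSolution α β z f f₁) :
    IsJacobiSolution α β (-z) f f₁ := by
  intro t ht
  rw [neg_sq]
  exact h t ht

lemma phiDeriv_neg (hα : -1 < α) (z : ℂ) (t : ℝ) : phiDeriv α β (-z) t = phiDeriv α β z t := by
  have h := hasDerivAt_phiFun (β := β) hα (-z) t
  rw [funext (phiFun_neg (β := β) hα z)] at h
  exact h.unique (hasDerivAt_phiFun hα z t)

/-- The Wronskian of the two Harish-Chandra series is constant, and its value is the limit at
infinity, to which only the leading terms contribute. -/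
lemma weightedWronskian_hcPhi_neg (hz : |z.re| ≤ 1 / 2) {t : ℝ} (ht : 0 < t) :
    weightedWronskian α β (hcPhi α β z) (hcPhiDeriv α β z) (hcPhi α β (-z)) (hcPhiDeriv α β (-z)) t
      = 2 * z := by
  obtain ⟨hz1, hz2⟩ := abs_le.1 hz
  have hz3 : -(1 / 2) ≤ (-z).re := by simp only [Complex.neg_re]; linarith
  have s2 := (isJacobiSolution_hcPhi (α := α) (β := β) hz3).neg
  rw [neg_neg] at s2
  have hconst := fun s (hs : 0 < s) => weightedWronskian_const
    (isJacobiSolution_hcPhi (α := α) (β := β) hz1) s2 ht hs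
  have p1 := tendsto_hcPhi_mul_exp (α := α) (β := β) hz1
  have p2 := tendsto_hcPhi_mul_exp (α := α) (β := β) hz3
  have q1 := tendsto_hcPhiDeriv_mul_exp (α := α) (β := β) hz1
  have q2 := tendsto_hcPhiDeriv_mul_exp (α := α) (β := β) hz3
  have hΔ := (Complex.continuous_ofReal.tendsto _).comp
    (tendsto_jacobiDelta_mul_exp (α := α) (β := β))
  have hlim := hΔ.mul ((p1.mul q2).sub (q1.mul p2))
  have e : ((1 : ℝ) : ℂ) * (1 * -(-z + rho α β) - -(z + rho α β) * 1) = 2 * z := by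
    push_cast; ring
  rw [e] at hlim
  refine tendsto_nhds_unique (Tendsto.congr' ?_ tendsto_const_nhds) hlim
  filter_upwards [eventually_gt_atTop 0] with s hs
  rw [hconst s hs]
  simp only [weightedWronskian, Function.comp_apply]
  push_cast
  have e1 : Complex.exp (-(2 * rho α β * s)) * (Complex.exp ((z + rho α β) * s) *
      Complex.exp ((-z + rho α β) * s)) = 1 := by
    rw [← Complex.exp_add, ← Complex.exp_add, ← Complex.exp_zero]; congr 1; ring
  linear_combination (-(jacobiDelta α β s : ℂ) * (hcPhi α β z s * hcPhiDeriv α β (-z) s -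
    hcPhiDeriv α β z s * hcPhi α β (-z) s)) * e1

/-- The Jacobi function in the basis of the two Harish-Chandra series, with Wronskians as
coefficients. -/
lemma two_mul_phiFun_eq (hα : -1 < α) (hz : |z.re| ≤ 1 / 2) {t : ℝ} (ht : 0 < t) :
    2 * z * phiFun α β z t =
      hcPhi α β z t * hcWronskian α β (-z) - hcPhi α β (-z) t * hcWronskian α β z := by
  obtain ⟨hz1, hz2⟩ := abs_le.1 hz
  have hz3 : -(1 / 2) ≤ (-z).re := by simp only [Complex.neg_re]; linarith
  have s0 := isJacobiSolution_phiFun (β := β) hα z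
  have s0' := isJacobiSolution_phiFun (β := β) hα (-z)
  have h1 := weightedWronskian_const s0
    (isJacobiSolution_hcPhi (α := α) (β := β) hz1) one_pos ht
  have h2 := weightedWronskian_const s0'
    (isJacobiSolution_hcPhi (α := α) (β := β) hz3) one_pos ht
  rw [hcWronskian, hcWronskian, h1, h2, ← weightedWronskian_hcPhi_neg hz ht]
  simp only [weightedWronskian, phiFun_neg hα, phiDeriv_neg hα]
  ring

/-- For `z = η > 0` the series for `-η` dominates the one for `η`, so the growth of the Jacobi
function reveals its Wronskian with the latter. -/
lemma tendsto_phiFun_mul_exp_wronskian (hα : -1 < α) {η : ℝ} (h0 : 0 < η) (h1 : η ≤ 1 / 2) :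
    Tendsto (fun t : ℝ => phiFun α β η t * Complex.exp ((rho α β - η) * t)) atTop
      (𝓝 (hcWronskian α β η / (-2 * η))) := by
  have hη : |(η : ℂ).re| ≤ 1 / 2 := by rwa [Complex.ofReal_re, abs_of_pos h0]
  obtain ⟨hz1, hz2⟩ := abs_le.1 hη
  have hz3 : -(1 / 2) ≤ (-(η : ℂ)).re := by simp only [Complex.neg_re]; linarith
  have p1 := tendsto_hcPhi_mul_exp (α := α) (β := β) hz1
  have p2 := tendsto_hcPhi_mul_exp (α := α) (β := β) hz3
  have hexp : Tendsto (fun t : ℝ => Complex.exp (-(2 * η * t))) atTop (𝓝 0) := by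
    have h := Real.tendsto_exp_neg_atTop_nhds_zero.comp
      ((tendsto_id (α := ℝ)).const_mul_atTop (by positivity : 0 < 2 * η))
    have h2 := (Complex.continuous_ofReal.tendsto _).comp h
    simp only [Complex.ofReal_zero] at h2
    refine h2.congr fun t => ?_
    simp
  have hlim := (((p1.mul hexp).mul_const (hcWronskian α β (-η))).sub
    (p2.mul_const (hcWronskian α β η))).div_const (2 * (η : ℂ))
  have hη0 : (η : ℂ) ≠ 0 := by exact_mod_cast h0.ne'
  have e : ((1 : ℂ) * 0 * hcWronskian α β (-η) - 1 * hcWronskian α β η) / (2 * η) =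
      hcWronskian α β η / (-2 * η) := by
    field_simp; ring
  rw [e] at hlim
  refine hlim.congr' ?_
  filter_upwards [eventually_gt_atTop 0] with t ht
  have h := two_mul_phiFun_eq (β := β) hα hη ht
  have e1 : Complex.exp ((η + rho α β) * t) * Complex.exp (-(2 * η * t)) =
      Complex.exp ((rho α β - η) * t) := by
    rw [← Complex.exp_add]; congr 1; ring
  have e2 : Complex.exp ((-(η : ℂ) + rho α β) * t) = Complex.exp ((rho α β - η) * t) := by
    congr 1; ring
  rw [mul_assoc (hcPhi α β η t), e1, e2, div_eq_iff (by simpa using hη0)]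
  linear_combination (-Complex.exp ((rho α β - η) * t)) * h

/-- The same growth, from the definition of the Jacobi function: its hypergeometric factor has the
argument `tanh² t`, which tends to `1`. -/
lemma tendsto_phiFun_mul_exp_gauss (hα : -1 < α) {η : ℝ} (h0 : 0 < η) (h1 : η < rho α β)
    (h2 : η < α - β + 1) :
    Tendsto (fun t : ℝ => phiFun α β η t * Complex.exp ((rho α β - η) * t)) atTop
      (𝓝 ((2 : ℂ) ^ (rho α β - η : ℂ) * (Complex.Gamma (α + 1) * Complex.Gamma η /
        (Complex.Gamma ((rho α β + η) / 2 - β) * Complex.Gamma ((rho α β + η) / 2))))) := by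
  have hρ : (rho α β : ℂ) = α + β + 1 := by unfold rho; push_cast; ring
  have hρ' : rho α β = α + β + 1 := rfl
  set a : ℝ := (rho α β - η) / 2 with ha
  set b : ℂ := (((α - β + 1 - η) / 2 : ℝ) : ℂ) with hb
  have hG := tendsto_two_f_one_one (a := a) (b := b) (c := α + 1) (by rw [ha]; linarith)
    (by rw [hb, Complex.ofReal_re]; linarith) (by
      rw [ha, hb, ← Complex.ofReal_one, ← Complex.ofReal_add, ← Complex.ofReal_sub,
        Complex.ofReal_re]; linarith)
  have hexp : Tendsto (fun t : ℝ => Real.exp (-(2 * t))) atTop (𝓝 0) :=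
    Real.tendsto_exp_neg_atTop_nhds_zero.comp (tendsto_id.const_mul_atTop two_pos)
  have htanh : Tendsto (fun t : ℝ => Real.sinh t ^ 2 / Real.cosh t ^ 2) atTop (𝓝[<] 1) := by
    rw [tendsto_nhdsWithin_iff]
    constructor
    · have h := ((hexp.const_sub 1).div (hexp.const_add 1) (by norm_num)).pow 2
      simp only [sub_zero, add_zero, div_one, one_pow] at h
      refine h.congr fun t => ?_
      have e1 := two_mul_sinh_eq t
      have e2 := two_mul_cosh_eq t
      rw [← div_pow, ← mul_div_mul_left (Real.sinh t) _ two_ne_zero, e1, e2,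
        mul_div_mul_left _ _ (Real.exp_pos t).ne']
      rfl
    · refine Eventually.of_forall fun t => ?_
      have := Real.cosh_sq t
      rw [mem_Iio, div_lt_one (by have := Real.cosh_pos t; positivity)]
      linarith
  have hcosh : Tendsto (fun t : ℝ => (2 / (1 + Real.exp (-(2 * t)))) ^ (rho α β - η)) atTop
      (𝓝 (2 ^ (rho α β - η))) := by
    have h : Tendsto (fun t : ℝ => 2 / (1 + Real.exp (-(2 * t)))) atTop (𝓝 (2 / (1 + 0))) :=
      tendsto_const_nhds.div (hexp.const_add 1) (by norm_num)
    simp only [add_zero, div_one] at h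
    exact h.rpow_const (Or.inl two_ne_zero)
  have hlim := ((Complex.continuous_ofReal.tendsto _).comp hcosh).mul (hG.comp htanh)
  have e : (((2 : ℝ) ^ (rho α β - η) : ℝ) : ℂ) * (Complex.Gamma (α + 1) *
      Complex.Gamma (α + 1 - a - b) / (Complex.Gamma (α + 1 - a) * Complex.Gamma (α + 1 - b))) =
      (2 : ℂ) ^ (rho α β - η : ℂ) * (Complex.Gamma (α + 1) * Complex.Gamma η /
        (Complex.Gamma ((rho α β + η) / 2 - β) * Complex.Gamma ((rho α β + η) / 2))) := by
    rw [Complex.ofReal_cpow two_pos.le]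
    have e1 : (α : ℂ) + 1 - a - b = η := by
      rw [ha, hb]; push_cast; rw [hρ]; ring
    have e2 : (α : ℂ) + 1 - a = (rho α β + η) / 2 - β := by
      rw [ha]; push_cast; rw [hρ]; ring
    have e3 : (α : ℂ) + 1 - b = (rho α β + η) / 2 := by
      rw [hb]; push_cast; rw [hρ]; ring
    rw [e1, e2, e3]
    push_cast
    rfl
  rw [e] at hlim
  refine hlim.congr fun t => ?_
  have hc := Real.cosh_pos t
  have hsq := Real.cosh_sq t
  simp only [Function.comp_apply]
  rw [← phiFun_neg hα, phiFun, hyp2F1]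
  have f1 : (1 - -(Real.sinh t : ℂ) ^ 2) = ((Real.cosh t ^ 2 : ℝ) : ℂ) := by
    rw [hsq]; push_cast; ring
  have f2 : -(Real.sinh t : ℂ) ^ 2 / (-(Real.sinh t : ℂ) ^ 2 - 1) =
      ((Real.sinh t ^ 2 / Real.cosh t ^ 2 : ℝ) : ℂ) := by
    rw [hsq]; push_cast
    rw [← neg_div_neg_eq]; congr 1 <;> ring
  have f3 : ((rho α β : ℂ) + -η) / 2 = (a : ℂ) := by rw [ha]; push_cast; ring
  have f4 : (α : ℂ) + 1 - (rho α β - -η) / 2 = b := by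
    rw [hb]; push_cast; rw [hρ]; ring
  rw [f1, f2, f3, f4]
  have f5 : ((Real.cosh t ^ 2 : ℝ) : ℂ) ^ (-(a : ℂ)) * Complex.exp ((rho α β - η) * t) =
      (((2 / (1 + Real.exp (-(2 * t)))) ^ (rho α β - η) : ℝ) : ℂ) := by
    have e2 := two_mul_cosh_eq t
    have e3 : 2 / (1 + Real.exp (-(2 * t))) = Real.exp t / Real.cosh t := by
      rw [div_eq_div_iff (by positivity) hc.ne']; linarith
    rw [e3, ← Complex.ofReal_neg, ← Complex.ofReal_cpow (by positivity), ← Complex.ofReal_sub,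
      ← Complex.ofReal_mul, ← Complex.ofReal_exp, ← Complex.ofReal_mul,
      Real.div_rpow (Real.exp_pos t).le hc.le, ← Real.exp_mul, ← Real.rpow_natCast,
      ← Real.rpow_mul hc.le, ha]
    congr 1
    rw [show ((2 : ℕ) : ℝ) * -((rho α β - η) / 2) = -(rho α β - η) by push_cast; ring,
      Real.rpow_neg hc.le, mul_comm t]
    field_simp
  rw [← f5]
  ring

/-- The two expressions for the growth agree by the duplication formula of the Gamma function. -/
lemma hcWronskian_eq_of_pos (hα : -1 < α) {η : ℝ} (h0 : 0 < η) (h1 : η < rho α β)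
    (h2 : η < α - β + 1) (h3 : η ≤ 1 / 2) :
    hcWronskian α β η = -2 * η * (hcConst α * hcC α β η) := by
  have h := tendsto_nhds_unique (tendsto_phiFun_mul_exp_wronskian (β := β) hα h0 h3)
    (tendsto_phiFun_mul_exp_gauss hα h0 h1 h2)
  have hη0 : (η : ℂ) ≠ 0 := by exact_mod_cast h0.ne'
  rw [div_eq_iff (by simpa using hη0)] at h
  rw [h, hcC, hcConst]
  have hd := Complex.Gamma_mul_Gamma_add_half ((η : ℂ) / 2)
  rw [show 2 * ((η : ℂ) / 2) = η by ring, show (η : ℂ) / 2 + 1 / 2 = (1 + η) / 2 by ring] at hd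
  rw [mul_assoc ((2 : ℂ) ^ (rho α β : ℂ)), hd, Complex.cpow_sub _ _ two_ne_zero,
    Complex.cpow_sub _ _ two_ne_zero, Complex.cpow_one]
  have hpi : (√Real.pi : ℂ) ≠ 0 := by
    exact_mod_cast (Real.sqrt_pos.2 Real.pi_pos).ne'
  have hg : ((Real.Gamma (α + 1) : ℝ) : ℂ) = Complex.Gamma (α + 1) := by
    rw [← Complex.Gamma_ofReal]; push_cast; rfl
  have h2η : (2 : ℂ) ^ (η : ℂ) ≠ 0 := by simp [Complex.cpow_eq_zero_iff]
  push_cast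
  rw [hg]
  field_simp

lemma differentiableOn_hcWronskian (hα : -1 < α) :
    DifferentiableOn ℂ (hcWronskian α β) {z | -(1 / 2) < z.re} := by
  have h1 := (differentiable_phiFun (β := β) hα 1).differentiableOn (s := {z | -(1 / 2) < z.re})
  have h2 := (differentiable_phiDeriv (β := β) hα 1).differentiableOn (s := {z | -(1 / 2) < z.re})
  have h3 := differentiableOn_hcPhi α β one_pos
  have h4 := differentiableOn_hcPhiDeriv α β one_pos
  unfold hcWronskian weightedWronskian
  fun_prop

/-- The Wronskian is the Harish-Chandra function: both sides are holomorphic, and by Gauss'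
theorem they agree on an interval. -/
theorem hcWronskian_eq (hα : -1 < α) (hρ : 0 < rho α β) (hαβ : 0 < α - β + 1) {z : ℂ}
    (hz : -(1 / 2) < z.re) (hz0 : z ≠ 0) :
    hcWronskian α β z = -2 * z * (hcConst α * hcC α β z) := by
  -- The right-hand side with the pole of `Γ(z / 2)` at the origin absorbed by the factor `z`.
  set g : ℂ → ℂ := fun z => -4 * hcConst α * (2 : ℂ) ^ (rho α β : ℂ) *
    Complex.Gamma (z / 2 + 1) * Complex.Gamma ((1 + z) / 2) *
    (Complex.Gamma ((rho α β + z) / 2))⁻¹ * (Complex.Gamma ((rho α β + z) / 2 - β))⁻¹ with hg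
  have hgeq : ∀ z : ℂ, z ≠ 0 → g z = -2 * z * (hcConst α * hcC α β z) := by
    intro z hz0
    simp only [hg, hcC]
    rw [Complex.Gamma_add_one _ (by simpa using hz0)]
    ring
  have hU : IsOpen {z : ℂ | -(1 / 2) < z.re} := isOpen_re_gt _
  have hgd : DifferentiableOn ℂ g {z | -(1 / 2) < z.re} := by
    intro z hz
    have i1 : DifferentiableAt ℂ (fun z : ℂ => Complex.Gamma (z / 2 + 1)) z := by
      refine DifferentiableAt.fun_comp' z (Complex.differentiableAt_Gamma _
        (ne_neg_nat_of_re_pos ?_)) (by fun_prop)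
      simp only [mem_ofPred_eq] at hz
      simp; linarith
    have i2 : DifferentiableAt ℂ (fun z : ℂ => Complex.Gamma ((1 + z) / 2)) z := by
      refine DifferentiableAt.fun_comp' z (Complex.differentiableAt_Gamma _
        (ne_neg_nat_of_re_pos ?_)) (by fun_prop)
      simp only [mem_ofPred_eq] at hz
      simp; linarith
    have i3 : DifferentiableAt ℂ (fun z : ℂ => (Complex.Gamma ((rho α β + z) / 2))⁻¹) z :=
      Complex.differentiable_one_div_Gamma.comp (f := fun z : ℂ => (rho α β + z) / 2)
        (by fun_prop) z
    have i4 : DifferentiableAt ℂ (fun z : ℂ => (Complex.Gamma ((rho α β + z) / 2 - β))⁻¹) z :=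
      Complex.differentiable_one_div_Gamma.comp (f := fun z : ℂ => (rho α β + z) / 2 - β)
        (by fun_prop) z
    exact ((((i1.const_mul _).mul i2).mul i3).mul i4).differentiableWithinAt
  rw [← hgeq z hz0]
  obtain ⟨η₀, hη₀, hη₀'⟩ := exists_between
    (show (0 : ℝ) < min (min (rho α β) (α - β + 1)) (1 / 2) by
    simp only [lt_min_iff]; refine ⟨⟨hρ, hαβ⟩, by norm_num⟩)
  refine (DifferentiableOn.analyticOnNhd (differentiableOn_hcWronskian hα)
    hU).eqOn_of_preconnected_of_frequently_eq (hgd.analyticOnNhd hU)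
    (convex_halfSpace_re_gt _).isPreconnected (z₀ := (η₀ : ℂ))
    (by simp only [mem_ofPred_eq, Complex.ofReal_re]; linarith) ?_ hz
  have ht : Tendsto ((↑) : ℝ → ℂ) (𝓝[≠] η₀) (𝓝[≠] (η₀ : ℂ)) := by
    rw [tendsto_nhdsWithin_iff]
    refine ⟨tendsto_nhdsWithin_of_tendsto_nhds Complex.continuous_ofReal.continuousAt, ?_⟩
    exact eventually_nhdsWithin_iff.2 (Eventually.of_forall fun t ht => by
      simpa using ht)
  refine ht.frequently (Eventually.frequently (Eventually.filter_mono nhdsWithin_le_nhds ?_))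
  filter_upwards [Ioo_mem_nhds hη₀ hη₀'] with η hη
  obtain ⟨⟨q1, q2⟩, q3⟩ := (by simpa only [lt_min_iff] using hη.2 :
    (η < rho α β ∧ η < α - β + 1) ∧ η < 1 / 2)
  rw [hcWronskian_eq_of_pos hα hη.1 q1 q2 q3.le, hgeq]
  exact_mod_cast hη.1.ne'

/-- The Harish-Chandra expansion of the Jacobi function. -/
theorem phiFun_eq_hcPhi (hα : -1 < α) (hρ : 0 < rho α β) (hαβ : 0 < α - β + 1) {z : ℂ}
    (hz : z.re = 0) (hz0 : z ≠ 0) {t : ℝ} (ht : 0 < t) :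
    phiFun α β z t =
      hcConst α * (hcC α β (-z) * hcPhi α β z t + hcC α β z * hcPhi α β (-z) t) := by
  have h := two_mul_phiFun_eq (β := β) hα (z := z) (by rw [hz]; norm_num) ht
  rw [hcWronskian_eq hα hρ hαβ (z := z) (by rw [hz]; norm_num) hz0,
    hcWronskian_eq hα hρ hαβ (z := -z) (by rw [Complex.neg_re, hz]; norm_num)
    (neg_ne_zero.2 hz0)] at h
  have h2 : (2 * z) ≠ 0 := by simpa using hz0
  refine mul_left_cancel₀ h2 ?_
  rw [h]
  ring

end Connection

/-! ### The size of the Jacobi function near the origin -/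

section JacobiFunctionBound

variable {α β : ℝ} {z : ℂ}

lemma rho_pos (hα : -(1 / 2) < α) (hβ : -(1 / 2) < β) : 0 < rho α β := by unfold rho; linarith

lemma norm_rho_sq_sub_sq_le (hρ : 0 < rho α β) (z : ℂ) :
    ‖(rho α β : ℂ) ^ 2 - z ^ 2‖ ≤ (1 + rho α β + ‖z‖) ^ 2 := by
  refine (norm_sub_le _ _).trans ?_
  rw [norm_pow, norm_pow, Complex.norm_of_nonneg hρ.le]
  nlinarith [norm_nonneg z, mul_nonneg hρ.le (norm_nonneg z)]

/-- `Δ φ'` has derivative `-(ρ² - z²) Δ φ`, so `φ'` is controlled by the maximum of `φ`. -/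
lemma norm_phiDeriv_le (hα : -(1 / 2) < α) (hβ : -(1 / 2) < β) {M t : ℝ} (ht : 0 ≤ t)
    (hM : ∀ s ∈ Icc 0 t, ‖phiFun α β z s‖ ≤ M) :
    ‖phiDeriv α β z t‖ ≤ (1 + rho α β + ‖z‖) ^ 2 * M * t := by
  have hα1 : -1 < α := by linarith
  rcases ht.eq_or_lt with rfl | ht
  · simp [phiDeriv]
  set Λ := 1 + rho α β + ‖z‖
  set f : ℝ → ℂ := fun s => jacobiDelta α β s * phiDeriv α β z s with hf
  have hM0 : 0 ≤ M := (norm_nonneg _).trans (hM 0 ⟨le_rfl, ht.le⟩)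
  have hΔ := continuous_jacobiDelta (β := β) hα
  have hcont : Continuous f := by
    have := continuous_phiDeriv (β := β) hα1 z
    fun_prop
  have hder : ∀ s, 0 < s → HasDerivAt f (-(rho α β ^ 2 - z ^ 2) *
      (jacobiDelta α β s * phiFun α β z s)) s := by
    intro s hs
    refine ((hasDerivAt_jacobiDelta (α := α) (β := β) hs).ofReal_comp.mul
      (isJacobiSolution_phiFun (β := β) hα1 z s hs).2).congr_deriv ?_
    push_cast
    ring
  -- The equation is singular at the origin, so the mean value inequality is applied on `[ε, t]`.
  have hε : ∀ ε ∈ Ioo 0 t, ‖f t - f ε‖ ≤ Λ ^ 2 * (jacobiDelta α β t * M) * (t - ε) := by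
    intro ε hε
    refine norm_image_sub_le_of_norm_deriv_le_segment' (f' := fun s => -(rho α β ^ 2 - z ^ 2) *
      (jacobiDelta α β s * phiFun α β z s))
      (fun s hs => (hder s (hε.1.trans_le hs.1)).hasDerivWithinAt) (fun s hs => ?_) t
      ⟨hε.2.le, le_rfl⟩
    have hs0 : 0 < s := hε.1.trans_le hs.1
    rw [norm_mul, norm_mul, norm_neg, Complex.norm_of_nonneg (jacobiDelta_pos hs0).le]
    have h1 := norm_rho_sq_sub_sq_le (rho_pos hα hβ) z
    have h2 := jacobiDelta_mono hα hβ hs0.le hs.2.le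
    have h3 := hM s ⟨hs0.le, hs.2.le⟩
    have h4 := jacobiDelta_pos (α := α) (β := β) ht
    have h5 := jacobiDelta_pos (α := α) (β := β) hs0
    gcongr
  have h0 : f 0 = 0 := by simp [hf, jacobiDelta_zero hα]
  have hlim : ‖f t - f 0‖ ≤ Λ ^ 2 * (jacobiDelta α β t * M) * (t - 0) := by
    refine le_of_tendsto_of_tendsto (b := 𝓝[>] (0 : ℝ)) (f := fun ε => ‖f t - f ε‖)
      (g := fun ε => Λ ^ 2 * (jacobiDelta α β t * M) * (t - ε)) ?_ ?_ ?_
    · exact ((by fun_prop : Continuous fun ε => ‖f t - f ε‖).tendsto 0).mono_left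
        nhdsWithin_le_nhds
    · exact ((by fun_prop : Continuous fun ε => Λ ^ 2 * (jacobiDelta α β t * M) *
        (t - ε)).tendsto 0).mono_left nhdsWithin_le_nhds
    · filter_upwards [Ioo_mem_nhdsGT ht] with ε h using hε ε h
  rw [h0, sub_zero, sub_zero, hf, norm_mul, Complex.norm_of_nonneg (jacobiDelta_pos ht).le] at hlim
  refine le_of_mul_le_mul_left ?_ (jacobiDelta_pos (α := α) (β := β) ht)
  calc _ ≤ _ := hlim
    _ = _ := by ring

/-- Near the origin, on the scale of the wave length, the Jacobi function stays bounded. The maximum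
`M` of its absolute value satisfies `M ≤ 1 + M / 4`. -/
lemma norm_phiFun_le_two (hα : -(1 / 2) < α) (hβ : -(1 / 2) < β) (z : ℂ) {t : ℝ} (ht : 0 ≤ t)
    (ht1 : t ≤ 1 / (2 * (1 + rho α β + ‖z‖))) : ‖phiFun α β z t‖ ≤ 2 := by
  have hα1 : -1 < α := by linarith
  have hρ := rho_pos hα hβ
  set Λ := 1 + rho α β + ‖z‖ with hΛ
  have hΛ1 : 1 ≤ Λ := by have := norm_nonneg z; linarith
  set t₀ := 1 / (2 * Λ) with ht₀
  have hΛt : Λ * t₀ = 1 / 2 := by rw [ht₀]; field_simp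
  have ht₀0 : 0 < t₀ := by positivity
  have hcont : Continuous (phiFun α β z) :=
    continuous_iff_continuousAt.2 fun s => (hasDerivAt_phiFun hα1 z s).continuousAt
  obtain ⟨s, hs, hmax⟩ := isCompact_Icc.exists_isMaxOn (nonempty_Icc.2 ht₀0.le)
    hcont.norm.continuousOn
  set M := ‖phiFun α β z s‖
  have hM : ∀ x ∈ Icc 0 t₀, ‖phiFun α β z x‖ ≤ M := fun x hx => hmax hx
  have hM0 : 0 ≤ M := norm_nonneg _
  have h1 := norm_image_sub_le_of_norm_deriv_le_segment' (f := phiFun α β z)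
    (f' := phiDeriv α β z) (a := 0) (b := t₀) (C := Λ ^ 2 * M * t₀)
    (fun x _ => (hasDerivAt_phiFun hα1 z x).hasDerivWithinAt) (fun x hx => by
      refine (norm_phiDeriv_le hα hβ hx.1 fun y hy => hM y ⟨hy.1, hy.2.trans hx.2.le⟩).trans ?_
      have := hx.2.le
      gcongr) s hs
  rw [phiFun_zero, sub_zero] at h1
  have h2 : Λ ^ 2 * M * t₀ * s ≤ M / 4 := by
    calc Λ ^ 2 * M * t₀ * s ≤ Λ ^ 2 * M * t₀ * t₀ := by
          have := hs.2
          gcongr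
      _ = (Λ * t₀) ^ 2 * M := by ring
      _ = M / 4 := by rw [hΛt]; ring
  have h3 : M ≤ ‖phiFun α β z s - 1‖ + 1 := by
    have := norm_add_le (phiFun α β z s - 1) 1
    simpa using this
  have h4 := hM t ⟨ht, ht1⟩
  linarith

/-- The derivative of `halfLogDeriv`. -/
noncomputable def halfLogDeriv₂ (α β t : ℝ) : ℝ :=
  -(α + 1 / 2) / Real.sinh t ^ 2 + (β + 1 / 2) / Real.cosh t ^ 2

lemma hasDerivAt_halfLogDeriv {t : ℝ} (ht : 0 < t) :
    HasDerivAt (halfLogDeriv α β) (halfLogDeriv₂ α β t) t := by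
  have hs := (Real.sinh_pos_iff.2 ht).ne'
  have hc := (Real.cosh_pos t).ne'
  have h1 := ((Real.hasDerivAt_cosh t).div (Real.hasDerivAt_sinh t) hs).const_mul (α + 1 / 2)
  have h2 := ((Real.hasDerivAt_sinh t).div (Real.hasDerivAt_cosh t) hc).const_mul (β + 1 / 2)
  refine (h1.add h2).congr_deriv ?_
  have := Real.cosh_sq t
  have e1 : Real.sinh t * Real.sinh t - Real.cosh t * Real.cosh t = -1 := by nlinarith
  have e2 : Real.cosh t * Real.cosh t - Real.sinh t * Real.sinh t = 1 := by nlinarith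
  rw [e1, e2, halfLogDeriv₂]
  ring

lemma abs_halfLogDeriv_le (hα : -(1 / 2) < α) (hβ : -(1 / 2) < β) {t : ℝ} (ht : 0 < t)
    (ht1 : t ≤ 1) : |halfLogDeriv α β t| ≤ 2 * rho α β / t := by
  have hs := Real.self_le_sinh_iff.2 ht.le
  have hs0 : 0 < Real.sinh t := ht.trans_le hs
  have hc0 := Real.cosh_pos t
  have hc := cosh_le_two ht.le ht1
  have h1 : Real.cosh t / Real.sinh t ≤ 2 / t := by gcongr
  have h2 : Real.sinh t / Real.cosh t ≤ 2 / t := by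
    have : Real.sinh t / Real.cosh t ≤ 1 := (div_le_one hc0).2 (Real.sinh_lt_cosh t).le
    refine this.trans ?_
    rw [le_div_iff₀ ht]; linarith
  have hα' : 0 ≤ α + 1 / 2 := by linarith
  have hβ' : 0 ≤ β + 1 / 2 := by linarith
  rw [halfLogDeriv, abs_of_nonneg (by positivity)]
  calc _ ≤ (α + 1 / 2) * (2 / t) + (β + 1 / 2) * (2 / t) := by gcongr
    _ = _ := by rw [rho]; ring

lemma abs_halfLogDeriv₂_le (hα : -(1 / 2) < α) (hβ : -(1 / 2) < β) {t : ℝ} (ht : 0 < t)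
    (ht1 : t ≤ 1) : |halfLogDeriv₂ α β t| ≤ rho α β / t ^ 2 := by
  have hs := Real.self_le_sinh_iff.2 ht.le
  have hs0 : 0 < Real.sinh t := ht.trans_le hs
  have hc := Real.one_le_cosh t
  have hα' : 0 ≤ α + 1 / 2 := by linarith
  have hβ' : 0 ≤ β + 1 / 2 := by linarith
  have h1 : (α + 1 / 2) / Real.sinh t ^ 2 ≤ (α + 1 / 2) / t ^ 2 := by gcongr
  have h2 : (β + 1 / 2) / Real.cosh t ^ 2 ≤ (β + 1 / 2) / t ^ 2 := by
    gcongr; linarith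
  rw [halfLogDeriv₂]
  refine (abs_add_le _ _).trans ?_
  rw [neg_div, abs_neg, abs_of_nonneg (by positivity), abs_of_nonneg (by positivity)]
  calc _ ≤ (α + 1 / 2) / t ^ 2 + (β + 1 / 2) / t ^ 2 := add_le_add h1 h2
    _ = _ := by rw [rho]; ring

/-- The energy `Δ (|φ' + h φ|² + L² |φ|²)`, with `h = Δ'/(2Δ)`. It is the energy of `Δ^{1/2} φ`,
which solves an equation without first order term. -/
noncomputable def jacobiEnergy (α β : ℝ) (z : ℂ) (L t : ℝ) : ℝ :=
  jacobiDelta α β t * (‖phiDeriv α β z t + halfLogDeriv α β t * phiFun α β z t‖ ^ 2 +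
    L ^ 2 * ‖phiFun α β z t‖ ^ 2)

/-- The defect `z² + Λ²` between the equation and the energy weight `Λ = 1 + ρ + |z|` is of order
`Λ` instead of `Λ²` when `Re z` is bounded, because `z² + |z|² = 2 z Re z`. -/
lemma norm_sq_add_sq_le (hρ : 0 < rho α β) (hz : 0 ≤ z.re) :
    ‖z ^ 2 + ((1 + rho α β + ‖z‖ : ℝ) : ℂ) ^ 2‖ ≤
      (2 * z.re + 2 * (1 + rho α β)) * (1 + rho α β + ‖z‖) := by
  have hz0 := norm_nonneg z
  have e : z ^ 2 + ((1 + rho α β + ‖z‖ : ℝ) : ℂ) ^ 2 =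
      z * ((2 * z.re : ℝ) : ℂ) + (((1 + rho α β) * (1 + rho α β + 2 * ‖z‖) : ℝ) : ℂ) := by
    have h1 : z * (starRingEnd ℂ) z = ((‖z‖ ^ 2 : ℝ) : ℂ) := by
      rw [Complex.mul_conj, Complex.normSq_eq_norm_sq]
    have h2 : z + (starRingEnd ℂ) z = ((2 * z.re : ℝ) : ℂ) := Complex.add_conj z
    rw [← h2]
    push_cast at h1 ⊢
    linear_combination -h1
  rw [e]
  refine (norm_add_le _ _).trans ?_
  rw [norm_mul, Complex.norm_of_nonneg (by positivity), Complex.norm_of_nonneg (by positivity)]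
  nlinarith [mul_nonneg hz hz0, mul_nonneg hz hρ.le]

/-- The logarithmic derivative of the energy exceeds `2 Re z` by a bounded amount and a multiple of
`1 / (Λ t²)`, which integrates to a bounded amount over `t ≥ 1 / (2 Λ)`, for `Λ = 1 + ρ + |z|`. -/
lemma hasDerivAt_jacobiEnergy_le (hα : -(1 / 2) < α) (hβ : -(1 / 2) < β) (hz : 0 ≤ z.re) {t : ℝ}
    (ht : 0 < t) (ht1 : t ≤ 1) :
    ∃ D : ℝ, HasDerivAt (jacobiEnergy α β z (1 + rho α β + ‖z‖)) D t ∧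
      D ≤ ((5 * rho α β ^ 2 + rho α β) / ((1 + rho α β + ‖z‖) * t ^ 2) +
        (2 * z.re + 2 * (1 + rho α β))) * jacobiEnergy α β z (1 + rho α β + ‖z‖) t := by
  have hα1 : -1 < α := by linarith
  have hρ := rho_pos hα hβ
  have hz0 := norm_nonneg z
  set Λ := 1 + rho α β + ‖z‖ with hΛ
  have hΛ0 : 0 < Λ := by positivity
  obtain ⟨f1, f2⟩ := isJacobiSolution_phiFun (β := β) hα1 z t ht
  have hh := (hasDerivAt_halfLogDeriv (α := α) (β := β) ht).ofReal_comp
  have hΔ := hasDerivAt_jacobiDelta (α := α) (β := β) ht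
  have hΔ0 := jacobiDelta_pos (α := α) (β := β) ht
  set φ := phiFun α β z t with hφ
  set φ' := phiDeriv α β z t with hφ'
  set h := halfLogDeriv α β t with hhd
  set h' := halfLogDeriv₂ α β t with hhd'
  set ψ := φ' + h * φ with hψ
  set q : ℝ := h ^ 2 + h' - rho α β ^ 2 with hq
  -- `Δ^{1/2} φ` solves `u'' = (q + z²) u`, and `ψ` is `Δ^{-1/2}` times the derivative of `u`.
  have g1 : HasDerivAt (fun s => phiDeriv α β z s + halfLogDeriv α β s * phiFun α β z s)
      (-h * ψ + (q + z ^ 2) * φ) t := by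
    refine (f2.add (hh.mul f1)).congr_deriv ?_
    rw [hψ, hq]
    push_cast
    ring
  have g2 : HasDerivAt (phiFun α β z) (ψ - h * φ) t := by
    refine f1.congr_deriv ?_
    rw [hψ]; ring
  have g := hΔ.mul (g1.norm_sq.add (g2.norm_sq.const_mul (Λ ^ 2)))
  refine ⟨_, g, ?_⟩
  have key : inner ℝ ψ (-h * ψ + (q + z ^ 2) * φ) + Λ ^ 2 * inner ℝ φ (ψ - h * φ) =
      -h * (‖ψ‖ ^ 2 + Λ ^ 2 * ‖φ‖ ^ 2) +
        ((starRingEnd ℂ) ψ * ((q + (z ^ 2 + (Λ : ℂ) ^ 2)) * φ)).re := by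
    have e1 : inner ℝ ψ (-h * ψ + (q + z ^ 2) * φ) =
        -h * ‖ψ‖ ^ 2 + ((starRingEnd ℂ) ψ * ((q + z ^ 2) * φ)).re := by
      rw [inner_add_right, show -(h : ℂ) * ψ = (-h) • ψ by rw [Complex.real_smul]; push_cast; rfl,
        inner_smul_right, real_inner_self_eq_norm_sq, Complex.inner, mul_comm ((starRingEnd ℂ) ψ)]
    have e2 : inner ℝ φ (ψ - h * φ) = inner ℝ ψ φ - h * ‖φ‖ ^ 2 := by
      rw [inner_sub_right, show (h : ℂ) * φ = h • φ by rw [Complex.real_smul], inner_smul_right,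
        real_inner_self_eq_norm_sq, real_inner_comm]
    have e3 : ((starRingEnd ℂ) ψ * ((q + (z ^ 2 + (Λ : ℂ) ^ 2)) * φ)).re =
        ((starRingEnd ℂ) ψ * ((q + z ^ 2) * φ)).re + Λ ^ 2 * inner ℝ ψ φ := by
      rw [Complex.inner, mul_comm φ, ← Complex.re_ofReal_mul, ← Complex.add_re]
      congr 1; push_cast; ring
    rw [e1, e2, e3]; ring
  have hqb : |q| ≤ (5 * rho α β ^ 2 + rho α β) / t ^ 2 := by
    have b1 := abs_halfLogDeriv_le hα hβ ht ht1
    have b2 := abs_halfLogDeriv₂_le hα hβ ht ht1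
    have b3 : h ^ 2 ≤ (2 * rho α β / t) ^ 2 := sq_le_sq' (by linarith [neg_abs_le h])
      ((le_abs_self h).trans b1)
    have b4 : rho α β ^ 2 ≤ rho α β ^ 2 / t ^ 2 := by
      rw [le_div_iff₀ (by positivity)]
      exact mul_le_of_le_one_right (by positivity) (by nlinarith)
    have e : (5 * rho α β ^ 2 + rho α β) / t ^ 2 =
        (2 * rho α β / t) ^ 2 + rho α β / t ^ 2 + rho α β ^ 2 / t ^ 2 := by ring
    obtain ⟨b5, b6⟩ := abs_le.1 b2
    rw [e, hq, abs_le]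
    constructor <;> nlinarith [sq_nonneg h, sq_nonneg (rho α β), sq_nonneg (2 * rho α β / t)]
  have hre : ((starRingEnd ℂ) ψ * ((q + (z ^ 2 + (Λ : ℂ) ^ 2)) * φ)).re ≤
      ((5 * rho α β ^ 2 + rho α β) / t ^ 2 + (2 * z.re + 2 * (1 + rho α β)) * Λ) *
        (‖ψ‖ * ‖φ‖) := by
    refine (Complex.re_le_norm _).trans ?_
    rw [norm_mul, norm_mul, RCLike.norm_conj]
    have b : ‖(q : ℂ) + (z ^ 2 + (Λ : ℂ) ^ 2)‖ ≤
        (5 * rho α β ^ 2 + rho α β) / t ^ 2 + (2 * z.re + 2 * (1 + rho α β)) * Λ := by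
      refine (norm_add_le _ _).trans (add_le_add ?_ (norm_sq_add_sq_le hρ hz))
      rwa [Complex.norm_real]
    calc _ ≤ ‖ψ‖ * (((5 * rho α β ^ 2 + rho α β) / t ^ 2 +
          (2 * z.re + 2 * (1 + rho α β)) * Λ) * ‖φ‖) := by gcongr
      _ = _ := by ring
  have hamgm : 2 * (‖ψ‖ * ‖φ‖) ≤ (‖ψ‖ ^ 2 + Λ ^ 2 * ‖φ‖ ^ 2) / Λ := by
    rw [le_div_iff₀ hΛ0]
    nlinarith [sq_nonneg (‖ψ‖ - Λ * ‖φ‖)]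
  have hk : 0 ≤ (5 * rho α β ^ 2 + rho α β) / t ^ 2 + (2 * z.re + 2 * (1 + rho α β)) * Λ := by
    positivity
  have hfin := mul_le_mul_of_nonneg_left hamgm hk
  set E := ‖ψ‖ ^ 2 + Λ ^ 2 * ‖φ‖ ^ 2 with hE
  have hen : jacobiEnergy α β z Λ t = jacobiDelta α β t * E := rfl
  rw [hen]
  simp only [Pi.add_apply]
  rw [← hφ, ← hφ', ← hhd, ← hψ, ← hE]
  have hident : 2 * h * jacobiDelta α β t * E + jacobiDelta α β t *
      (2 * inner ℝ ψ (-h * ψ + (q + z ^ 2) * φ) + Λ ^ 2 * (2 * inner ℝ φ (ψ - h * φ))) =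
      jacobiDelta α β t * (2 * ((starRingEnd ℂ) ψ * ((q + (z ^ 2 + (Λ : ℂ) ^ 2)) * φ)).re) := by
    linear_combination (2 * jacobiDelta α β t) * key
  have hcoef : ((5 * rho α β ^ 2 + rho α β) / (Λ * t ^ 2) + (2 * z.re + 2 * (1 + rho α β))) *
      (jacobiDelta α β t * E) = jacobiDelta α β t *
      (((5 * rho α β ^ 2 + rho α β) / t ^ 2 + (2 * z.re + 2 * (1 + rho α β)) * Λ) * (E / Λ)) := by
    field_simp
  rw [hcoef]
  refine hident.le.trans (mul_le_mul_of_nonneg_left ?_ hΔ0.le)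
  linarith

/-- Gronwall's inequality for the energy. -/
lemma jacobiEnergy_le (hα : -(1 / 2) < α) (hβ : -(1 / 2) < β) (hz : 0 ≤ z.re) {s t : ℝ}
    (hs : 0 < s) (hst : s ≤ t) (ht1 : t ≤ 1) :
    jacobiEnergy α β z (1 + rho α β + ‖z‖) t ≤ jacobiEnergy α β z (1 + rho α β + ‖z‖) s *
      Real.exp ((5 * rho α β ^ 2 + rho α β) / ((1 + rho α β + ‖z‖) * s) +
        (2 * z.re + 2 * (1 + rho α β)) * t) := by
  have hρ := rho_pos hα hβ
  have hz0 := norm_nonneg z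
  set Λ := 1 + rho α β + ‖z‖ with hΛ
  have hΛ0 : 0 < Λ := by positivity
  set Q := 5 * rho α β ^ 2 + rho α β with hQ
  have hQ0 : 0 ≤ Q := by positivity
  set k := 2 * z.re + 2 * (1 + rho α β) with hk
  have hk0 : 0 ≤ k := by positivity
  set N := jacobiEnergy α β z Λ with hN
  have hN0 : ∀ x, 0 < x → 0 ≤ N x := fun x hx => by
    have := jacobiDelta_pos (α := α) (β := β) hx
    rw [hN, jacobiEnergy]; positivity
  set G : ℝ → ℝ := fun x => N x * Real.exp (Q / Λ * x⁻¹ - k * x) with hG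
  have hGd : ∀ x ∈ Icc s t, ∃ D : ℝ, HasDerivAt G D x ∧ D ≤ 0 := by
    intro x hx
    have hx0 : 0 < x := hs.trans_le hx.1
    obtain ⟨D, hD, hDle⟩ := hasDerivAt_jacobiEnergy_le hα hβ hz hx0 (hx.2.trans ht1)
    have he : HasDerivAt (fun x : ℝ => Real.exp (Q / Λ * x⁻¹ - k * x))
        (Real.exp (Q / Λ * x⁻¹ - k * x) * (Q / Λ * (-(x ^ 2)⁻¹) - k * 1)) x :=
      (((hasDerivAt_inv hx0.ne').const_mul _).sub ((hasDerivAt_id x).const_mul k)).exp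
    refine ⟨_, hD.mul he, ?_⟩
    have e : D * Real.exp (Q / Λ * x⁻¹ - k * x) +
        N x * (Real.exp (Q / Λ * x⁻¹ - k * x) * (Q / Λ * (-(x ^ 2)⁻¹) - k * 1)) =
        Real.exp (Q / Λ * x⁻¹ - k * x) * (D - (Q / (Λ * x ^ 2) + k) * N x) := by
      field_simp
      ring
    rw [e]
    exact mul_nonpos_of_nonneg_of_nonpos (Real.exp_pos _).le (sub_nonpos.2 hDle)
  have hanti : AntitoneOn G (Icc s t) := by
    refine antitoneOn_of_deriv_nonpos (convex_Icc s t) (fun x hx => ?_) (fun x hx => ?_)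
      (fun x hx => ?_)
    · obtain ⟨D, hD, -⟩ := hGd x hx
      exact hD.continuousAt.continuousWithinAt
    · obtain ⟨D, hD, -⟩ := hGd x (interior_subset hx)
      exact hD.differentiableAt.differentiableWithinAt
    · obtain ⟨D, hD, h⟩ := hGd x (interior_subset hx)
      rwa [hD.deriv]
  have h := hanti ⟨le_rfl, hst⟩ ⟨hst, le_rfl⟩ hst
  simp only [hG] at h
  have ht0 : 0 < t := hs.trans_le hst
  rw [← le_div_iff₀ (Real.exp_pos _), mul_div_assoc, ← Real.exp_sub] at h
  refine h.trans ?_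
  have := hN0 s hs
  gcongr
  have e1 : 0 ≤ Q / Λ * t⁻¹ := by positivity
  have e2 : 0 ≤ k * s := by positivity
  have e3 : Q / Λ * s⁻¹ = Q / (Λ * s) := by field_simp
  rw [e3]
  linarith

/-- The Jacobi function on `(0, 1]`, for all spectral parameters in a closed half plane, has the
size of the Bessel function with which it agrees to first order. -/
theorem exists_norm_phiFun_le (hα : -(1 / 2) < α) (hβ : -(1 / 2) < β) :
    ∃ C : ℝ, 0 < C ∧ ∀ (z : ℂ) (t : ℝ), 0 ≤ z.re → 0 < t → t ≤ 1 →
      ‖phiFun α β z t‖ ≤ C * (Real.exp (z.re * t) * ((1 + ‖z‖) * t) ^ (-(α + 1 / 2))) := by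
  have hρ := rho_pos hα hβ
  set Q := 5 * rho α β ^ 2 + rho α β with hQ
  set A : ℝ := (4 : ℝ) ^ (2 * α + 1) * 4 ^ (2 * β + 1) * ((1 + 8 * rho α β) ^ 2 + 4) *
    Real.exp (2 * Q + 2 * (1 + rho α β)) with hA
  have hA0 : 0 < A := by positivity
  refine ⟨√A + 2, by positivity, fun z t hz ht ht1 => ?_⟩
  have hz0 := norm_nonneg z
  set Λ := 1 + rho α β + ‖z‖ with hΛ
  have hΛ1 : 1 ≤ Λ := by linarith
  have hΛ0 : 0 < Λ := by positivity
  set t₀ := 1 / (2 * Λ) with ht₀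
  have ht₀0 : 0 < t₀ := by positivity
  have hΛt₀ : Λ * t₀ = 1 / 2 := by rw [ht₀]; field_simp
  have ht₀1 : t₀ ≤ 1 := by
    rw [ht₀, div_le_one (by positivity)]; linarith
  have hexp1 : 1 ≤ Real.exp (z.re * t) := Real.one_le_exp (by positivity)
  have hmono : (Λ * t) ^ (-(α + 1 / 2)) ≤ ((1 + ‖z‖) * t) ^ (-(α + 1 / 2)) := by
    refine Real.rpow_le_rpow_of_nonpos (by positivity) ?_ (by linarith)
    gcongr
    linarith
  have hpow0 : 0 < (Λ * t) ^ (-(α + 1 / 2)) := by positivity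
  suffices hmain : ‖phiFun α β z t‖ ≤
      (√A + 2) * (Real.exp (z.re * t) * (Λ * t) ^ (-(α + 1 / 2))) by
    refine hmain.trans ?_
    gcongr
  -- Up to `t₀` the function is bounded; from there on the energy at `t₀` is propagated.
  rcases le_total t t₀ with htt | htt
  · have h1 := norm_phiFun_le_two hα hβ z ht.le htt
    have h2 : 1 ≤ (Λ * t) ^ (-(α + 1 / 2)) := by
      refine Real.one_le_rpow_of_pos_of_le_one_of_nonpos (by positivity) ?_ (by linarith)
      calc Λ * t ≤ Λ * t₀ := by gcongr
        _ ≤ 1 := by rw [hΛt₀]; norm_num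
    have h3 : 1 ≤ Real.exp (z.re * t) * (Λ * t) ^ (-(α + 1 / 2)) :=
      one_le_mul_of_one_le_of_one_le hexp1 h2
    have h4 := Real.sqrt_nonneg A
    nlinarith
  · have hE := jacobiEnergy_le hα hβ hz ht₀0 htt ht1
    rw [← hΛ] at hE
    have hup : jacobiEnergy α β z Λ t₀ ≤ (4 : ℝ) ^ (2 * α + 1) * 4 ^ (2 * β + 1) *
        t₀ ^ (2 * α + 1) * (Λ ^ 2 * ((1 + 8 * rho α β) ^ 2 + 4)) := by
      have b0 := norm_phiFun_le_two hα hβ z ht₀0.le le_rfl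
      have b1 : ‖phiDeriv α β z t₀‖ ≤ Λ := by
        refine (norm_phiDeriv_le hα hβ (M := 2) ht₀0.le fun s hs =>
          norm_phiFun_le_two hα hβ z hs.1 hs.2).trans ?_
        rw [← hΛ]
        have : Λ ^ 2 * 2 * t₀ = 2 * Λ * (Λ * t₀) := by ring
        rw [this, hΛt₀]
        linarith
      have b2 : ‖phiDeriv α β z t₀ + halfLogDeriv α β t₀ * phiFun α β z t₀‖ ≤
          (1 + 8 * rho α β) * Λ := by
        refine (norm_add_le _ _).trans ?_
        rw [norm_mul, Complex.norm_real, Real.norm_eq_abs]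
        have b3 := abs_halfLogDeriv_le hα hβ ht₀0 ht₀1
        have b4 : 2 * rho α β / t₀ = 4 * rho α β * Λ := by rw [ht₀]; field_simp; norm_num
        rw [b4] at b3
        calc _ ≤ Λ + 4 * rho α β * Λ * 2 := by gcongr
          _ = _ := by ring
      rw [jacobiEnergy]
      have b5 := jacobiDelta_le hα hβ ht₀0.le ht₀1
      have b6 := jacobiDelta_pos (α := α) (β := β) ht₀0
      gcongr
      calc _ ≤ ((1 + 8 * rho α β) * Λ) ^ 2 + Λ ^ 2 * 2 ^ 2 := by gcongr
        _ = _ := by ring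
    have hlow : t ^ (2 * α + 1) * (Λ ^ 2 * ‖phiFun α β z t‖ ^ 2) ≤ jacobiEnergy α β z Λ t := by
      rw [jacobiEnergy]
      have b1 := le_jacobiDelta hα hβ ht.le
      have b2 := jacobiDelta_pos (α := α) (β := β) ht
      gcongr
      have := sq_nonneg ‖phiDeriv α β z t + halfLogDeriv α β t * phiFun α β z t‖
      linarith
    have hexp : Real.exp (Q / (Λ * t₀) + (2 * z.re + 2 * (1 + rho α β)) * t) ≤
        Real.exp (2 * Q + 2 * (1 + rho α β)) * Real.exp (z.re * t) ^ 2 := by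
      rw [hΛt₀, ← Real.exp_nat_mul, ← Real.exp_add, Real.exp_le_exp]
      push_cast
      have : (2 * (1 + rho α β)) * t ≤ 2 * (1 + rho α β) :=
        mul_le_of_le_one_right (by positivity) ht1
      nlinarith
    have hall : t ^ (2 * α + 1) * (Λ ^ 2 * ‖phiFun α β z t‖ ^ 2) ≤
        A * t₀ ^ (2 * α + 1) * Λ ^ 2 * Real.exp (z.re * t) ^ 2 := by
      refine hlow.trans (hE.trans ?_)
      calc _ ≤ (4 : ℝ) ^ (2 * α + 1) * 4 ^ (2 * β + 1) *
            t₀ ^ (2 * α + 1) * (Λ ^ 2 * ((1 + 8 * rho α β) ^ 2 + 4)) *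
            (Real.exp (2 * Q + 2 * (1 + rho α β)) * Real.exp (z.re * t) ^ 2) := by
            gcongr
        _ = _ := by rw [hA]; ring
    have hsq : ‖phiFun α β z t‖ ^ 2 ≤
        (√A * (Real.exp (z.re * t) * (Λ * t) ^ (-(α + 1 / 2)))) ^ 2 := by
      have e1 : ((Λ * t) ^ (-(α + 1 / 2))) ^ 2 * (Λ * t) ^ (2 * α + 1) = 1 := by
        rw [← Real.rpow_natCast, ← Real.rpow_mul (by positivity), ← Real.rpow_add (by positivity)]
        rw [show -(α + 1 / 2) * ((2 : ℕ) : ℝ) + (2 * α + 1) = 0 by push_cast; ring, Real.rpow_zero]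
      have e2 : t₀ ^ (2 * α + 1) * Λ ^ (2 * α + 1) ≤ 1 := by
        rw [← Real.mul_rpow ht₀0.le hΛ0.le, mul_comm t₀, hΛt₀]
        exact Real.rpow_le_one (by norm_num) (by norm_num) (by linarith)
      have hpos : 0 < Λ ^ 2 * (Λ * t) ^ (2 * α + 1) := by positivity
      refine le_of_mul_le_mul_left ?_ hpos
      rw [mul_pow, mul_pow, Real.sq_sqrt hA0.le]
      calc Λ ^ 2 * (Λ * t) ^ (2 * α + 1) * ‖phiFun α β z t‖ ^ 2
          = Λ ^ (2 * α + 1) * (t ^ (2 * α + 1) * (Λ ^ 2 * ‖phiFun α β z t‖ ^ 2)) := by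
            rw [Real.mul_rpow hΛ0.le ht.le]; ring
        _ ≤ Λ ^ (2 * α + 1) * (A * t₀ ^ (2 * α + 1) * Λ ^ 2 * Real.exp (z.re * t) ^ 2) := by
            gcongr
        _ = (t₀ ^ (2 * α + 1) * Λ ^ (2 * α + 1)) * (A * Λ ^ 2 * Real.exp (z.re * t) ^ 2) := by ring
        _ ≤ 1 * (A * Λ ^ 2 * Real.exp (z.re * t) ^ 2) := by gcongr
        _ = _ := by linear_combination (-(A * Λ ^ 2 * Real.exp (z.re * t) ^ 2)) * e1
    have hle := abs_le_of_sq_le_sq hsq (by positivity)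
    refine (le_abs_self _).trans (hle.trans ?_)
    gcongr
    linarith

end JacobiFunctionBound

/-! ### Quotients of Gamma functions and the size of the Harish-Chandra function -/

section GammaRatio

lemma norm_betaIntegral_le {u v : ℂ} (hu : 0 < u.re) (hv : 0 < v.re) :
    ‖Complex.betaIntegral u v‖ ≤
      Real.Gamma u.re * Real.Gamma v.re / Real.Gamma (u.re + v.re) := by
  have e : ((∫ x : ℝ in (0 : ℝ)..1, ‖(x : ℂ) ^ (u - 1) * (1 - (x : ℂ)) ^ (v - 1)‖ : ℝ) : ℂ) =
      Complex.betaIntegral (u.re : ℂ) (v.re : ℂ) := by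
    rw [Complex.betaIntegral, ← intervalIntegral.integral_ofReal]
    refine intervalIntegral.integral_congr_ae ?_
    filter_upwards [Measure.ae_ne volume (1 : ℝ)] with x hx1 hx
    rw [uIoc_of_le zero_le_one] at hx
    have hx' : 0 < 1 - x := sub_pos.2 (lt_of_le_of_ne hx.2 hx1)
    have e1 : (1 - (x : ℂ)) = ((1 - x : ℝ) : ℂ) := by push_cast; ring
    rw [e1, norm_mul, Complex.norm_cpow_eq_rpow_re_of_pos hx.1,
      Complex.norm_cpow_eq_rpow_re_of_pos hx', Complex.ofReal_mul,
      Complex.ofReal_cpow hx.1.le, Complex.ofReal_cpow hx'.le]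
    push_cast
    simp
  have e2 : Complex.betaIntegral (u.re : ℂ) (v.re : ℂ) =
      ((Real.Gamma u.re * Real.Gamma v.re / Real.Gamma (u.re + v.re) : ℝ) : ℂ) := by
    rw [Complex.betaIntegral_eq_Gamma_mul_div _ _ (by simpa using hu) (by simpa using hv),
      ← Complex.ofReal_add, Complex.Gamma_ofReal, Complex.Gamma_ofReal, Complex.Gamma_ofReal]
    push_cast; rfl
  rw [e2] at e
  rw [← Complex.ofReal_injective e]
  exact intervalIntegral.norm_integral_le_integral_norm zero_le_one

/-- A consequence of the logarithmic convexity of the Gamma function. -/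
lemma Gamma_add_le_rpow_mul_Gamma_add_one {x s : ℝ} (hx : 0 < x) (hs : 0 < s) (hs1 : s < 1) :
    Real.Gamma (x + s) ≤ x ^ (s - 1) * Real.Gamma (x + 1) := by
  have h := Real.Gamma_mul_add_mul_le_rpow_Gamma_mul_rpow_Gamma (s := x) (t := x + 1)
    (a := 1 - s) (b := s) hx (by linarith) (by linarith) hs (by ring)
  have hG := Real.Gamma_pos_of_pos hx
  rw [show (1 - s) * x + s * (x + 1) = x + s by ring, Real.Gamma_add_one hx.ne',
    Real.mul_rpow hx.le hG.le] at h
  rw [Real.Gamma_add_one hx.ne', Real.rpow_sub_one hx.ne']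
  refine h.trans (le_of_eq ?_)
  rw [mul_left_comm, ← Real.rpow_add hG]
  simp
  field_simp

/-- The quotient `Γ(w + s) / Γ(w)` is `w B(w + s, 1 - s) / Γ(1 - s)`, and the Beta function is at
most its value at the real parts. -/
lemma norm_Gamma_add_le {w : ℂ} {s : ℝ} (hw : 0 < w.re) (hs : 0 ≤ s) (hs1 : s < 1) :
    ‖Complex.Gamma (w + s) * (Complex.Gamma w)⁻¹‖ ≤ ‖w‖ * w.re ^ (s - 1) := by
  have hw0 : w ≠ 0 := by rintro rfl; simp at hw
  have hG := Complex.Gamma_ne_zero_of_re_pos hw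
  rcases hs.eq_or_lt with rfl | hs
  · rw [Complex.ofReal_zero, add_zero, mul_inv_cancel₀ hG, norm_one, zero_sub, Real.rpow_neg_one,
      ← div_eq_mul_inv, one_le_div hw]
    exact Complex.re_le_norm w
  have h := Complex.Gamma_mul_Gamma_eq_betaIntegral (s := w + s) (t := 1 - s)
    (by simp; linarith) (by simp; linarith)
  rw [show w + s + (1 - s) = w + 1 by ring, Complex.Gamma_add_one w hw0] at h
  have hb := norm_betaIntegral_le (u := w + s) (v := 1 - s) (by simp; linarith) (by simp; linarith)
  have e1 : (w + s : ℂ).re = w.re + s := by simp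
  have e2 : (1 - s : ℂ).re = 1 - s := by simp
  rw [e1, e2, show w.re + s + (1 - s) = w.re + 1 by ring] at hb
  have hg1 : Complex.Gamma (1 - s) = ((Real.Gamma (1 - s) : ℝ) : ℂ) := by
    rw [← Complex.Gamma_ofReal]; push_cast; rfl
  have hg0 : 0 < Real.Gamma (1 - s) := Real.Gamma_pos_of_pos (by linarith)
  have hgx : 0 < Real.Gamma (w.re + 1) := Real.Gamma_pos_of_pos (by linarith)
  have hreal := Gamma_add_le_rpow_mul_Gamma_add_one hw hs hs1
  have e3 : Complex.Gamma (w + s) * (Complex.Gamma w)⁻¹ =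
      w * Complex.betaIntegral (w + s) (1 - s) / Complex.Gamma (1 - s) := by
    have : Complex.Gamma (1 - s) ≠ 0 := by rw [hg1]; exact_mod_cast hg0.ne'
    field_simp
    linear_combination h
  rw [e3, norm_div, norm_mul, hg1, Complex.norm_of_nonneg hg0.le, div_le_iff₀ hg0, mul_assoc]
  gcongr
  refine hb.trans ?_
  rw [div_le_iff₀ hgx]
  calc _ ≤ w.re ^ (s - 1) * Real.Gamma (w.re + 1) * Real.Gamma (1 - s) := by gcongr
    _ = _ := by ring

/-- Replacing `w` by `w + 1` multiplies the quotient by `(w + s) / w`, of absolute value at least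
one. -/
lemma norm_Gamma_ratio_le_shift {w : ℂ} {s : ℝ} (hw : 0 ≤ w.re) (hs : 0 ≤ s) (N : ℕ) :
    ‖Complex.Gamma (w + s) * (Complex.Gamma w)⁻¹‖ ≤
      ‖Complex.Gamma (w + N + s) * (Complex.Gamma (w + N))⁻¹‖ := by
  induction N with
  | zero => simp
  | succ N ih =>
    refine ih.trans ?_
    set v : ℂ := w + N with hv
    have hvre : 0 ≤ v.re := by rw [hv]; simp; positivity
    push_cast
    rw [← add_assoc, ← hv]
    rcases eq_or_ne v 0 with h0 | h0
    · rw [h0]; simp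
    have hvs : v + s ≠ 0 := by
      intro h
      have h1 : v.re + s = 0 := by simpa using congrArg Complex.re h
      have h2 : v.im = 0 := by simpa using congrArg Complex.im h
      exact h0 (Complex.ext (by simp; linarith) (by simpa using h2))
    have hle : ‖v‖ ≤ ‖v + s‖ := by
      rw [← sq_le_sq₀ (norm_nonneg _) (norm_nonneg _), ← Complex.normSq_eq_norm_sq,
        ← Complex.normSq_eq_norm_sq, Complex.normSq_apply, Complex.normSq_apply]
      simp
      nlinarith
    rw [show v + 1 + s = v + s + 1 by ring, Complex.Gamma_add_one _ h0,
      Complex.Gamma_add_one _ hvs, mul_inv]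
    have e : (v + s) * Complex.Gamma (v + s) * (v⁻¹ * (Complex.Gamma v)⁻¹) =
        (v + s) / v * (Complex.Gamma (v + s) * (Complex.Gamma v)⁻¹) := by
      field_simp
    rw [e, norm_mul ((v + s) / v), norm_div]
    refine le_mul_of_one_le_left (norm_nonneg _) ?_
    rwa [one_le_div (norm_pos_iff.2 h0)]

/-- Quotients of Gamma functions have power growth, uniformly up to the imaginary axis. Shifting
`w` by an integer of the size of `|w|` increases the quotient and reduces the bound to a sector. -/
theorem exists_norm_Gamma_ratio_le {s : ℝ} (hs : 0 ≤ s) : ∃ C : ℝ, 0 < C ∧ ∀ w : ℂ, 0 ≤ w.re →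
    ‖Complex.Gamma (w + s) * (Complex.Gamma w)⁻¹‖ ≤ C * (1 + ‖w‖) ^ s := by
  have main : ∀ n : ℕ, ∀ s : ℝ, n ≤ s → s < n + 1 → ∃ C : ℝ, 0 < C ∧ ∀ w : ℂ, 0 ≤ w.re →
      ‖Complex.Gamma (w + s) * (Complex.Gamma w)⁻¹‖ ≤ C * (1 + ‖w‖) ^ s := by
    intro n
    induction n with
    | zero =>
      intro s hs hs1
      simp only [Nat.cast_zero, zero_add] at hs hs1
      refine ⟨2, two_pos, fun w hw => ?_⟩
      have hw0 := norm_nonneg w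
      -- After the shift by `N` the real part of the argument is comparable to its absolute value.
      set N := ⌈‖w‖⌉₊ + 1 with hN
      have hN1 : ‖w‖ + 1 ≤ (N : ℝ) := by
        rw [hN]; push_cast; linarith [Nat.le_ceil ‖w‖]
      have hN2 : (N : ℝ) ≤ ‖w‖ + 2 := by
        rw [hN]; push_cast; linarith [Nat.ceil_lt_add_one hw0]
      have hre : 1 + ‖w‖ ≤ (w + N).re := by simp; linarith
      have hnorm : ‖w + N‖ ≤ 2 * (1 + ‖w‖) := by
        refine (norm_add_le _ _).trans ?_
        simp; linarith
      have hre0 : 0 < (w + N).re := lt_of_lt_of_le (by linarith) hre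
      refine (norm_Gamma_ratio_le_shift hw hs N).trans
        ((norm_Gamma_add_le hre0 hs hs1).trans ?_)
      calc _ ≤ 2 * (1 + ‖w‖) * (1 + ‖w‖) ^ (s - 1) := by
            refine mul_le_mul hnorm ?_ (by positivity) (by positivity)
            exact Real.rpow_le_rpow_of_nonpos (by positivity) hre (by linarith)
        _ = _ := by
          rw [Real.rpow_sub_one (by positivity)]
          field_simp
    | succ n ih =>
      intro s hs hs1
      push_cast at hs hs1
      obtain ⟨C, hC, h⟩ := ih (s - 1) (by linarith) (by linarith)
      have hn : (0 : ℝ) ≤ n := n.cast_nonneg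
      have hspos : 0 < s := by linarith
      refine ⟨s * C, by positivity, fun w hw => ?_⟩
      have hw0 := norm_nonneg w
      -- At the pole `w = 0` the inverse of `Γ` takes the value `0`, in accordance with its
      -- continuous extension.
      rcases eq_or_ne w 0 with rfl | hw1
      · simp only [Complex.Gamma_zero, inv_zero, mul_zero, norm_zero]
        positivity
      have hne : w + ((s - 1 : ℝ) : ℂ) ≠ 0 := by
        intro h
        have h1 : w.re + (s - 1) = 0 := by simpa using congrArg Complex.re h
        have h2 : w.im = 0 := by simpa using congrArg Complex.im h
        exact hw1 (Complex.ext (by simp; linarith) (by simpa using h2))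
      have e : w + (s : ℂ) = w + ((s - 1 : ℝ) : ℂ) + 1 := by push_cast; ring
      rw [e, Complex.Gamma_add_one _ hne, mul_assoc, norm_mul]
      have h1 : ‖w + ((s - 1 : ℝ) : ℂ)‖ ≤ s * (1 + ‖w‖) := by
        refine (norm_add_le _ _).trans ?_
        rw [Complex.norm_of_nonneg (by linarith)]
        nlinarith
      calc _ ≤ s * (1 + ‖w‖) * (C * (1 + ‖w‖) ^ (s - 1)) := by
            gcongr
            exact h w hw
        _ = _ := by
          rw [Real.rpow_sub_one (by positivity)]
          field_simp
  exact main ⌊s⌋₊ s (Nat.floor_le hs) (Nat.lt_floor_add_one s)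

variable {α β : ℝ}

/-- The reciprocal of the Harish-Chandra function as a product of two quotients `Γ(w + s) / Γ(w)`.
-/
lemma inv_hcC_eq (α β : ℝ) (z : ℂ) : (hcC α β z)⁻¹ = ((2 : ℂ) ^ (rho α β : ℂ))⁻¹ *
    (Complex.Gamma (z / 2 + (rho α β / 2 : ℝ)) * (Complex.Gamma (z / 2))⁻¹) *
    (Complex.Gamma ((1 + z) / 2 + ((α - β) / 2 : ℝ)) * (Complex.Gamma ((1 + z) / 2))⁻¹) := by
  have e1 : ((rho α β : ℂ) + z) / 2 = z / 2 + (rho α β / 2 : ℝ) := by push_cast; ring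
  have e2 : ((rho α β : ℂ) + z) / 2 - β = (1 + z) / 2 + ((α - β) / 2 : ℝ) := by
    unfold rho; push_cast; ring
  rw [hcC, e2, e1, inv_div, div_eq_mul_inv, mul_inv, mul_inv]
  ring

/-- The growth of the reciprocal of the Harish-Chandra function has the exponent
`ρ/2 + (α - β)/2 = α + 1/2`. -/
theorem exists_norm_inv_hcC_le (hρ : 0 < rho α β) (hαβ : β < α) : ∃ C : ℝ, 0 < C ∧
    ∀ z : ℂ, 0 ≤ z.re → ‖(hcC α β z)⁻¹‖ ≤ C * (1 + ‖z‖) ^ (α + 1 / 2) := by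
  obtain ⟨C₁, hC₁, h₁⟩ := exists_norm_Gamma_ratio_le (s := rho α β / 2) (by linarith)
  obtain ⟨C₂, hC₂, h₂⟩ := exists_norm_Gamma_ratio_le (s := (α - β) / 2) (by linarith)
  have h2 : 0 < ‖((2 : ℂ) ^ (rho α β : ℂ))⁻¹‖ := by
    rw [norm_pos_iff]; simp [Complex.cpow_eq_zero_iff]
  refine ⟨‖((2 : ℂ) ^ (rho α β : ℂ))⁻¹‖ * C₁ * (C₂ * 2 ^ ((α - β) / 2)), by positivity,
    fun z hz => ?_⟩
  have hz0 := norm_nonneg z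
  have b1 : ‖Complex.Gamma (z / 2 + (rho α β / 2 : ℝ)) * (Complex.Gamma (z / 2))⁻¹‖ ≤
      C₁ * (1 + ‖z‖) ^ (rho α β / 2) := by
    refine (h₁ (z / 2) (by simp; linarith)).trans ?_
    gcongr
    simp
  have b2 : ‖Complex.Gamma ((1 + z) / 2 + ((α - β) / 2 : ℝ)) *
      (Complex.Gamma ((1 + z) / 2))⁻¹‖ ≤ C₂ * (2 * (1 + ‖z‖)) ^ ((α - β) / 2) := by
    refine (h₂ ((1 + z) / 2) (by simp; linarith)).trans ?_
    have h3 : ‖(1 + z) / 2‖ ≤ (1 + ‖z‖) / 2 := by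
      rw [norm_div]
      have := norm_add_le 1 z
      simp at this ⊢
      linarith
    gcongr
    linarith
  rw [inv_hcC_eq, norm_mul, norm_mul]
  calc _ ≤ ‖((2 : ℂ) ^ (rho α β : ℂ))⁻¹‖ * (C₁ * (1 + ‖z‖) ^ (rho α β / 2)) *
        (C₂ * (2 * (1 + ‖z‖)) ^ ((α - β) / 2)) := by gcongr
    _ = ‖((2 : ℂ) ^ (rho α β : ℂ))⁻¹‖ * C₁ * (C₂ * 2 ^ ((α - β) / 2)) *
        ((1 + ‖z‖) ^ (rho α β / 2) * (1 + ‖z‖) ^ ((α - β) / 2)) := by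
      rw [Real.mul_rpow two_pos.le (by positivity)]; ring
    _ = _ := by
      rw [← Real.rpow_add (by positivity)]
      congr 2
      unfold rho; ring

/-- The reciprocal of the Harish-Chandra function is holomorphic up to the imaginary axis, where at
the origin it has a zero. -/
lemma differentiableAt_inv_hcC (hρ : 0 < rho α β) (hαβ : β < α) {z : ℂ} (hz : 0 ≤ z.re) :
    DifferentiableAt ℂ (fun z => (hcC α β z)⁻¹) z := by
  simp only [inv_hcC_eq]
  have i1 : DifferentiableAt ℂ (fun z : ℂ => Complex.Gamma (z / 2 + (rho α β / 2 : ℝ))) z := by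
    refine DifferentiableAt.fun_comp' z (Complex.differentiableAt_Gamma _
      (ne_neg_nat_of_re_pos ?_)) (by fun_prop)
    simp; linarith
  have i2 : DifferentiableAt ℂ
      (fun z : ℂ => Complex.Gamma ((1 + z) / 2 + ((α - β) / 2 : ℝ))) z := by
    refine DifferentiableAt.fun_comp' z (Complex.differentiableAt_Gamma _
      (ne_neg_nat_of_re_pos ?_)) (by fun_prop)
    simp; linarith
  have i3 : DifferentiableAt ℂ (fun z : ℂ => (Complex.Gamma (z / 2))⁻¹) z :=
    Complex.differentiable_one_div_Gamma.comp (f := fun z : ℂ => z / 2) (by fun_prop) z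
  have i4 : DifferentiableAt ℂ (fun z : ℂ => (Complex.Gamma ((1 + z) / 2))⁻¹) z :=
    Complex.differentiable_one_div_Gamma.comp (f := fun z : ℂ => (1 + z) / 2) (by fun_prop) z
  exact ((i1.mul i3).const_mul _).mul (i2.mul i4)

lemma hcC_ne_zero (hρ : 0 < rho α β) (hαβ : β < α) {z : ℂ} (hz : z.re = 0) (hz0 : z ≠ 0) :
    hcC α β z ≠ 0 := by
  have e2 : ((rho α β : ℂ) + z) / 2 - β = ((α - β + 1 + z) / 2) := by
    unfold rho; push_cast; ring
  have g1 : Complex.Gamma (z / 2) ≠ 0 := by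
    refine Complex.Gamma_ne_zero fun m hm => hz0 ?_
    have h2 := congrArg Complex.im hm
    simp at h2
    exact Complex.ext hz h2
  have g2 : Complex.Gamma ((1 + z) / 2) ≠ 0 :=
    Complex.Gamma_ne_zero_of_re_pos (by simp [hz])
  have g3 : Complex.Gamma ((rho α β + z) / 2) ≠ 0 :=
    Complex.Gamma_ne_zero_of_re_pos (by simp [hz]; linarith)
  have g4 : Complex.Gamma ((rho α β + z) / 2 - β) ≠ 0 := by
    rw [e2]
    exact Complex.Gamma_ne_zero_of_re_pos (by simp [hz]; linarith)
  have g5 : (2 : ℂ) ^ (rho α β : ℂ) ≠ 0 := by simp [Complex.cpow_eq_zero_iff]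
  rw [hcC]
  exact div_ne_zero (mul_ne_zero (mul_ne_zero g5 g1) g2) (mul_ne_zero g3 g4)

lemma conj_hcC (α β : ℝ) (z : ℂ) :
    (starRingEnd ℂ) (hcC α β z) = hcC α β ((starRingEnd ℂ) z) := by
  have e : (2 : ℂ) ^ (rho α β : ℂ) = (((2 : ℝ) ^ rho α β : ℝ) : ℂ) := by
    rw [Complex.ofReal_cpow two_pos.le]; push_cast; rfl
  simp only [hcC, e, map_div₀, map_mul, ← Complex.Gamma_conj, map_sub, map_add, map_one,
    Complex.conj_ofReal, map_ofNat]

end GammaRatio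

/-! ### Contour shift -/

section ContourShift

/-- Shifting a segment of the real line to infinity in the upper half plane leaves only the two
vertical half lines at its end points. -/
lemma norm_integral_le_of_exp_decay {F : ℂ → ℂ} {B δ R : ℝ} (hδ : 0 < δ) (hR : 0 ≤ R)
    (hF : ∀ w : ℂ, 0 ≤ w.im → DifferentiableAt ℂ F w)
    (hb : ∀ w : ℂ, 0 ≤ w.im → ‖F w‖ ≤ B * Real.exp (-(δ * w.im))) :
    ‖∫ x : ℝ in -R..R, F x‖ ≤ 2 * B / δ := by
  have hB : 0 ≤ B := by
    have := (norm_nonneg _).trans (hb 0 (by simp))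
    simpa using this
  have hexp : ∀ T : ℝ, ∫ y in (0 : ℝ)..T, B * Real.exp (-(δ * y)) =
      B / δ - B / δ * Real.exp (-(δ * T)) := by
    intro T
    have hd : ∀ y ∈ uIcc 0 T, HasDerivAt (fun y => -(B / δ) * Real.exp (-(δ * y)))
        (B * Real.exp (-(δ * y))) y := by
      intro y _
      have h1 : HasDerivAt (fun y : ℝ => -(δ * y)) (-(δ * 1)) y :=
        ((hasDerivAt_id y).const_mul δ).neg
      refine (h1.exp.const_mul _).congr_deriv ?_
      field_simp
    rw [intervalIntegral.integral_eq_sub_of_hasDerivAt hd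
      (Continuous.intervalIntegrable (by fun_prop) _ _)]
    simp
    ring
  have hside : ∀ (a T : ℝ), 0 ≤ T →
      ‖∫ y : ℝ in (0 : ℝ)..T, F (a + y * Complex.I)‖ ≤ B / δ := by
    intro a T hT
    have h := intervalIntegral.norm_integral_le_of_norm_le (μ := volume) hT
      (f := fun y : ℝ => F (a + y * Complex.I)) (g := fun y => B * Real.exp (-(δ * y)))
      (Eventually.of_forall fun y hy => by
        have := hb (a + y * Complex.I) (by simpa using hy.1.le)
        simpa using this)
      (Continuous.intervalIntegrable (by fun_prop) _ _)
    refine h.trans ?_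
    rw [hexp]
    have : 0 ≤ B / δ * Real.exp (-(δ * T)) := by positivity
    linarith
  have hT : ∀ T : ℝ, 0 ≤ T → ‖∫ x : ℝ in -R..R, F x‖ ≤
      B * Real.exp (-(δ * T)) * (2 * R) + 2 * B / δ := by
    intro T hT
    have hc := Complex.integral_boundary_rect_eq_zero_of_differentiableOn F
      ((-R : ℝ) : ℂ) (⟨R, T⟩ : ℂ) (fun w hw => by
        refine (hF w ?_).differentiableWithinAt
        have := hw.2
        simp only [mem_preimage, Complex.ofReal_im, uIcc_of_le hT] at this
        exact this.1)
    simp only [Complex.ofReal_re, Complex.ofReal_im, Complex.ofReal_zero, zero_mul, add_zero] at hc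
    have htop : ‖∫ x : ℝ in -R..R, F (x + T * Complex.I)‖ ≤
        B * Real.exp (-(δ * T)) * (2 * R) := by
      have h := intervalIntegral.norm_integral_le_of_norm_le_const (a := -R) (b := R)
        (f := fun x : ℝ => F (x + T * Complex.I)) (C := B * Real.exp (-(δ * T))) (fun x _ => by
          have := hb (x + T * Complex.I) (by simpa using hT)
          simpa using this)
      rwa [show R - -R = 2 * R by ring, abs_of_nonneg (by positivity)] at h
    have e : ∫ x : ℝ in -R..R, F x = (∫ x : ℝ in -R..R, F (x + T * Complex.I)) -
        Complex.I • (∫ y : ℝ in (0 : ℝ)..T, F (R + y * Complex.I)) +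
        Complex.I • ∫ y : ℝ in (0 : ℝ)..T, F ((-R : ℝ) + y * Complex.I) := by
      linear_combination hc
    rw [e]
    refine (norm_add_le _ _).trans ((add_le_add_left (norm_sub_le _ _) _).trans ?_)
    rw [norm_smul, norm_smul, Complex.norm_I, one_mul, one_mul]
    have h1 := hside R T hT
    have h2 := hside (-R) T hT
    have h3 : 2 * B / δ = B / δ + B / δ := by ring
    linarith
  have h : Tendsto (fun T : ℝ => Real.exp (-(δ * T))) atTop (𝓝 0) :=
    Real.tendsto_exp_neg_atTop_nhds_zero.comp (tendsto_id.const_mul_atTop hδ)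
  have h2 := ((h.const_mul B).mul_const (2 * R)).add_const (2 * B / δ)
  rw [mul_zero, zero_mul, zero_add] at h2
  exact ge_of_tendsto h2 ((eventually_ge_atTop 0).mono hT)

end ContourShift

/-! ### The disc kernel away from the diagonal -/

section DiscKernel

variable {α β : ℝ}

/-- Half of the integrand of the disc kernel, extended holomorphically to the upper half plane in
`λ`. -/
noncomputable def hcIntegrand (α β t r : ℝ) (lam : ℂ) : ℂ :=
  phiFun α β (-Complex.I * lam) t * hcPhi α β (-Complex.I * lam) r *
    (hcC α β (-Complex.I * lam))⁻¹

lemma neg_I_mul_re (lam : ℂ) : (-Complex.I * lam).re = lam.im := by simp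

lemma differentiableAt_hcIntegrand (hβ : -(1 / 2) < β) (hαβ : β < α) {t r : ℝ} (hr : 0 < r)
    {lam : ℂ} (hlam : 0 ≤ lam.im) : DifferentiableAt ℂ (hcIntegrand α β t r) lam := by
  have hα : -(1 / 2) < α := by linarith
  have hre : 0 ≤ (-Complex.I * lam).re := by rwa [neg_I_mul_re]
  have h1 : DifferentiableAt ℂ (fun z => phiFun α β z t) (-Complex.I * lam) :=
    differentiable_phiFun (by linarith) t _
  have h2 : DifferentiableAt ℂ (fun z => hcPhi α β z r) (-Complex.I * lam) :=
    (differentiableOn_hcPhi α β hr).differentiableAt ((isOpen_re_gt _).mem_nhds (by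
      simp only [mem_ofPred_eq]; linarith))
  have h3 := differentiableAt_inv_hcC (rho_pos hα hβ) hαβ hre
  exact ((h1.mul h2).mul h3).comp lam (f := fun lam => -Complex.I * lam) (by fun_prop)

/-- The powers of the spectral parameter in the bounds for the Jacobi function and for the
reciprocal of the Harish-Chandra function cancel. -/
theorem exists_norm_hcIntegrand_le (hβ : -(1 / 2) < β) (hαβ : β < α) :
    ∃ C : ℝ, 0 < C ∧ ∀ (t r : ℝ) (lam : ℂ), 0 < t → t ≤ 1 → 1 ≤ r → 0 ≤ lam.im →
      ‖hcIntegrand α β t r lam‖ ≤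
        C * (Real.exp (-(rho α β * r)) / t ^ (α + 1 / 2)) * Real.exp (-((r - t) * lam.im)) := by
  have hα : -(1 / 2) < α := by linarith
  obtain ⟨C₁, hC₁, h₁⟩ := exists_norm_phiFun_le hα hβ
  obtain ⟨C₂, hC₂, h₂⟩ := exists_norm_hcPhi_le α β
  obtain ⟨C₃, hC₃, h₃⟩ := exists_norm_inv_hcC_le (rho_pos hα hβ) hαβ
  refine ⟨C₁ * C₂ * C₃, by positivity, fun t r lam ht ht1 hr hlam => ?_⟩
  set z := -Complex.I * lam with hz
  have hre : z.re = lam.im := neg_I_mul_re lam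
  have hz0 := norm_nonneg z
  have b1 := h₁ z t (by rwa [hre]) ht ht1
  have b2 := h₂ z r (by rwa [hre]) hr
  have b3 := h₃ z (by rwa [hre])
  rw [hcIntegrand, ← hz, norm_mul, norm_mul]
  calc _ ≤ C₁ * (Real.exp (z.re * t) * ((1 + ‖z‖) * t) ^ (-(α + 1 / 2))) *
        (C₂ * Real.exp (-((z.re + rho α β) * r))) * (C₃ * (1 + ‖z‖) ^ (α + 1 / 2)) := by gcongr
    _ = C₁ * C₂ * C₃ * (Real.exp (z.re * t) * Real.exp (-((z.re + rho α β) * r))) *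
        (((1 + ‖z‖) * t) ^ (-(α + 1 / 2)) * (1 + ‖z‖) ^ (α + 1 / 2)) := by ring
    _ = _ := by
      have e1 : ((1 + ‖z‖) * t) ^ (-(α + 1 / 2)) * (1 + ‖z‖) ^ (α + 1 / 2) =
          1 / t ^ (α + 1 / 2) := by
        rw [Real.rpow_neg (by positivity), Real.mul_rpow (by positivity) ht.le]
        field_simp
      have e2 : Real.exp (z.re * t) * Real.exp (-((z.re + rho α β) * r)) =
          Real.exp (-(rho α β * r)) * Real.exp (-((r - t) * lam.im)) := by
        rw [← Real.exp_add, ← Real.exp_add, hre]; congr 1; ring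
      rw [e1, e2]; ring

/-- On the real line the spectral density turns the Harish-Chandra expansion of the Jacobi
function into a sum of two boundary values of holomorphic functions. -/
lemma jacobiPhi_mul_density (hβ : -(1 / 2) < β) (hαβ : β < α) {lam : ℝ} (hlam : lam ≠ 0)
    {r : ℝ} (hr : 0 < r) :
    jacobiPhi α β lam r * (((‖cFun α β lam‖ ^ 2)⁻¹ : ℝ) : ℂ) =
      hcConst α * (hcPhi α β (-Complex.I * lam) r * (hcC α β (-Complex.I * lam))⁻¹ +
        hcPhi α β (Complex.I * lam) r * (hcC α β (Complex.I * lam))⁻¹) := by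
  have hα : -(1 / 2) < α := by linarith
  have hρ := rho_pos hα hβ
  set z := -Complex.I * (lam : ℂ) with hz
  have hzneg : Complex.I * (lam : ℂ) = -z := by rw [hz]; ring
  have hre : z.re = 0 := by rw [hz]; simp
  have hz0 : z ≠ 0 := by
    rw [hz]; simpa using hlam
  have hn1 := hcC_ne_zero hρ hαβ hre hz0
  have hn2 := hcC_ne_zero hρ hαβ (z := -z) (by rw [Complex.neg_re, hre, neg_zero])
    (neg_ne_zero.2 hz0)
  have hconj : (starRingEnd ℂ) (-z) = z := by rw [hz]; simp
  have hnorm : (((‖cFun α β lam‖ ^ 2)⁻¹ : ℝ) : ℂ) = (hcC α β (-z) * hcC α β z)⁻¹ := by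
    rw [cFun_eq_hcC, hzneg, ← Complex.normSq_eq_norm_sq, Complex.ofReal_inv,
      Complex.normSq_eq_conj_mul_self, conj_hcC, hconj, mul_comm]
  rw [hnorm, jacobiPhi_eq_phiFun, ← hz, hzneg,
    phiFun_eq_hcPhi (by linarith) hρ (by linarith) hre hz0 hr]
  field_simp

lemma continuous_hcIntegrand (hβ : -(1 / 2) < β) (hαβ : β < α) {t r : ℝ} (hr : 0 < r) :
    Continuous fun x : ℝ => hcIntegrand α β t r x :=
  continuous_iff_continuousAt.2 fun x =>
    (differentiableAt_hcIntegrand hβ hαβ hr (by simp)).continuousAt.comp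
      Complex.continuous_ofReal.continuousAt

/-- The disc kernel as an integral over `[-R, R]` of a function that is holomorphic in the upper
half plane; the second boundary value is the first one at `-λ`. -/
lemma discKernel_eq (hβ : -(1 / 2) < β) (hαβ : β < α) (R : ℝ) {t r : ℝ} (hr : 0 < r) :
    discKernel α β R t r = hcConst α * ∫ x : ℝ in -R..R, hcIntegrand α β t r x := by
  have hc := continuous_hcIntegrand hβ hαβ (t := t) hr
  have hc' : Continuous fun x : ℝ => hcIntegrand α β t r ((-x : ℝ) : ℂ) := hc.comp continuous_neg
  have hα : -1 < α := by linarith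
  have h1 : discKernel α β R t r = ∫ x : ℝ in (0 : ℝ)..R, (hcConst α : ℂ) *
      (hcIntegrand α β t r x + hcIntegrand α β t r ((-x : ℝ) : ℂ)) := by
    rw [discKernel]
    refine intervalIntegral.integral_congr_ae ?_
    filter_upwards [Measure.ae_ne volume (0 : ℝ)] with x hx _
    rw [mul_assoc, jacobiPhi_mul_density hβ hαβ hx hr, jacobiPhi_eq_phiFun]
    have e : -Complex.I * ((-x : ℝ) : ℂ) = Complex.I * x := by push_cast; ring
    have e2 : phiFun α β (Complex.I * x) t = phiFun α β (-Complex.I * x) t := by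
      rw [← phiFun_neg hα, neg_mul]
    simp only [hcIntegrand, e, e2]
    ring
  rw [h1, intervalIntegral.integral_const_mul,
    intervalIntegral.integral_add (hc.intervalIntegrable _ _)
      (hc'.intervalIntegrable _ _),
    intervalIntegral.integral_comp_neg (fun x : ℝ => hcIntegrand α β t r x), neg_zero, add_comm,
    intervalIntegral.integral_add_adjacent_intervals (hc.intervalIntegrable _ _)
      (hc.intervalIntegrable _ _)]

lemma hcConst_pos (hα : -1 < α) : 0 < hcConst α := by
  have := Real.Gamma_pos_of_pos (show 0 < α + 1 by linarith)
  have := Real.sqrt_pos.2 Real.pi_pos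
  unfold hcConst
  positivity

/-- The off-diagonal estimate of the disc kernel, uniform in the cut-off `R`. -/
theorem exists_norm_discKernel_le (hβ : -(1 / 2) < β) (hαβ : β < α) :
    ∃ C : ℝ, 0 < C ∧ ∀ R t r : ℝ, 0 ≤ R → 0 < t → t ≤ 1 → 1 ≤ r → 2 * t ≤ r →
      ‖discKernel α β R t r‖ ≤
        C * (Real.exp (-(rho α β * r)) / t ^ (α + 1 / 2) * (1 / r)) := by
  obtain ⟨C, hC, h⟩ := exists_norm_hcIntegrand_le hβ hαβ
  have hκ := hcConst_pos (α := α) (by linarith)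
  refine ⟨hcConst α * (4 * C), by positivity, fun R t r hR ht ht1 hr htr => ?_⟩
  have hr0 : 0 < r := by linarith
  have hδ : r / 2 ≤ r - t := by linarith
  have hδ0 : 0 < r - t := by linarith
  have hB := norm_integral_le_of_exp_decay hδ0 hR
    (fun w hw => differentiableAt_hcIntegrand hβ hαβ (t := t) hr0 hw)
    (fun w hw => h t r w ht ht1 hr hw)
  rw [discKernel_eq hβ hαβ R hr0, norm_mul, Complex.norm_of_nonneg hκ.le, mul_assoc]
  gcongr
  refine hB.trans ?_
  calc _ ≤ 2 * (C * (Real.exp (-(rho α β * r)) / t ^ (α + 1 / 2))) / (r / 2) := by gcongr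
    _ = _ := by field_simp; norm_num

end DiscKernel

/-! ### Continuity of the disc kernel -/

section KernelContinuity

variable {α β : ℝ}

lemma norm_hcIntegrand_ofReal_le {C t r : ℝ}
    (h : ∀ lam : ℂ, 0 ≤ lam.im → ‖hcIntegrand α β t r lam‖ ≤
      C * (Real.exp (-(rho α β * r)) / t ^ (α + 1 / 2)) * Real.exp (-((r - t) * lam.im)))
    (x : ℝ) : ‖hcIntegrand α β t r x‖ ≤ C * (Real.exp (-(rho α β * r)) / t ^ (α + 1 / 2)) := by
  simpa using h x (by simp)

lemma continuousAt_discKernel_right (hβ : -(1 / 2) < β) (hαβ : β < α) (R : ℝ) {t r₀ : ℝ}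
    (ht : 0 < t) (ht1 : t ≤ 1) (hr : 1 < r₀) :
    ContinuousAt (fun r => discKernel α β R t r) r₀ := by
  obtain ⟨C, hC, h⟩ := exists_norm_hcIntegrand_le hβ hαβ
  have hρ := rho_pos (by linarith : -(1 / 2) < α) hβ
  have hev : ∀ᶠ r in 𝓝 r₀, 1 < r := lt_mem_nhds hr
  have hc : ContinuousAt (fun r => (hcConst α : ℂ) *
      ∫ x : ℝ in -R..R, hcIntegrand α β t r x) r₀ := by
    refine continuousAt_const.mul ?_
    refine intervalIntegral.continuousAt_of_dominated_interval
      (bound := fun _ => C * (1 / t ^ (α + 1 / 2))) ?_ ?_ (by simp) ?_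
    · filter_upwards [hev] with r hr
      exact (continuous_hcIntegrand hβ hαβ (by linarith)).aestronglyMeasurable
    · filter_upwards [hev] with r hr
      refine Eventually.of_forall fun x _ => ?_
      refine (norm_hcIntegrand_ofReal_le (h t r · ht ht1 hr.le) x).trans ?_
      have : Real.exp (-(rho α β * r)) ≤ 1 := Real.exp_le_one_iff.2 (by
        have : 0 < rho α β * r := by positivity
        linarith)
      gcongr
    · refine Eventually.of_forall fun x _ => ?_
      have hd := (isJacobiSolution_hcPhi (α := α) (β := β) (z := -Complex.I * (x : ℂ))
        (by simp) r₀ (by linarith)).1.continuousAt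
      exact (continuousAt_const.mul hd).mul continuousAt_const
  refine hc.congr ?_
  filter_upwards [hev] with r hr
  rw [discKernel_eq hβ hαβ R (by linarith)]

lemma continuousAt_discKernel_left (hβ : -(1 / 2) < β) (hαβ : β < α) (R : ℝ) {t₀ r : ℝ}
    (ht : 0 < t₀) (ht1 : t₀ < 1) (hr : 1 ≤ r) :
    ContinuousAt (fun t => discKernel α β R t r) t₀ := by
  obtain ⟨C, hC, h⟩ := exists_norm_hcIntegrand_le hβ hαβ
  have hα : 0 < α + 1 / 2 := by linarith
  simp_rw [discKernel_eq hβ hαβ R (show 0 < r by linarith)]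
  refine continuousAt_const.mul ?_
  refine intervalIntegral.continuousAt_of_dominated_interval
    (bound := fun _ => C * (Real.exp (-(rho α β * r)) / (t₀ / 2) ^ (α + 1 / 2))) ?_ ?_ (by simp) ?_
  · exact Eventually.of_forall fun t =>
      (continuous_hcIntegrand hβ hαβ (by linarith)).aestronglyMeasurable
  · filter_upwards [lt_mem_nhds (show t₀ / 2 < t₀ by linarith), gt_mem_nhds ht1] with t h1 h2
    refine Eventually.of_forall fun x _ => ?_
    refine (norm_hcIntegrand_ofReal_le (h t r · (by linarith) h2.le hr) x).trans ?_
    gcongr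
  · refine Eventually.of_forall fun x _ => ?_
    have hd := (hasDerivAt_phiFun (α := α) (β := β) (by linarith) (-Complex.I * (x : ℂ))
      t₀).continuousAt
    exact (hd.mul continuousAt_const).mul continuousAt_const

end KernelContinuity

/-! ### The weights in `r` and `t` -/

section Weights

variable {α β : ℝ}

/-- The factor of the off-diagonal bound of the disc kernel that depends on `r`, cut off to `r > 1`.
-/
noncomputable def farWeight (α β : ℝ) : ℝ → ℝ :=
  (Ioi 1).indicator fun r => Real.exp (-(rho α β * r)) / r

/-- The factor of the off-diagonal bound of the disc kernel that depends on `t`, cut off to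
`0 < t < 1`. -/
noncomputable def nearWeight (α : ℝ) : ℝ → ℝ :=
  (Ioo 0 1).indicator fun t => 1 / t ^ (α + 1 / 2)

lemma measurable_farWeight : Measurable (farWeight α β) :=
  Measurable.indicator (by fun_prop) measurableSet_Ioi

lemma measurable_nearWeight : Measurable (nearWeight α) :=
  Measurable.indicator (by fun_prop) measurableSet_Ioo

lemma farWeight_nonneg (r : ℝ) : 0 ≤ farWeight α β r :=
  indicator_nonneg (fun x hx => by
    have : (0 : ℝ) < x := lt_trans one_pos hx
    positivity) r

lemma ae_pos_jacobiMeasure : ∀ᵐ t ∂(jacobiMeasure α β), 0 < t :=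
  (withDensity_absolutelyContinuous _ _).ae_le (ae_restrict_mem measurableSet_Ioi)

/-- A majorant of `|w|^p Δ` that is integrable for Lebesgue measure puts `w` in `L^p(μ)`. -/
lemma memLp_jacobiMeasure (hα : -(1 / 2) < α) {p : ℝ} (hp : 0 < p) {w B : ℝ → ℝ}
    (hw : Measurable w) (hB : IntegrableOn B (Ioi 0))
    (h : ∀ t : ℝ, 0 < t → jacobiDelta α β t * |w t| ^ p ≤ B t) :
    MemLp w (ENNReal.ofReal p) (jacobiMeasure α β) := by
  have hΔ : Measurable fun t => ENNReal.ofReal (jacobiDelta α β t) :=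
    (continuous_jacobiDelta hα).measurable.ennreal_ofReal
  refine ⟨hw.aestronglyMeasurable, ?_⟩
  rw [eLpNorm_lt_top_iff_lintegral_rpow_enorm_lt_top (by simpa using hp) ENNReal.ofReal_ne_top,
    ENNReal.toReal_ofReal hp.le, jacobiMeasure,
    lintegral_withDensity_eq_lintegral_mul _ hΔ (hw.enorm.pow_const p)]
  refine lt_of_le_of_lt ?_ hB.lintegral_lt_top
  refine setLIntegral_mono_ae' measurableSet_Ioi (Eventually.of_forall fun t ht => ?_)
  have ht : 0 < t := ht
  rw [Pi.mul_apply, Real.enorm_eq_ofReal_abs, ENNReal.ofReal_rpow_of_nonneg (abs_nonneg _) hp.le,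
    ← ENNReal.ofReal_mul (jacobiDelta_pos ht).le]
  exact ENNReal.ofReal_le_ofReal (h t ht)

lemma memLp_farWeight (hα : -(1 / 2) < α) (hβ : -(1 / 2) < β) {q : ℝ} (hq : 2 ≤ q) :
    MemLp (farWeight α β) (ENNReal.ofReal q) (jacobiMeasure α β) := by
  have hρ := rho_pos hα hβ
  have hi : IntegrableOn ((Ioi (1 : ℝ)).indicator fun r => (2 : ℝ) ^ (2 * β + 1) * r ^ (-2 : ℝ))
      (Ioi 0) :=
    ((integrable_indicator_iff measurableSet_Ioi).2
      ((integrableOn_Ioi_rpow_of_lt (by norm_num) one_pos).const_mul _)).integrableOn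
  refine memLp_jacobiMeasure hα (by linarith) measurable_farWeight hi fun t ht => ?_
  by_cases h1 : t ∈ Ioi 1
  · have h1' : 1 < t := h1
    have e1 : Real.exp (-(rho α β * t)) ≤ 1 := Real.exp_le_one_iff.2 (by
      have : 0 < rho α β * t := by positivity
      linarith)
    have e0 := Real.exp_pos (-(rho α β * t))
    rw [farWeight, indicator_of_mem h1, indicator_of_mem h1, abs_of_pos (by positivity)]
    -- The base is at most one, so the exponent may be lowered to two.
    have hpow : (Real.exp (-(rho α β * t)) / t) ^ q ≤ (Real.exp (-(rho α β * t)) / t) ^ (2 : ℝ) :=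
      Real.rpow_le_rpow_of_exponent_ge (by positivity)
        ((div_le_one ht).2 (e1.trans h1'.le)) hq
    have hexp : Real.exp (2 * rho α β * t) * Real.exp (-(rho α β * t)) ^ 2 = 1 := by
      rw [← Real.exp_nat_mul, ← Real.exp_add]
      norm_num
      ring
    calc _ ≤ (2 : ℝ) ^ (2 * β + 1) * Real.exp (2 * rho α β * t) *
          (Real.exp (-(rho α β * t)) / t) ^ (2 : ℝ) := by
          gcongr
          exact jacobiDelta_le_exp hα hβ ht.le
      _ = (2 : ℝ) ^ (2 * β + 1) *
          (Real.exp (2 * rho α β * t) * Real.exp (-(rho α β * t)) ^ 2) * t ^ (-2 : ℝ) := by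
          rw [Real.rpow_neg ht.le, Real.rpow_two, Real.rpow_two]
          field_simp
      _ = _ := by rw [hexp, mul_one]
  · rw [farWeight, indicator_of_notMem h1, indicator_of_notMem h1, abs_zero,
      Real.zero_rpow (by linarith), mul_zero]

lemma memLp_nearWeight (hα : -(1 / 2) < α) (hβ : -(1 / 2) < β) {p : ℝ} (hp : 0 < p)
    (hp2 : p ≤ 2) : MemLp (nearWeight α) (ENNReal.ofReal p) (jacobiMeasure α β) := by
  have hi : IntegrableOn ((Ioo (0 : ℝ) 1).indicator
      fun _ => (4 : ℝ) ^ (2 * α + 1) * 4 ^ (2 * β + 1)) (Ioi 0) :=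
    ((integrable_indicator_iff measurableSet_Ioo).2 (integrableOn_const (by simp))).integrableOn
  refine memLp_jacobiMeasure hα hp measurable_nearWeight hi fun t ht => ?_
  by_cases h1 : t ∈ Ioo 0 1
  · have hs : t ^ (α + 1 / 2) ≤ 1 := Real.rpow_le_one ht.le h1.2.le (by linarith)
    have hs0 : 0 < t ^ (α + 1 / 2) := by positivity
    rw [nearWeight, indicator_of_mem h1, indicator_of_mem h1, abs_of_pos (by positivity)]
    -- The base is at least one, so the exponent may be raised to two.
    have hpow : (1 / t ^ (α + 1 / 2)) ^ p ≤ (1 / t ^ (α + 1 / 2)) ^ (2 : ℝ) :=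
      Real.rpow_le_rpow_of_exponent_le ((one_le_div hs0).2 hs) hp2
    have hsq : t ^ (2 * α + 1) = (t ^ (α + 1 / 2)) ^ 2 := by
      rw [← Real.rpow_natCast, ← Real.rpow_mul ht.le]
      congr 1
      push_cast
      ring
    calc _ ≤ (4 : ℝ) ^ (2 * α + 1) * 4 ^ (2 * β + 1) * t ^ (2 * α + 1) *
          (1 / t ^ (α + 1 / 2)) ^ (2 : ℝ) := by
          gcongr
          exact jacobiDelta_le hα hβ ht.le h1.2.le
      _ = _ := by
          rw [hsq, Real.rpow_two]
          field_simp
  · rw [nearWeight, indicator_of_notMem h1, indicator_of_notMem h1, abs_zero,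
      Real.zero_rpow hp.ne', mul_zero]

end Weights

/-! ### The maximal operator -/

section MaximalOperator

variable {α β R₀ : ℝ}

lemma discKernelThree_of_mem {R t r : ℝ} (ht : t < R₀ / 2) (hr : R₀ < r) :
    discKernelThree α β R₀ R t r = discKernel α β R t r := by
  simp [discKernelThree, ht, hr]

lemma discKernelThree_of_ge {R t : ℝ} (ht : R₀ / 2 ≤ t) (r : ℝ) :
    discKernelThree α β R₀ R t r = 0 := by
  simp [discKernelThree, ht.not_gt]

lemma discKernelThree_of_le {R t r : ℝ} (hr : r ≤ R₀) :
    discKernelThree α β R₀ R t r = 0 := by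
  simp [discKernelThree, hr.not_gt]

lemma exists_norm_discKernelThree_le (hβ : -(1 / 2) < β) (hαβ : β < α) (h1 : 1 < R₀)
    (h2 : R₀ < 2) : ∃ C : ℝ, 0 < C ∧ ∀ R t r : ℝ, 0 ≤ R → 0 < t →
      ‖discKernelThree α β R₀ R t r‖ ≤ C / t ^ (α + 1 / 2) * farWeight α β r := by
  obtain ⟨C, hC, h⟩ := exists_norm_discKernel_le hβ hαβ
  refine ⟨C, hC, fun R t r hR ht => ?_⟩
  by_cases hm : t < R₀ / 2 ∧ R₀ < r
  · have hr : r ∈ Ioi (1 : ℝ) := h1.trans hm.2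
    rw [discKernelThree_of_mem hm.1 hm.2, farWeight, indicator_of_mem hr]
    refine (h R t r hR ht (by linarith) (by linarith) (by linarith)).trans_eq ?_
    ring
  · rw [discKernelThree, if_neg hm, norm_zero]
    have := farWeight_nonneg (α := α) (β := β) r
    positivity

lemma aestronglyMeasurable_discKernelThree (hβ : -(1 / 2) < β) (hαβ : β < α) (h1 : 1 < R₀)
    (h2 : R₀ < 2) (R : ℝ) {t : ℝ} (ht : 0 < t) (μ : Measure ℝ) :
    AEStronglyMeasurable (discKernelThree α β R₀ R t) μ := by
  rcases lt_or_ge t (R₀ / 2) with htR | htR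
  · have hc : ContinuousOn (discKernel α β R t) (Ioi R₀) := fun r hr =>
      (continuousAt_discKernel_right hβ hαβ R ht (by linarith)
        (h1.trans hr)).continuousWithinAt
    have e : discKernelThree α β R₀ R t = (Ioi R₀).indicator (discKernel α β R t) := by
      funext r
      by_cases hr : R₀ < r
      · rw [discKernelThree_of_mem htR hr, indicator_of_mem (mem_Ioi.2 hr)]
      · rw [discKernelThree_of_le (not_lt.1 hr), indicator_of_notMem (by simpa using hr)]
    rw [e]
    exact (aestronglyMeasurable_indicator_iff measurableSet_Ioi).2
      (hc.aestronglyMeasurable measurableSet_Ioi)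
  · have e : discKernelThree α β R₀ R t = fun _ => 0 := funext (discKernelThree_of_ge htR)
    rw [e]
    exact aestronglyMeasurable_const

lemma integrable_discKernelThree_mul (hβ : -(1 / 2) < β) (hαβ : β < α) (h1 : 1 < R₀)
    (h2 : R₀ < 2) {f : ℝ → ℂ} (hf : AEStronglyMeasurable f (jacobiMeasure α β))
    (hgf : Integrable (farWeight α β • f) (jacobiMeasure α β)) {R t : ℝ} (hR : 0 ≤ R)
    (ht : 0 < t) :
    Integrable (fun r => discKernelThree α β R₀ R t r * f r) (jacobiMeasure α β) := by
  obtain ⟨C, -, h⟩ := exists_norm_discKernelThree_le hβ hαβ h1 h2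
  refine (hgf.norm.const_mul (C / t ^ (α + 1 / 2))).mono'
    ((aestronglyMeasurable_discKernelThree hβ hαβ h1 h2 R ht _).mul hf)
    (Eventually.of_forall fun r => ?_)
  rw [norm_mul, Pi.smul_apply', norm_smul, Real.norm_of_nonneg (farWeight_nonneg r), ← mul_assoc]
  gcongr
  exact h R t r hR ht

lemma continuousAt_discOpThree (hβ : -(1 / 2) < β) (hαβ : β < α) (h1 : 1 < R₀)
    (h2 : R₀ < 2) {f : ℝ → ℂ} (hf : AEStronglyMeasurable f (jacobiMeasure α β))
    (hgf : Integrable (farWeight α β • f) (jacobiMeasure α β)) {R t₀ : ℝ} (hR : 0 ≤ R)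
    (ht : t₀ ∈ Ioo 0 (R₀ / 2)) : ContinuousAt (discOpThree α β R₀ R f) t₀ := by
  obtain ⟨C, hC, h⟩ := exists_norm_discKernelThree_le hβ hαβ h1 h2
  have ht0 : 0 < t₀ := ht.1
  have hα : 0 < α + 1 / 2 := by linarith
  have hev : ∀ᶠ t in 𝓝 t₀, t₀ / 2 < t := lt_mem_nhds (by linarith)
  have hev2 : ∀ᶠ t in 𝓝 t₀, t < R₀ / 2 := gt_mem_nhds ht.2
  refine continuousAt_of_dominated
    (bound := fun r => C / (t₀ / 2) ^ (α + 1 / 2) * ‖(farWeight α β • f) r‖) ?_ ?_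
    (hgf.norm.const_mul _) ?_
  · filter_upwards [hev] with t h'
    exact (aestronglyMeasurable_discKernelThree hβ hαβ h1 h2 R (by linarith) _).mul hf
  · filter_upwards [hev] with t h'
    refine Eventually.of_forall fun r => ?_
    rw [norm_mul, Pi.smul_apply', norm_smul, Real.norm_of_nonneg (farWeight_nonneg r),
      ← mul_assoc]
    gcongr
    refine (h R t r hR (by linarith)).trans ?_
    have := farWeight_nonneg (α := α) (β := β) r
    gcongr
  · refine Eventually.of_forall fun r => ContinuousAt.mul ?_ continuousAt_const
    rcases le_or_gt r R₀ with hr | hr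
    · simp only [discKernelThree_of_le hr]
      exact continuousAt_const
    · refine (continuousAt_discKernel_left hβ hαβ R ht0 (by linarith [ht.2])
        (by linarith : (1 : ℝ) ≤ r)).congr ?_
      filter_upwards [hev2] with t h'
      rw [discKernelThree_of_mem h' hr]

lemma discMaxThree_of_ge {f : ℝ → ℂ} {t : ℝ} (ht : R₀ / 2 ≤ t) :
    discMaxThree α β R₀ f t = 0 := by
  simp [discMaxThree, discOpThree, discKernelThree_of_ge ht]

/-- On `(0, R₀/2)` the maximal function is a supremum of continuous functions, and beyond
`R₀/2` it vanishes. -/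
lemma aemeasurable_discMaxThree (hβ : -(1 / 2) < β) (hαβ : β < α) (h1 : 1 < R₀)
    (h2 : R₀ < 2) {f : ℝ → ℂ} (hf : AEStronglyMeasurable f (jacobiMeasure α β))
    (hgf : Integrable (farWeight α β • f) (jacobiMeasure α β)) :
    AEMeasurable (discMaxThree α β R₀ f) (jacobiMeasure α β) := by
  refine ⟨(Ioo 0 (R₀ / 2)).indicator (discMaxThree α β R₀ f), ?_, ?_⟩
  · refine measurable_of_Ioi fun c => IsOpen.measurableSet ?_
    have e : (Ioo 0 (R₀ / 2)).indicator (discMaxThree α β R₀ f) ⁻¹' Ioi c =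
        ⋃ (R : ℝ) (_ : 0 < R),
          Ioo 0 (R₀ / 2) ∩ (fun t => ‖discOpThree α β R₀ R f t‖ₑ) ⁻¹' Ioi c := by
      ext t
      by_cases ht : t ∈ Ioo 0 (R₀ / 2)
      · simp [discMaxThree, lt_iSup_iff, ht.1, ht.2]
      · simp only [mem_preimage, indicator_of_notMem ht, mem_iUnion, mem_inter_iff, ht]
        simp
    rw [e]
    refine isOpen_iUnion fun R => isOpen_iUnion fun hR => ?_
    refine ContinuousOn.isOpen_inter_preimage (fun t ht => ?_) isOpen_Ioo isOpen_Ioi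
    exact (continuousAt_discOpThree hβ hαβ h1 h2 hf hgf hR.le ht).enorm.continuousWithinAt
  · filter_upwards [ae_pos_jacobiMeasure] with t ht
    by_cases hm : t < R₀ / 2
    · rw [indicator_of_mem (show t ∈ Ioo 0 (R₀ / 2) from ⟨ht, hm⟩)]
    · rw [indicator_of_notMem (fun h => hm h.2), discMaxThree_of_ge (not_lt.1 hm)]

/-- The maximal function is at most a rank one operator applied to `|f|`. -/
lemma exists_discMaxThree_le (hβ : -(1 / 2) < β) (hαβ : β < α) (h1 : 1 < R₀) (h2 : R₀ < 2) :
    ∃ C : ℝ, 0 < C ∧ ∀ f : ℝ → ℂ, Integrable (farWeight α β • f) (jacobiMeasure α β) →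
      ∀ t : ℝ, 0 < t → discMaxThree α β R₀ f t ≤
        ENNReal.ofReal C * (∫⁻ r, ‖(farWeight α β • f) r‖ₑ ∂(jacobiMeasure α β)) *
          ‖nearWeight α t‖ₑ := by
  obtain ⟨C, hC, h⟩ := exists_norm_discKernelThree_le hβ hαβ h1 h2
  refine ⟨C, hC, fun f hgf t ht => ?_⟩
  rcases le_or_gt (R₀ / 2) t with htR | htR
  · simp [discMaxThree_of_ge htR]
  refine iSup₂_le fun R hR => (enorm_integral_le_lintegral_enorm _).trans ?_
  have hw : ENNReal.ofReal (C / t ^ (α + 1 / 2)) = ENNReal.ofReal C * ‖nearWeight α t‖ₑ := by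
    rw [nearWeight, indicator_of_mem (show t ∈ Ioo 0 1 from ⟨ht, by linarith⟩),
      Real.enorm_of_nonneg (by positivity), ← ENNReal.ofReal_mul hC.le, mul_one_div]
  rw [mul_right_comm, ← hw, ← lintegral_const_mul' _ _ ENNReal.ofReal_ne_top]
  refine lintegral_mono fun r => ?_
  rw [← ofReal_norm, ← ofReal_norm, ← ENNReal.ofReal_mul (by positivity)]
  refine ENNReal.ofReal_le_ofReal ?_
  rw [norm_mul, Pi.smul_apply', norm_smul, Real.norm_of_nonneg (farWeight_nonneg r), ← mul_assoc]
  gcongr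
  exact h R t r hR.le ht

theorem exists_eLpNorm_discMaxThree_le (hβ : -(1 / 2) < β) (hαβ : β < α) (h1 : 1 < R₀)
    (h2 : R₀ < 2) {p : ℝ} (hp1 : 1 < p) (hp2 : p ≤ 2) :
    ∃ C : ℝ, 0 < C ∧ ∀ f : ℝ → ℂ, MemLp f (ENNReal.ofReal p) (jacobiMeasure α β) →
      Integrable (farWeight α β • f) (jacobiMeasure α β) ∧
      eLpNorm (discMaxThree α β R₀ f) (ENNReal.ofReal p) (jacobiMeasure α β) ≤
        ENNReal.ofReal C * eLpNorm f (ENNReal.ofReal p) (jacobiMeasure α β) := by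
  have hα : -(1 / 2) < α := by linarith
  obtain ⟨C, hC, h⟩ := exists_discMaxThree_le hβ hαβ h1 h2
  set μ := jacobiMeasure α β with hμ
  set q := p.conjExponent with hq
  have hpq : p.HolderConjugate q := Real.HolderConjugate.conjExponent hp1
  have hq2 : 2 ≤ q := by
    rw [hq, Real.conjExponent, le_div_iff₀ (by linarith)]
    linarith
  have hg : MemLp (farWeight α β) (ENNReal.ofReal q) μ := memLp_farWeight hα hβ hq2
  have hw : MemLp (nearWeight α) (ENNReal.ofReal p) μ :=
    memLp_nearWeight hα hβ (by linarith) hp2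
  have : ENNReal.HolderConjugate (ENNReal.ofReal q) (ENNReal.ofReal p) :=
    hpq.symm.ennrealOfReal
  set G := eLpNorm (farWeight α β) (ENNReal.ofReal q) μ with hG
  set W := eLpNorm (nearWeight α) (ENNReal.ofReal p) μ with hW
  have hfin : ENNReal.ofReal C * G * W ≠ ⊤ :=
    ENNReal.mul_ne_top (ENNReal.mul_ne_top ENNReal.ofReal_ne_top hg.2.ne) hw.2.ne
  refine ⟨(ENNReal.ofReal C * G * W).toReal + 1, by positivity, fun f hf => ?_⟩
  have hgf1 : MemLp (farWeight α β • f) 1 μ := hf.smul hg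
  have hgf : Integrable (farWeight α β • f) μ := memLp_one_iff_integrable.1 hgf1
  refine ⟨hgf, ?_⟩
  set J := ∫⁻ r, ‖(farWeight α β • f) r‖ₑ ∂μ with hJ
  have hJle : J ≤ G * eLpNorm f (ENNReal.ofReal p) μ := by
    rw [hJ, ← eLpNorm_one_eq_lintegral_enorm]
    exact eLpNorm_smul_le_mul_eLpNorm hf.1 hg.1
  have hJtop : ENNReal.ofReal C * J ≠ ⊤ := ENNReal.mul_ne_top ENNReal.ofReal_ne_top hgf.2.ne
  calc eLpNorm (discMaxThree α β R₀ f) (ENNReal.ofReal p) μ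
      ≤ eLpNorm ((ENNReal.ofReal C * J).toReal • nearWeight α) (ENNReal.ofReal p) μ := by
        refine eLpNorm_mono_enorm_ae ?_
        filter_upwards [ae_pos_jacobiMeasure] with t ht
        rw [Pi.smul_apply, enorm_smul, Real.enorm_of_nonneg ENNReal.toReal_nonneg,
          ENNReal.ofReal_toReal hJtop, enorm_eq_self]
        exact h f hgf t ht
    _ = ENNReal.ofReal C * J * W := by
        rw [eLpNorm_const_smul, Real.enorm_of_nonneg ENNReal.toReal_nonneg,
          ENNReal.ofReal_toReal hJtop]
    _ ≤ ENNReal.ofReal C * (G * eLpNorm f (ENNReal.ofReal p) μ) * W := by gcongr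
    _ = ENNReal.ofReal C * G * W * eLpNorm f (ENNReal.ofReal p) μ := by ring
    _ ≤ _ := by
        gcongr
        rw [ENNReal.le_ofReal_iff_toReal_le hfin (by positivity)]
        linarith

end MaximalOperator

end JacobiAnalysis

theorem mainTheorem8 (α β R₀ : ℝ) (hβ : -(1 / 2) < β) (hαβ : β < α)
    (hR₀ : 1 < R₀) (hR₀' : R₀ < Real.sqrt (Real.pi / 2)) :
    (∃ C : ℝ, 0 < C ∧ ∀ R t r : ℝ, 1 < R → 0 < t → t < R₀ / 2 → R₀ < r →
      ‖JacobiAnalysis.discKernel α β R t r‖ ≤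
        C * (Real.exp (-(JacobiAnalysis.rho α β * r)) / t ^ (α + 1 / 2) * (1 / r))) ∧
    (∀ p : ℝ, 1 < p → p ≤ 2 → ∃ C : ℝ, 0 < C ∧ ∀ f : ℝ → ℂ,
      MeasureTheory.MemLp f (ENNReal.ofReal p) (JacobiAnalysis.jacobiMeasure α β) →
        (∀ R t : ℝ, 0 < R → 0 < t →
          MeasureTheory.Integrable
            (fun r => JacobiAnalysis.discKernelThree α β R₀ R t r * f r)
            (JacobiAnalysis.jacobiMeasure α β)) ∧
        AEMeasurable (JacobiAnalysis.discMaxThree α β R₀ f)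
          (JacobiAnalysis.jacobiMeasure α β) ∧
        MeasureTheory.eLpNorm (JacobiAnalysis.discMaxThree α β R₀ f) (ENNReal.ofReal p)
            (JacobiAnalysis.jacobiMeasure α β) ≤
          ENNReal.ofReal C *
            MeasureTheory.eLpNorm f (ENNReal.ofReal p) (JacobiAnalysis.jacobiMeasure α β)) := by
  have h2 : R₀ < 2 := hR₀'.trans_le ((Real.sqrt_le_left (by norm_num)).2 (by
    linarith [Real.pi_le_four]))
  refine ⟨?_, fun p hp1 hp2 => ?_⟩
  · obtain ⟨C, hC, h⟩ := JacobiAnalysis.exists_norm_discKernel_le hβ hαβ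
    exact ⟨C, hC, fun R t r hR ht htR hr =>
      h R t r (by linarith) ht (by linarith) (by linarith) (by linarith)⟩
  · obtain ⟨C, hC, h⟩ := JacobiAnalysis.exists_eLpNorm_discMaxThree_le hβ hαβ hR₀ h2 hp1 hp2
    refine ⟨C, hC, fun f hf => ⟨fun R t hR ht => ?_, ?_, (h f hf).2⟩⟩
    · exact JacobiAnalysis.integrable_discKernelThree_mul hβ hαβ hR₀ h2 hf.1 (h f hf).1 hR.le ht
    · exact JacobiAnalysis.aemeasurable_discMaxThree hβ hαβ hR₀ h2 hf.1 (h f hf).1
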